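/- Let $\alpha\in[0,1)$ and $k\in\mathbb{Z}$. In $\mathfrak{h}=L^2(\mathbb{R}^-)\oplus L^2(\mathbb{R}^+)$ consider $A_\alpha(k)=A_\alpha^-(k)\oplus A_\alpha^+(k)$, where $A^\pm_\alpha(k)$ is the differential operator $-\frac{d^2}{dx^2}+k^2|x|^{2\alpha}+\frac{\alpha(2+\alpha)}{4x^2}$ in $L^2(\mathbb{R}^\pm)$ with domain $C^\infty_c(\mathbb{R}^\pm)$. On $(0,\infty)$ set, for $k\neq0$, $$\Phi_{\alpha,k}(x)=\sqrt{\tfrac{\pi(1+\alpha)}{2|k|}}\,x^{-\frac\alpha2}e^{-\frac{|k|}{1+\alpha}x^{1+\alpha}},\qquad F_{\alpha,k}(x)=\sqrt{\tfrac{2(1+\alpha)}{\pi|k|}}\,x^{-\frac\alpha2}\sinh\big(\tfrac{|k|}{1+\alpha}x^{1+\alpha}\big),\qquad W=1+\alpha ,$$ and, for $k=0$, in terms of the modified Bessel functions, $\Phi_{\alpha,0}(x)=\sqrt{x}\,K_{\frac{1+\alpha}2}(x)$, $F_{\alpha,0}(x)=\sqrt{x}\,I_{\frac{1+\alpha}2}(x)$,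 $W=1$. Let $$\Psi_{\alpha,k}(x)=\frac1W\Big(\Phi_{\alpha,k}(x)\int_0^xF_{\alpha,k}\Phi_{\alpha,k}\,d\rho+F_{\alpha,k}(x)\int_x^\infty\Phi_{\alpha,k}^2\,d\rho\Big),\qquad N_k=\int_0^\infty\Phi_{\alpha,k}^2\,dx,$$ $\widetilde\Phi_{\alpha,k}(x)=\Phi_{\alpha,k}(|x|)$ and $\widetilde\Psi_{\alpha,k}(x)=\Psi_{\alpha,k}(|x|)$. Then $\widetilde\Phi_{\alpha,k},\widetilde\Psi_{\alpha,k}\in L^2(\mathbb{R})$, and the elements of $\mathcal{D}(A_\alpha(k)^*)$ are precisely the $g=(g^-,g^+)\in\mathfrak{h}$ of the form $$g^\pm=\widetilde\varphi^\pm+c_1^\pm\widetilde\Psi_{\alpha,k}+c_0^\pm\widetilde\Phi_{\alpha,k},\qquad\widetilde\varphi^\pm\in\mathcal{D}(\overline{A_\alpha^\pm(k)}),\quad c_0^\pm,c_1^\pm\in\mathbb{C},\qquad(\ast)$$ with $\widetilde\varphi^\pm,c_0^\pm,c_1^\pm$ uniquely determined by $g$. For $g\in\mathcal{D}(A_\alpha(k)^*)$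 let $g_0^\pm=\lim_{x\to0^\pm}|x|^{\frac\alpha2}g^\pm(x)$ and $g_1^\pm=\lim_{x\to0^\pm}|x|^{-(1+\frac\alpha2)}(g^\pm(x)-g_0^\pm|x|^{-\frac\alpha2})$. Let $A_{\alpha,R}^{[\gamma]}(k)$, $A_{\alpha,L}^{[\gamma]}(k)$, $A_{\alpha,a}^{[\gamma]}(k)$, $A_\alpha^{[\Gamma]}(k)$ ($\gamma\in\mathbb{R}$, $a\in\mathbb{C}$, $\Gamma=(\gamma_1,\gamma_2,\gamma_3,\gamma_4)\in\mathbb{R}^4$) be the restrictions of $A_\alpha(k)^*$ to those $g$ satisfying, respectively, - $g_0^-=0$, $g_1^+=\gamma g_0^+$ (family $\mathrm{I_R}$); - $g_0^+=0$, $g_1^-=\gamma g_0^-$ (family $\mathrm{I_L}$); - $g_0^+=a\,g_0^-$, $g_1^-+\overline a\,g_1^+=\gamma g_0^-$ (family $\mathrm{II}_a$; for $a=0$ it is family $\mathrm{I_L}$); - $g_1^-=\gamma_1g_0^-+(\gamma_2+\mathrm{i}\gamma_3)g_0^+$, $g_1^+=(\gamma_2-\mathrm{i}\gamma_3)g_0^-+\gamma_4g_0^+$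 (family $\mathrm{III}$). The Friedrichs extension $A_{\alpha,F}(k)$ of $A_\alpha(k)$ is the orthogonal sum of the Friedrichs extensions of $A_\alpha^-(k)$ and $A_\alpha^+(k)$. The self-adjoint extensions of $A_\alpha(k)$ in $\mathfrak{h}$ are exactly $A_{\alpha,F}(k)$ and the members of the families $\mathrm{I_R}$, $\mathrm{I_L}$, $\mathrm{II}_a$ with $a\in\mathbb{C}\setminus\{0\}$, and $\mathrm{III}$. Moreover, with respect to $(\ast)$, the domains are characterised as follows. - Friedrichs: $\mathcal{D}(A_{\alpha,F}(k))=\{g\in\mathcal{D}(A_\alpha(k)^*)\mid c_0^-=c_0^+=0\}$. - $\mathrm{I_R}$: $\mathcal{D}(A_{\alpha,R}^{[\gamma]}(k))=\{g\in\mathcal{D}(A_\alpha(k)^*)\mid c_0^-=0,\ c_1^+=\beta c_0^+\}$. - $\mathrm{I_L}$: $\mathcal{D}(A_{\alpha,L}^{[\gamma]}(k))=\{g\in\mathcal{D}(A_\alpha(k)^*)\mid c_0^+=0,\ c_1^-=\beta c_0^-\}$. - $\mathrm{II}_a$ with $a\neq0$: $\mathcal{D}(A_{\alpha,a}^{[\gamma]}(k))$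 consists of those $g\in\mathcal{D}(A_\alpha(k)^*)$ for which there are $c_0,\widetilde c_0\in\mathbb{C}$ with $(c_0^-,c_0^+)=(c_0,a c_0)$ and $(c_1^-,c_1^+)=(\tau c_0+\widetilde c_0,\ \tau c_0a-\widetilde c_0\,\overline a^{-1})$. - $\mathrm{III}$: $\mathcal{D}(A_\alpha^{[\Gamma]}(k))$ consists of those $g\in\mathcal{D}(A_\alpha(k)^*)$ for which $$\begin{pmatrix}c_1^-\\c_1^+\end{pmatrix}=\begin{pmatrix}\tau_1&\tau_2+\mathrm{i}\tau_3\\\tau_2-\mathrm{i}\tau_3&\tau_4\end{pmatrix}\begin{pmatrix}c_0^-\\c_0^+\end{pmatrix}.$$ Here the real parameters $\beta$, $\tau$, $(\tau_1,\dots,\tau_4)$ are in one-to-one correspondence with $\gamma$, $\gamma$ (for each fixed $a$), $\Gamma$, respectively, as follows. If $k\neq0$: - $\gamma=\frac{|k|}{1+\alpha}\big(\frac{2N_k}{\pi(1+\alpha)}\beta-1\big)$ for $\mathrm{I_R}$ and $\mathrm{I_L}$; - $\gamma=(1+|a|^2)\frac{|k|}{1+\alpha}\big(\frac{2N_k}{\pi(1+\alpha)}\tau-1\big)$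 for $\mathrm{II}_a$; - $\gamma_j=\frac{|k|}{1+\alpha}\big(\frac{2N_k}{\pi(1+\alpha)}\tau_j-1\big)$ for $j=1,4$ and $\gamma_2+\mathrm{i}\gamma_3=(\tau_2+\mathrm{i}\tau_3)\frac{2|k|}{\pi(1+\alpha)^2}N_k$ for $\mathrm{III}$. If $k=0$ (here $\Gamma(\cdot)$ is the Euler Gamma function): - $\gamma=\frac{N_0}{2^\alpha\Gamma(\frac{1+\alpha}2)\Gamma(\frac{3+\alpha}2)}\Big(\beta-\frac{\Gamma(\frac{1-\alpha}2)\Gamma(\frac{3+\alpha}2)}{(1+\alpha)N_0}\Big)$ for $\mathrm{I_R}$ and $\mathrm{I_L}$; - $\gamma=\frac{(1+|a|^2)\Gamma(\frac{1-\alpha}2)}{2^\alpha(1+\alpha)\Gamma(\frac{1+\alpha}2)}\Big(\frac{(1+\alpha)N_0}{\Gamma(\frac{3+\alpha}2)\Gamma(\frac{1-\alpha}2)}\tau-1\Big)$ for $\mathrm{II}_a$; - $\gamma_j=\frac{\Gamma(\frac{1-\alpha}2)}{2^\alpha(1+\alpha)\Gamma(\frac{1+\alpha}2)}\Big(\frac{(1+\alpha)N_0}{\Gamma(\frac{3+\alpha}2)\Gamma(\frac{1-\alpha}2)}\tau_j-1\Big)$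 for $j=1,4$ and $\gamma_2+\mathrm{i}\gamma_3=(\tau_2+\mathrm{i}\tau_3)\frac{N_0}{2^\alpha\Gamma(\frac{3+\alpha}2)\Gamma(\frac{1+\alpha}2)}$ for $\mathrm{III}$. -/

import Mathlib

open MeasureTheory Set Filter Topology
open scoped ContDiff ComplexConjugate

noncomputable section

namespace Grushin

/-! ### General operator theory -/

/-- The orthogonal sum `A ⊕ B` of two operators, with domain `D(A) ⊞ D(B)`. -/
def orthSum {E F : Type*} [NormedAddCommGroup E] [InnerProductSpace ℂ E]
    [NormedAddCommGroup F] [InnerProductSpace ℂ F]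
    (A : E →ₗ.[ℂ] E) (B : F →ₗ.[ℂ] F) : WithLp 2 (E × F) →ₗ.[ℂ] WithLp 2 (E × F) where
  domain :=
    { carrier := {x | x.fst ∈ A.domain ∧ x.snd ∈ B.domain}
      add_mem' := fun hx hy => ⟨A.domain.add_mem hx.1 hy.1, B.domain.add_mem hx.2 hy.2⟩
      zero_mem' := ⟨A.domain.zero_mem, B.domain.zero_mem⟩
      smul_mem' := fun c _ hx => ⟨A.domain.smul_mem c hx.1, B.domain.smul_mem c hx.2⟩ }
  toFun :=
    { toFun := fun x => WithLp.toLp 2 (A ⟨x.1.fst, x.2.1⟩, B ⟨x.1.snd, x.2.2⟩)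
      map_add' := fun x y => by
        rw [← WithLp.toLp_add, Prod.mk_add_mk, ← LinearPMap.map_add, ← LinearPMap.map_add]
        rfl
      map_smul' := fun c x => by
        rw [RingHom.id_apply, ← WithLp.toLp_smul, Prod.smul_mk, ← LinearPMap.map_smul,
          ← LinearPMap.map_smul]
        rfl }

variable {E : Type*} [NormedAddCommGroup E] [InnerProductSpace ℂ E] [CompleteSpace E]

/-- `B` is a self-adjoint extension of `A`. -/
def IsSelfAdjointExtension (A B : E →ₗ.[ℂ] E) : Prop :=
  A ≤ B ∧ IsSelfAdjoint B

/-- `g` lies in the form domain of the Friedrichs extension of the densely defined non-negative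
symmetric operator `A`: it is the limit of a sequence in `D(A)` that is Cauchy for the quadratic
form `u ↦ ⟨u, A u⟩`. -/
def MemFormDomain (A : E →ₗ.[ℂ] E) (g : E) : Prop :=
  ∃ u : ℕ → A.domain, Tendsto (fun n => (u n : E)) atTop (𝓝 g) ∧
    ∀ ε > 0, ∃ N, ∀ m ≥ N, ∀ n ≥ N,
      ‖inner ℂ ((u m - u n : A.domain) : E) (A (u m - u n))‖ < ε

/-- `F` is the Friedrichs extension of the densely defined non-negative symmetric operator `A`:
the restriction of `A*` to the vectors of `D(A*)` that lie in the form domain. -/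
def IsFriedrichsExtension (A F : E →ₗ.[ℂ] E) : Prop :=
  F ≤ A.adjoint ∧ ∀ g, g ∈ F.domain ↔ g ∈ A.adjoint.domain ∧ MemFormDomain A g

/-! ### The minimal operators on the two half-fibres and on the bilateral fibre -/

/-- `L²(U, dx)`. -/
abbrev L2 (U : Set ℝ) : Type := Lp ℂ 2 (volume.restrict U)

/-- `C_c^∞(U)`. -/
def testFn (U : Set ℝ) : Submodule ℂ (ℝ → ℂ) where
  carrier := {φ | ContDiff ℝ ∞ φ ∧ HasCompactSupport φ ∧ tsupport φ ⊆ U}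
  add_mem' := fun {φ ψ} hφ hψ => ⟨hφ.1.add hψ.1, hφ.2.1.add hψ.2.1,
    (tsupport_add φ ψ).trans (union_subset hφ.2.2 hψ.2.2)⟩
  zero_mem' := ⟨contDiff_const, HasCompactSupport.zero, by simp [tsupport]⟩
  smul_mem' := fun c φ hφ => ⟨contDiff_const.smul hφ.1, hφ.2.1.smul_left,
    (closure_mono (Function.support_const_smul_subset c φ)).trans hφ.2.2⟩

/-- The potential `k² |x|^{2α} + α(2+α)/(4x²)`. -/
def potential (α : ℝ) (k : ℤ) (x : ℝ) : ℝ :=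
  (k : ℝ) ^ 2 * |x| ^ (2 * α) + α * (2 + α) / (4 * x ^ 2)

/-- The differential expression `- d²/dx² + k² |x|^{2α} + α(2+α)/(4x²)`. -/
def diffExpr (α : ℝ) (k : ℤ) (φ : ℝ → ℂ) (x : ℝ) : ℂ :=
  -deriv (deriv φ) x + (potential α k x : ℂ) * φ x

theorem testFn_memLp {U : Set ℝ} {φ : ℝ → ℂ} (hφ : φ ∈ testFn U) :
    MemLp φ 2 (volume.restrict U) :=
  (hφ.1.continuous.memLp_of_hasCompactSupport hφ.2.1).restrict U

theorem continuousOn_potential (α : ℝ) (k : ℤ) {U : Set ℝ} (h0 : (0 : ℝ) ∉ U) :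
    ContinuousOn (potential α k) U := by
  have hne : ∀ x ∈ U, x ≠ 0 := fun x hx h => h0 (h ▸ hx)
  unfold potential
  refine ContinuousOn.add (continuousOn_const.mul ?_) ?_
  · exact continuous_abs.continuousOn.rpow_const fun x hx => Or.inl (abs_ne_zero.mpr (hne x hx))
  · refine continuousOn_const.div (by fun_prop) fun x hx => ?_
    have := hne x hx
    positivity

theorem contDiff_deriv_testFn {φ : ℝ → ℂ} (h : ContDiff ℝ ∞ φ) : ContDiff ℝ ∞ (deriv φ) :=
  (contDiff_infty_iff_deriv.mp h).2

theorem diffExpr_memLp (α : ℝ) (k : ℤ) {U : Set ℝ} (hU : IsOpen U) (h0 : (0 : ℝ) ∉ U)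
    {φ : ℝ → ℂ} (hφ : φ ∈ testFn U) : MemLp (diffExpr α k φ) 2 (volume.restrict U) := by
  obtain ⟨hs, hc, ht⟩ := hφ
  have h2 := contDiff_deriv_testFn (contDiff_deriv_testFn hs)
  have e1 : MemLp (fun x => -deriv (deriv φ) x) 2 (volume.restrict U) :=
    ((h2.continuous.memLp_of_hasCompactSupport (p := 2) (μ := volume) hc.deriv.deriv).restrict U).neg
  have hc' : HasCompactSupport (fun x => (potential α k x : ℂ) * φ x) := hc.mul_left
  have hcont : Continuous (fun x => (potential α k x : ℂ) * φ x) := by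
    have hon : ContinuousOn (fun x => (potential α k x : ℂ) * φ x) U :=
      (Complex.continuous_ofReal.comp_continuousOn (continuousOn_potential α k h0)).mul
        hs.continuous.continuousOn
    refine hon.continuous_of_tsupport_subset hU ?_
    exact (tsupport_mul_subset_right (f := fun x => (potential α k x : ℂ)) (g := φ)).trans ht
  exact e1.add ((hcont.memLp_of_hasCompactSupport hc').restrict U)

/-- The inclusion of `C_c^∞(U)` into `L²(U)`. -/
def testIncl (U : Set ℝ) : testFn U →ₗ[ℂ] L2 U where
  toFun φ := (testFn_memLp φ.2).toLp φ.1
  map_add' φ ψ := MemLp.toLp_add (testFn_memLp φ.2) (testFn_memLp ψ.2)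
  map_smul' c φ := MemLp.toLp_const_smul c (testFn_memLp φ.2)

theorem testIncl_injective {U : Set ℝ} (hU : IsOpen U) : Function.Injective (testIncl U) := by
  intro φ ψ h
  have hae : φ.1 =ᵐ[volume.restrict U] ψ.1 :=
    (MemLp.toLp_eq_toLp_iff (testFn_memLp φ.2) (testFn_memLp ψ.2)).mp h
  have heq := Measure.eqOn_open_of_ae_eq hae hU φ.2.1.continuous.continuousOn
    ψ.2.1.continuous.continuousOn
  refine Subtype.ext (funext fun x => ?_)
  by_cases hx : x ∈ U
  · exact heq hx
  · rw [image_eq_zero_of_notMem_tsupport fun h => hx (φ.2.2.2 h),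
      image_eq_zero_of_notMem_tsupport fun h => hx (ψ.2.2.2 h)]

/-- The action of the differential expression, as a linear map `C_c^∞(U) → L²(U)`. -/
def testAction (α : ℝ) (k : ℤ) {U : Set ℝ} (hU : IsOpen U) (h0 : (0 : ℝ) ∉ U) :
    testFn U →ₗ[ℂ] L2 U where
  toFun φ := (diffExpr_memLp α k hU h0 φ.2).toLp _
  map_add' φ ψ := by
    rw [← MemLp.toLp_add]
    refine MemLp.toLp_congr _ _ (Eventually.of_forall fun x => ?_)
    have a1 : deriv (φ.1 + ψ.1) = deriv φ.1 + deriv ψ.1 := funext fun y =>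
      deriv_add (φ.2.1.differentiable (by simp) y) (ψ.2.1.differentiable (by simp) y)
    have a2 : deriv (deriv φ.1 + deriv ψ.1) x = deriv (deriv φ.1) x + deriv (deriv ψ.1) x :=
      deriv_add ((contDiff_deriv_testFn φ.2.1).differentiable (by simp) x)
        ((contDiff_deriv_testFn ψ.2.1).differentiable (by simp) x)
    simp only [diffExpr, Submodule.coe_add, a1, a2, Pi.add_apply]
    ring
  map_smul' c φ := by
    rw [RingHom.id_apply, ← MemLp.toLp_const_smul]
    refine MemLp.toLp_congr _ _ (Eventually.of_forall fun x => ?_)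
    have a1 : deriv (c • φ.1) = c • deriv φ.1 := funext fun y =>
      deriv_const_smul c (φ.2.1.differentiable (by simp) y)
    have a2 : deriv (c • deriv φ.1) x = c • deriv (deriv φ.1) x :=
      deriv_const_smul c ((contDiff_deriv_testFn φ.2.1).differentiable (by simp) x)
    simp only [diffExpr, Submodule.coe_smul, a1, a2, Pi.smul_apply, smul_eq_mul]
    ring

/-- The minimal operator in `L²(U)`: the differential expression with domain `C_c^∞(U)`. -/
def minOp (α : ℝ) (k : ℤ) {U : Set ℝ} (hU : IsOpen U) (h0 : (0 : ℝ) ∉ U) :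
    L2 U →ₗ.[ℂ] L2 U where
  domain := LinearMap.range (testIncl U)
  toFun := (testAction α k hU h0).comp
    (LinearEquiv.ofInjective (testIncl U) (testIncl_injective hU)).symm.toLinearMap

/-- `A_α⁻(k)` in `L²(ℝ⁻)`. -/
def opNeg (α : ℝ) (k : ℤ) : L2 (Iio 0) →ₗ.[ℂ] L2 (Iio 0) :=
  minOp α k isOpen_Iio self_notMem_Iio

/-- `A_α⁺(k)` in `L²(ℝ⁺)`. -/
def opPos (α : ℝ) (k : ℤ) : L2 (Ioi 0) →ₗ.[ℂ] L2 (Ioi 0) :=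
  minOp α k isOpen_Ioi self_notMem_Ioi

/-- The bilateral fibre `L²(ℝ⁻) ⊕ L²(ℝ⁺)`. -/
abbrev Fibre : Type := WithLp 2 (L2 (Iio 0) × L2 (Ioi 0))

/-- `A_α(k) = A_α⁻(k) ⊕ A_α⁺(k)`. -/
def op (α : ℝ) (k : ℤ) : Fibre →ₗ.[ℂ] Fibre := orthSum (opNeg α k) (opPos α k)

/-! ### The families of extensions, through the short-range behaviour at `x = 0` -/

/-- `g₀ = lim |x|^{α/2} g(x)` and `g₁ = lim |x|^{-(1+α/2)} (g(x) - g₀ |x|^{-α/2})` as `x → 0` inside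
`U`, where `g(x)` is the continuous representative of `g` on `U`. -/
def HasLimits (α : ℝ) {U : Set ℝ} (g : L2 U) (g₀ g₁ : ℂ) : Prop :=
  ∃ f : ℝ → ℂ, ContinuousOn f U ∧ g =ᵐ[volume.restrict U] f ∧
    Tendsto (fun x : ℝ => ((|x| ^ (α / 2) : ℝ) : ℂ) * f x) (𝓝[U] 0) (𝓝 g₀) ∧
    Tendsto (fun x : ℝ => ((|x| ^ (-(1 + α / 2)) : ℝ) : ℂ) *
      (f x - g₀ * ((|x| ^ (-(α / 2)) : ℝ) : ℂ))) (𝓝[U] 0) (𝓝 g₁)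

theorem HasLimits.zero (α : ℝ) (U : Set ℝ) : HasLimits α (0 : L2 U) 0 0 :=
  ⟨0, continuousOn_const, Lp.coeFn_zero _ _ _, by simp [tendsto_const_nhds],
    by simp [tendsto_const_nhds]⟩

theorem HasLimits.add {α : ℝ} {U : Set ℝ} {g h : L2 U} {g₀ g₁ h₀ h₁ : ℂ}
    (hg : HasLimits α g g₀ g₁) (hh : HasLimits α h h₀ h₁) :
    HasLimits α (g + h) (g₀ + h₀) (g₁ + h₁) := by
  obtain ⟨f, fc, fe, f0, f1⟩ := hg
  obtain ⟨f', fc', fe', f0', f1'⟩ := hh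
  refine ⟨f + f', fc.add fc', (Lp.coeFn_add g h).trans (fe.add fe'), ?_, ?_⟩
  · refine (f0.add f0').congr fun x => ?_
    simp only [Pi.add_apply]; ring
  · refine (f1.add f1').congr fun x => ?_
    simp only [Pi.add_apply]; ring

theorem HasLimits.smul {α : ℝ} {U : Set ℝ} {g : L2 U} {g₀ g₁ : ℂ} (c : ℂ)
    (hg : HasLimits α g g₀ g₁) : HasLimits α (c • g) (c * g₀) (c * g₁) := by
  obtain ⟨f, fc, fe, f0, f1⟩ := hg
  refine ⟨c • f, fc.const_smul c, (Lp.coeFn_smul c g).trans (fe.const_smul c), ?_, ?_⟩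
  · refine (f0.const_mul c).congr fun x => ?_
    simp only [Pi.smul_apply, smul_eq_mul]; ring
  · refine (f1.const_mul c).congr fun x => ?_
    simp only [Pi.smul_apply, smul_eq_mul]; ring

/-- The restriction of `A_α(k)*` to those `g` whose limits `((g₀⁻, g₀⁺), (g₁⁻, g₁⁺))` exist and
satisfy the linear boundary condition `L`. -/
def bdryExt (α : ℝ) (k : ℤ) (L : Submodule ℂ ((ℂ × ℂ) × (ℂ × ℂ))) : Fibre →ₗ.[ℂ] Fibre :=
  (op α k).adjoint.domRestrict
    { carrier := {g | ∃ t ∈ L, HasLimits α g.fst t.1.1 t.2.1 ∧ HasLimits α g.snd t.1.2 t.2.2}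
      add_mem' := fun ⟨t, ht, h1, h2⟩ ⟨s, hs, h3, h4⟩ =>
        ⟨t + s, L.add_mem ht hs, h1.add h3, h2.add h4⟩
      zero_mem' := ⟨0, L.zero_mem, HasLimits.zero _ _, HasLimits.zero _ _⟩
      smul_mem' := fun c _ ⟨t, ht, h1, h2⟩ => ⟨c • t, L.smul_mem c ht, h1.smul c, h2.smul c⟩ }

/-- Family `I_R`: `g₀⁻ = 0`, `g₁⁺ = γ g₀⁺`. -/
def extR (α : ℝ) (k : ℤ) (γ : ℝ) : Fibre →ₗ.[ℂ] Fibre :=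
  bdryExt α k
    { carrier := {t | t.1.1 = 0 ∧ t.2.2 = γ * t.1.2}
      add_mem' := fun {s t} hs ht => by
        simp only [mem_ofPred_eq, Prod.fst_add, Prod.snd_add] at *
        rw [hs.1, ht.1, hs.2, ht.2]; constructor <;> ring
      zero_mem' := by simp
      smul_mem' := fun c t ht => by
        simp only [mem_ofPred_eq, Prod.smul_fst, Prod.smul_snd, smul_eq_mul] at *
        rw [ht.1, ht.2]; constructor <;> ring }

/-- Family `I_L`: `g₀⁺ = 0`, `g₁⁻ = γ g₀⁻`. -/
def extL (α : ℝ) (k : ℤ) (γ : ℝ) : Fibre →ₗ.[ℂ] Fibre :=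
  bdryExt α k
    { carrier := {t | t.1.2 = 0 ∧ t.2.1 = γ * t.1.1}
      add_mem' := fun {s t} hs ht => by
        simp only [mem_ofPred_eq, Prod.fst_add, Prod.snd_add] at *
        rw [hs.1, ht.1, hs.2, ht.2]; constructor <;> ring
      zero_mem' := by simp
      smul_mem' := fun c t ht => by
        simp only [mem_ofPred_eq, Prod.smul_fst, Prod.smul_snd, smul_eq_mul] at *
        rw [ht.1, ht.2]; constructor <;> ring }

/-- Family `II_a`: `g₀⁺ = a g₀⁻`, `g₁⁻ + ā g₁⁺ = γ g₀⁻`. -/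
def extII (α : ℝ) (k : ℤ) (a : ℂ) (γ : ℝ) : Fibre →ₗ.[ℂ] Fibre :=
  bdryExt α k
    { carrier := {t | t.1.2 = a * t.1.1 ∧ t.2.1 + conj a * t.2.2 = γ * t.1.1}
      add_mem' := fun {s t} hs ht => by
        simp only [mem_ofPred_eq, Prod.fst_add, Prod.snd_add] at *
        exact ⟨by linear_combination hs.1 + ht.1, by linear_combination hs.2 + ht.2⟩
      zero_mem' := by simp
      smul_mem' := fun c t ht => by
        simp only [mem_ofPred_eq, Prod.smul_fst, Prod.smul_snd, smul_eq_mul] at *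
        exact ⟨by linear_combination c * ht.1, by linear_combination c * ht.2⟩ }

/-- Family `III`: `g₁⁻ = γ₁ g₀⁻ + ζ g₀⁺`, `g₁⁺ = ζ̄ g₀⁻ + γ₄ g₀⁺`, with `ζ = γ₂ + i γ₃` and
`Γ = (γ₁, γ₂, γ₃, γ₄)`. -/
def extIII (α : ℝ) (k : ℤ) (Γ : Fin 4 → ℝ) : Fibre →ₗ.[ℂ] Fibre :=
  bdryExt α k
    { carrier := {t | t.2.1 = Γ 0 * t.1.1 + (Γ 1 + Complex.I * Γ 2) * t.1.2 ∧
        t.2.2 = (Γ 1 - Complex.I * Γ 2) * t.1.1 + Γ 3 * t.1.2}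
      add_mem' := fun {s t} hs ht => by
        simp only [mem_ofPred_eq, Prod.fst_add, Prod.snd_add] at *
        exact ⟨by linear_combination hs.1 + ht.1, by linear_combination hs.2 + ht.2⟩
      zero_mem' := by simp
      smul_mem' := fun c t ht => by
        simp only [mem_ofPred_eq, Prod.smul_fst, Prod.smul_snd, smul_eq_mul] at *
        exact ⟨by linear_combination c * ht.1, by linear_combination c * ht.2⟩ }

/-! ### The special functions -/

/-- The modified Bessel function `I_ν` on `(0,∞)`. -/
def besselI (ν x : ℝ) : ℝ :=
  ∑' m : ℕ, (x / 2) ^ (2 * (m : ℝ) + ν) / (m.factorial * Real.Gamma (m + ν + 1))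

/-- The modified Bessel function `K_ν` on `(0,∞)`, through its classical integral formula. -/
def besselK (ν x : ℝ) : ℝ :=
  ∫ t in Ioi (0 : ℝ), Real.exp (-x * Real.cosh t) * Real.cosh (ν * t)

/-- `Φ_{α,k}` on `(0,∞)`. -/
def Phi (α : ℝ) (k : ℤ) (x : ℝ) : ℝ :=
  if k = 0 then √x * besselK ((1 + α) / 2) x
  else √(Real.pi * (1 + α) / (2 * |(k : ℝ)|)) * x ^ (-(α / 2)) *
    Real.exp (-(|(k : ℝ)| / (1 + α) * x ^ (1 + α)))

/-- `F_{α,k}` on `(0,∞)`. -/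
def Fsol (α : ℝ) (k : ℤ) (x : ℝ) : ℝ :=
  if k = 0 then √x * besselI ((1 + α) / 2) x
  else √(2 * (1 + α) / (Real.pi * |(k : ℝ)|)) * x ^ (-(α / 2)) *
    Real.sinh (|(k : ℝ)| / (1 + α) * x ^ (1 + α))

/-- The Wronskian of `Φ_{α,k}` and `F_{α,k}`. -/
def wronskian (α : ℝ) (k : ℤ) : ℝ := if k = 0 then 1 else 1 + α

/-- The Green function `G_{α,k}`. -/
def green (α : ℝ) (k : ℤ) (r ρ : ℝ) : ℝ :=
  (wronskian α k)⁻¹ * if ρ < r then Phi α k r * Fsol α k ρ else Fsol α k r * Phi α k ρ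

/-- `Ψ_{α,k} = R_{G_{α,k}} Φ_{α,k}` on `(0,∞)`. -/
def Psi (α : ℝ) (k : ℤ) (x : ℝ) : ℝ :=
  ∫ ρ in Ioi (0 : ℝ), green α k x ρ * Phi α k ρ

/-- `Φ̃_{α,k}(x) = Φ_{α,k}(|x|)`. -/
def PhiT (α : ℝ) (k : ℤ) (x : ℝ) : ℂ := (Phi α k |x| : ℂ)

/-- `Ψ̃_{α,k}(x) = Ψ_{α,k}(|x|)`. -/
def PsiT (α : ℝ) (k : ℤ) (x : ℝ) : ℂ := (Psi α k |x| : ℂ)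

/-- `‖Φ_{α,k}‖²` in `L²(ℝ⁺)`. -/
def normSqPhi (α : ℝ) (k : ℤ) : ℝ := ∫ x in Ioi (0 : ℝ), Phi α k x ^ 2

/-- The representation
`g = (φ̃⁻, φ̃⁺) + (c₁⁻ Ψ̃_{α,k}, c₁⁺ Ψ̃_{α,k}) + (c₀⁻ Φ̃_{α,k}, c₀⁺ Φ̃_{α,k})` with `φ̃^±` in the domain
of the closure of `A_α^±(k)`, where `c₀ = (c₀⁻, c₀⁺)` and `c₁ = (c₁⁻, c₁⁺)`. -/
def IsRep (α : ℝ) (k : ℤ) (g φ : Fibre) (c₀ c₁ : ℂ × ℂ) : Prop :=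
  φ.fst ∈ (opNeg α k).closure.domain ∧ φ.snd ∈ (opPos α k).closure.domain ∧
  (g.fst =ᵐ[volume.restrict (Iio 0)]
    fun x => φ.fst x + c₁.1 * PsiT α k x + c₀.1 * PhiT α k x) ∧
  (g.snd =ᵐ[volume.restrict (Ioi 0)]
    fun x => φ.snd x + c₁.2 * PsiT α k x + c₀.2 * PhiT α k x)

/-! ### The relations between the two sets of parameters -/

/-- `γ` in terms of `β`, for the families `I_R` and `I_L`. -/
def gammaI (α : ℝ) (k : ℤ) (β : ℝ) : ℝ :=
  if k = 0 then
    normSqPhi α 0 / ((2 : ℝ) ^ α * Real.Gamma ((1 + α) / 2) * Real.Gamma ((3 + α) / 2)) *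
      (β - Real.Gamma ((1 - α) / 2) * Real.Gamma ((3 + α) / 2) / ((1 + α) * normSqPhi α 0))
  else |(k : ℝ)| / (1 + α) * (2 * normSqPhi α k / (Real.pi * (1 + α)) * β - 1)

/-- `γ` in terms of `τ`, for the family `II_a`. -/
def gammaII (α : ℝ) (k : ℤ) (a : ℂ) (τ : ℝ) : ℝ :=
  if k = 0 then
    (1 + ‖a‖ ^ 2) * Real.Gamma ((1 - α) / 2) /
        ((2 : ℝ) ^ α * (1 + α) * Real.Gamma ((1 + α) / 2)) *
      ((1 + α) * normSqPhi α 0 / (Real.Gamma ((3 + α) / 2) * Real.Gamma ((1 - α) / 2)) * τ - 1)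
  else (1 + ‖a‖ ^ 2) * (|(k : ℝ)| / (1 + α)) *
    (2 * normSqPhi α k / (Real.pi * (1 + α)) * τ - 1)

/-- The diagonal entries `γ₁`, `γ₄` in terms of `τ₁`, `τ₄`, for the family `III`. -/
def gammaDiag (α : ℝ) (k : ℤ) (τ : ℝ) : ℝ :=
  if k = 0 then
    Real.Gamma ((1 - α) / 2) / ((2 : ℝ) ^ α * (1 + α) * Real.Gamma ((1 + α) / 2)) *
      ((1 + α) * normSqPhi α 0 / (Real.Gamma ((3 + α) / 2) * Real.Gamma ((1 - α) / 2)) * τ - 1)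
  else |(k : ℝ)| / (1 + α) * (2 * normSqPhi α k / (Real.pi * (1 + α)) * τ - 1)

/-- `γ₂` and `γ₃` in terms of `τ₂` and `τ₃`, for the family `III`. -/
def gammaOff (α : ℝ) (k : ℤ) (τ : ℝ) : ℝ :=
  if k = 0 then
    τ * (normSqPhi α 0 / ((2 : ℝ) ^ α * Real.Gamma ((3 + α) / 2) * Real.Gamma ((1 + α) / 2)))
  else τ * (2 * |(k : ℝ)| / (Real.pi * (1 + α) ^ 2) * normSqPhi α k)

/-- `Γ = (γ₁, γ₂, γ₃, γ₄)` in terms of `(τ₁, τ₂, τ₃, τ₄)`, for the family `III`. -/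
def gammaIII (α : ℝ) (k : ℤ) (τ : Fin 4 → ℝ) : Fin 4 → ℝ :=
  ![gammaDiag α k (τ 0), gammaOff α k (τ 1), gammaOff α k (τ 2), gammaDiag α k (τ 3)]

/-- The Hermitian matrix `T` with entries `τ₁`, `τ₂ + i τ₃`, `τ₂ - i τ₃`, `τ₄`. -/
def matT (τ : Fin 4 → ℝ) : Matrix (Fin 2) (Fin 2) ℂ :=
  !![(τ 0 : ℂ), τ 1 + Complex.I * τ 2; τ 1 - Complex.I * τ 2, (τ 3 : ℂ)]

end Grushin

end

open MeasureTheory Set Filter Topology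
open scoped ContDiff ComplexConjugate

noncomputable section

set_option linter.unusedSectionVars false

namespace Grushin

/-! On each half-line put T = A + λ, with A the minimal operator and λ = 1 for k = 0, λ = 0
otherwise, so that T is coercive. Near the origin the solutions of Ty = 0 behave like |x|^(-α/2) and
|x|^(1+α/2), both square-integrable because α < 1; at infinity only the multiples of Φ are. Hence
ker T* is spanned by Φ, while Ψ solves T*Ψ = Φ. By coercivity the closure of T has closed range,
with orthogonal complement ℂΦ, and this yields the direct decomposition D(A*) = D(Ā) + ℂΨ + ℂΦ
(`DeficiencyData.exists_rep`, `DeficiencyData.rep_eq_zero`).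

The boundary values are read off this decomposition. An element of D(Ā) is recovered from its image
under T̄ by variation of constants, hence is O(|x|^(3/2)) and has both boundary values zero
(`SolPair.hasLimits_of_tendsto`). Ψ is a function of the same kind plus a multiple of the second
solution F, so it only contributes to g₁. With Φ ~ a|x|^(-α/2) - κa|x|^(1+α/2) this gives g₀ = a c₀
and g₁ = a(m c₁ - κ c₀), where m = ‖Φ‖²/(a²(1+α)) (`HalfLineData.Rep.hasLimits`). All parameter
formulas are instances of the affine change γ = mβ - κ (`ParamRelation`).

In these coordinates the boundary form of A* is (1+α) times the standard symplectic form on ℂ⁴, and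
the trace map is onto. Self-adjoint extensions therefore correspond to Lagrangian subspaces
(`IsTrace.isSelfAdjointExtension_iff`). A Lagrangian subspace is classified by its projection to the
components (g₀⁻, g₀⁺): dimension two gives III, dimension one gives I_R, I_L or II_a, dimension zero
gives Friedrichs (`isLagrangian_iff`).

For the Friedrichs extension, functions of finite energy are O(√|x|) at the origin, which forces c₀
= 0 (`eq_zero_of_memFormDomain`). Conversely, energy minimisation produces a solution of T*ψ = Φ in
the form domain, and it can only be Ψ (`DeficiencyData.memFormDomain_psi`).

What is needed about the special functions is collected in `SolPair`. It is checked on explicit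
exponentials for k ≠ 0 and, for k = 0, on the integral formula for K and the power series of I. The
negative half-line follows by reflection. -/

/-! ### Symmetric operators with a one-dimensional deficiency space -/

section Abstract

variable {E : Type*} [NormedAddCommGroup E] [InnerProductSpace ℂ E] [CompleteSpace E]

/-- `A` is symmetric and `T = A + lam` is coercive, with `ker T* = ℂ Φ` and `T* Ψ = Φ`. -/
structure DeficiencyData (A : E →ₗ.[ℂ] E) (lam : ℝ) (Φ Ψ : E) : Prop where
  dense : Dense (A.domain : Set E)
  symm : ∀ u v : A.domain, inner ℂ (A u) (v : E) = inner ℂ (u : E) (A v)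
  nonneg : ∀ u : A.domain, 0 ≤ (inner ℂ (u : E) (A u)).re
  lam_nonneg : 0 ≤ lam
  coercive : ∃ c > 0, ∀ u : A.domain,
    c * ‖(u : E)‖ ^ 2 ≤ (inner ℂ (u : E) (A u)).re + lam * ‖(u : E)‖ ^ 2
  phi : ∀ u : A.domain, inner ℂ Φ (A u + (lam : ℂ) • (u : E)) = 0
  psi : ∀ u : A.domain, inner ℂ Ψ (A u + (lam : ℂ) • (u : E)) = inner ℂ Φ (u : E)
  ker : ∀ g : E, (∀ u : A.domain, inner ℂ g (A u + (lam : ℂ) • (u : E)) = 0) → ∃ c : ℂ, g = c • Φ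
  phi_ne : Φ ≠ 0
  real : inner ℂ Ψ Φ = inner ℂ Φ Ψ

theorem le_adjoint_of_symm {A : E →ₗ.[ℂ] E} (hd : Dense (A.domain : Set E))
    (hs : ∀ u v : A.domain, inner ℂ (A u) (v : E) = inner ℂ (u : E) (A v)) : A ≤ A.adjoint :=
  LinearPMap.IsFormalAdjoint.le_adjoint hd hs

theorem isClosable_of_symm {A : E →ₗ.[ℂ] E} (hd : Dense (A.domain : Set E))
    (hs : ∀ u v : A.domain, inner ℂ (A u) (v : E) = inner ℂ (u : E) (A v)) : A.IsClosable :=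
  (LinearPMap.adjoint_isClosed hd).isClosable.leIsClosable (le_adjoint_of_symm hd hs)

theorem mem_closure_domain_iff {A : E →ₗ.[ℂ] E} (hA : A.IsClosable) (g : E) :
    g ∈ A.closure.domain ↔ ∃ (u : ℕ → A.domain) (h : E),
      Tendsto (fun n => (u n : E)) atTop (𝓝 g) ∧ Tendsto (fun n => A (u n)) atTop (𝓝 h) := by
  have key : ∀ h, (g, h) ∈ A.closure.graph ↔ ∃ u : ℕ → A.domain,
      Tendsto (fun n => (u n : E)) atTop (𝓝 g) ∧ Tendsto (fun n => A (u n)) atTop (𝓝 h) := by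
    intro h
    rw [← hA.graph_closure_eq_closure_graph, ← SetLike.mem_coe, Submodule.topologicalClosure_coe,
      mem_closure_iff_seq_limit]
    constructor
    · rintro ⟨x, hx, hl⟩
      have hx' : ∀ n, ∃ y : A.domain, ((y : E), A y) = x n := fun n =>
        (LinearPMap.mem_graph_iff' A).mp (hx n)
      choose y hy using hx'
      refine ⟨y, ?_, ?_⟩
      · have := (continuous_fst.tendsto (g, h)).comp hl
        refine this.congr fun n => ?_
        simp [← hy n]
      · have := (continuous_snd.tendsto (g, h)).comp hl
        refine this.congr fun n => ?_
        simp [← hy n]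
    · rintro ⟨u, h1, h2⟩
      exact ⟨fun n => ((u n : E), A (u n)), fun n => LinearPMap.mem_graph A (u n),
        h1.prodMk_nhds h2⟩
  constructor
  · intro hg
    obtain ⟨u, h1, h2⟩ := (key (A.closure ⟨g, hg⟩)).mp (LinearPMap.mem_graph _ ⟨g, hg⟩)
    exact ⟨u, _, h1, h2⟩
  · rintro ⟨u, h, h1, h2⟩
    exact LinearPMap.mem_domain_of_mem_graph ((key h).mpr ⟨u, h1, h2⟩)

theorem mem_adjoint_iff_exists {A : E →ₗ.[ℂ] E} (hd : Dense (A.domain : Set E)) (g : E) :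
    g ∈ A.adjoint.domain ↔ ∃ w : E, ∀ x : A.domain, inner ℂ w (x : E) = inner ℂ g (A x) :=
  ⟨fun hg => ⟨A.adjoint ⟨g, hg⟩, fun x => LinearPMap.adjoint_isFormalAdjoint hd ⟨g, hg⟩ x⟩,
    LinearPMap.mem_adjoint_domain_of_exists g⟩

variable {A : E →ₗ.[ℂ] E} {lam : ℝ} {Φ Ψ : E}

namespace DeficiencyData

/-- `y = T* x`. -/
def Shift (A : E →ₗ.[ℂ] E) (lam : ℝ) (x y : E) : Prop :=
  ∀ v : A.domain, inner ℂ y (v : E) = inner ℂ x (A v + (lam : ℂ) • (v : E))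

theorem isClosable (D : DeficiencyData A lam Φ Ψ) : A.IsClosable := isClosable_of_symm D.dense D.symm

/-- Since λ is real, T* = A* + λ on the domain of A*. As a relation, `Shift` can be added and scaled
without carrying domain memberships along. -/
theorem shift_iff (D : DeficiencyData A lam Φ Ψ) (x y : E) :
    Shift A lam x y ↔ ∃ hx : x ∈ A.adjoint.domain, A.adjoint ⟨x, hx⟩ = y - (lam : ℂ) • x := by
  have aux : ∀ v : A.domain, inner ℂ x (A v + (lam : ℂ) • (v : E)) =
      inner ℂ x (A v) + inner ℂ ((lam : ℂ) • x) (v : E) := fun v => by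
    rw [inner_add_right, inner_smul_right, inner_smul_left, Complex.conj_ofReal]
  constructor
  · intro h
    have h' : ∀ v : A.domain, inner ℂ (y - (lam : ℂ) • x) (v : E) = inner ℂ x (A v) := fun v => by
      rw [inner_sub_left, h v, aux v]; ring
    have hx : x ∈ A.adjoint.domain := LinearPMap.mem_adjoint_domain_of_exists x ⟨_, h'⟩
    exact ⟨hx, LinearPMap.adjoint_apply_eq D.dense ⟨x, hx⟩ h'⟩
  · rintro ⟨hx, h⟩ v
    have := LinearPMap.adjoint_isFormalAdjoint D.dense ⟨x, hx⟩ v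
    rw [aux v, ← this, h, inner_sub_left]; ring

/-- The elements of the domain of the closure of `A`, through approximating sequences. -/
def Approx (A : E →ₗ.[ℂ] E) (lam : ℝ) (φ r : E) : Prop :=
  ∃ u : ℕ → A.domain, Tendsto (fun n => (u n : E)) atTop (𝓝 φ) ∧
    Tendsto (fun n => A (u n) + (lam : ℂ) • (u n : E)) atTop (𝓝 r)

theorem mem_closure_iff (D : DeficiencyData A lam Φ Ψ) (φ : E) :
    φ ∈ A.closure.domain ↔ ∃ r, Approx A lam φ r := by
  rw [mem_closure_domain_iff D.isClosable]
  constructor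
  · rintro ⟨u, h, h1, h2⟩
    exact ⟨_, u, h1, h2.add (h1.const_smul _)⟩
  · rintro ⟨r, u, h1, h2⟩
    refine ⟨u, r - (lam : ℂ) • φ, h1, (h2.sub (h1.const_smul (lam : ℂ))).congr fun n => ?_⟩
    abel

/-- The defining identity of T*, known on D(A), extends to the closure of T by continuity of the
inner product. -/
theorem Shift.inner_approx {x y φ r : E} (h : Shift A lam x y) (hφ : Approx A lam φ r) :
    inner ℂ y φ = inner ℂ x r := by
  obtain ⟨u, h1, h2⟩ := hφ
  have e1 : Tendsto (fun n => inner ℂ y (u n : E)) atTop (𝓝 (inner ℂ y φ)) :=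
    tendsto_const_nhds.inner h1
  have e2 : Tendsto (fun n => inner ℂ x (A (u n) + (lam : ℂ) • (u n : E))) atTop
      (𝓝 (inner ℂ x r)) := tendsto_const_nhds.inner h2
  exact tendsto_nhds_unique e1 (e2.congr fun n => (h (u n)).symm)

theorem Shift.inner_approx' {x y φ r : E} (h : Shift A lam x y) (hφ : Approx A lam φ r) :
    inner ℂ φ y = inner ℂ r x := by
  rw [← inner_conj_symm, h.inner_approx hφ, inner_conj_symm]

theorem shift_self (D : DeficiencyData A lam Φ Ψ) (u : A.domain) :
    Shift A lam (u : E) (A u + (lam : ℂ) • (u : E)) := fun v => by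
  rw [inner_add_left, inner_add_right, D.symm, inner_smul_left, inner_smul_right,
    Complex.conj_ofReal]

theorem Approx.shift (D : DeficiencyData A lam Φ Ψ) {φ r : E} (h : Approx A lam φ r) :
    Shift A lam φ r := fun v => ((D.shift_self v).inner_approx' h).symm

theorem shift_phi (D : DeficiencyData A lam Φ Ψ) : Shift A lam Φ 0 := fun v => by
  rw [inner_zero_left, D.phi v]

theorem shift_psi (D : DeficiencyData A lam Φ Ψ) : Shift A lam Ψ Φ := fun v => (D.psi v).symm

theorem Shift.add {x y x' y' : E} (h : Shift A lam x y) (h' : Shift A lam x' y') :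
    Shift A lam (x + x') (y + y') := fun v => by
  rw [inner_add_left, inner_add_left, h v, h' v]

theorem Shift.smul {x y : E} (c : ℂ) (h : Shift A lam x y) : Shift A lam (c • x) (c • y) :=
  fun v => by rw [inner_smul_left, inner_smul_left, h v]

theorem Shift.unique (D : DeficiencyData A lam Φ Ψ) {x y y' : E} (h : Shift A lam x y)
    (h' : Shift A lam x y') : y = y' :=
  D.dense.eq_of_inner_left ℂ fun v hv => (h ⟨v, hv⟩).trans (h' ⟨v, hv⟩).symm

theorem shift_rep (D : DeficiencyData A lam Φ Ψ) {φ r : E} (h : Approx A lam φ r) (c₀ c₁ : ℂ) :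
    Shift A lam (φ + c₁ • Ψ + c₀ • Φ) (r + c₁ • Φ) := by
  simpa using ((h.shift D).add (D.shift_psi.smul c₁)).add (D.shift_phi.smul c₀)

theorem mem_adjoint_of_rep (D : DeficiencyData A lam Φ Ψ) {φ : E} (h : φ ∈ A.closure.domain)
    (c₀ c₁ : ℂ) : φ + c₁ • Ψ + c₀ • Φ ∈ A.adjoint.domain := by
  obtain ⟨r, hr⟩ := (D.mem_closure_iff φ).mp h
  exact ((D.shift_iff _ _).mp (D.shift_rep hr c₀ c₁)).1

theorem re_inner_shift (v : A.domain) : (inner ℂ (v : E) (A v)).re + lam * ‖(v : E)‖ ^ 2 =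
    (inner ℂ (v : E) (A v + (lam : ℂ) • (v : E))).re := by
  rw [inner_add_right, inner_smul_right, inner_self_eq_norm_sq_to_K, Complex.add_re,
    Complex.re_ofReal_mul]
  norm_cast

/-- Coercivity and Cauchy–Schwarz give c‖v‖ ≤ ‖Tv‖, so a sequence whose images converge is itself
Cauchy. In other words, the closure of T has closed range. -/
theorem mem_closure_of_tendsto (D : DeficiencyData A lam Φ Ψ) {u : ℕ → A.domain} {r : E}
    (h : Tendsto (fun n => A (u n) + (lam : ℂ) • (u n : E)) atTop (𝓝 r)) :
    ∃ φ, Approx A lam φ r := by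
  obtain ⟨c, hc, hco⟩ := D.coercive
  have bound : ∀ v : A.domain, ‖(v : E)‖ ≤ c⁻¹ * ‖A v + (lam : ℂ) • (v : E)‖ := by
    intro v
    have h2 := (hco v).trans_eq (re_inner_shift v)
    have h3 : (inner ℂ (v : E) (A v + (lam : ℂ) • (v : E))).re ≤
        ‖(v : E)‖ * ‖A v + (lam : ℂ) • (v : E)‖ :=
      (Complex.re_le_norm _).trans (norm_inner_le_norm _ _)
    rcases (norm_nonneg (v : E)).eq_or_lt with h0 | h0
    · rw [← h0]; positivity
    · have h4 : c * ‖(v : E)‖ ≤ ‖A v + (lam : ℂ) • (v : E)‖ := by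
        refine le_of_mul_le_mul_left ?_ h0
        calc ‖(v : E)‖ * (c * ‖(v : E)‖) = c * ‖(v : E)‖ ^ 2 := by ring
          _ ≤ _ := h2.trans h3
      rw [inv_mul_eq_div, le_div_iff₀ hc]
      linarith
  have hcs : CauchySeq fun n => (u n : E) := by
    have h1 := h.cauchySeq
    rw [Metric.cauchySeq_iff] at h1 ⊢
    intro ε hε
    obtain ⟨N, hN⟩ := h1 (c * ε) (by positivity)
    refine ⟨N, fun m hm n hn => ?_⟩
    have h2 := hN m hm n hn
    rw [dist_eq_norm] at h2 ⊢
    have h3 := bound (u m - u n)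
    have h4 : A (u m - u n) + (lam : ℂ) • ((u m - u n : A.domain) : E) =
        A (u m) + (lam : ℂ) • (u m : E) - (A (u n) + (lam : ℂ) • (u n : E)) := by
      rw [LinearPMap.map_sub, Submodule.coe_sub, smul_sub]; abel
    rw [h4, Submodule.coe_sub] at h3
    calc _ ≤ _ := h3
      _ < c⁻¹ * (c * ε) := by gcongr
      _ = ε := by field_simp
  obtain ⟨φ, hφ⟩ := cauchySeq_tendsto_of_complete hcs
  exact ⟨φ, u, hφ, h⟩

/-- Split T*g along the closure of ran T and its orthogonal complement, which is ker T* = ℂΦ. The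
first part is T̄φ with φ in D(Ā), because that range is closed; the second part is cΦ = T*(cΨ). What
is left of g after subtracting φ + cΨ is annihilated by T*. -/
theorem exists_rep (D : DeficiencyData A lam Φ Ψ) {g : E} (hg : g ∈ A.adjoint.domain) :
    ∃ φ ∈ A.closure.domain, ∃ c₀ c₁ : ℂ, g = φ + c₁ • Ψ + c₀ • Φ := by
  let R : Submodule ℂ E := (LinearMap.range (A.toFun + (lam : ℂ) • A.domain.subtype)).topologicalClosure
  have hRc : IsClosed (R : Set E) := Submodule.isClosed_topologicalClosure _
  have : CompleteSpace R := hRc.completeSpace_coe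
  set h : E := A.adjoint ⟨g, hg⟩ + (lam : ℂ) • g with hh
  have hsh : Shift A lam g h := (D.shift_iff g h).mpr ⟨hg, by rw [hh]; abel⟩
  obtain ⟨r, hr, s, hs, hrs⟩ := Submodule.exists_add_mem_mem_orthogonal (K := R) h
  obtain ⟨c, rfl⟩ : ∃ c : ℂ, s = c • Φ := by
    refine D.ker s fun u => ?_
    rw [Submodule.mem_orthogonal'] at hs
    exact hs _ (Submodule.le_topologicalClosure _ ⟨u, rfl⟩)
  have hr' : r ∈ _root_.closure
      ((LinearMap.range (A.toFun + (lam : ℂ) • A.domain.subtype) : Submodule ℂ E) : Set E) := by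
    rw [← Submodule.topologicalClosure_coe]; exact hr
  obtain ⟨x, hx, hxl⟩ := mem_closure_iff_seq_limit.mp hr'
  choose u hu using hx
  have hl : Tendsto (fun n => A (u n) + (lam : ℂ) • (u n : E)) atTop (𝓝 r) :=
    hxl.congr fun n => (hu n).symm
  obtain ⟨φ, hφ⟩ := D.mem_closure_of_tendsto hl
  -- The coefficient of Φ is set to 0 here: T* does not see it, and it is recovered from `ker` as
  -- `d`.
  have h1 : Shift A lam (g + (-1 : ℂ) • (φ + c • Ψ + (0 : ℂ) • Φ)) (h + (-1 : ℂ) • (r + c • Φ)) :=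
    hsh.add ((D.shift_rep hφ 0 c).smul _)
  have h2 : h + (-1 : ℂ) • (r + c • Φ) = 0 := by rw [hrs]; module
  rw [h2] at h1
  obtain ⟨d, hd⟩ := D.ker _ fun u => (h1 u).symm.trans (inner_zero_left _)
  refine ⟨φ, (D.mem_closure_iff φ).mpr ⟨r, hφ⟩, d, c, ?_⟩
  rw [← hd]; module

/-- Applying T* to the relation gives r + c₁Φ = 0 with r = T̄φ orthogonal to Φ, so c₁ = 0 and r = 0.
Coercivity then gives φ = 0, and Φ ≠ 0 gives c₀ = 0. -/
theorem rep_eq_zero (D : DeficiencyData A lam Φ Ψ) {φ : E} (hφ : φ ∈ A.closure.domain) {c₀ c₁ : ℂ}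
    (h : φ + c₁ • Ψ + c₀ • Φ = 0) : φ = 0 ∧ c₀ = 0 ∧ c₁ = 0 := by
  obtain ⟨r, hr⟩ := (D.mem_closure_iff φ).mp hφ
  have h0 : Shift A lam (0 : E) (0 : E) := fun v => by simp
  have h1 : r + c₁ • Φ = 0 := by
    refine Shift.unique D (x := 0) ?_ h0
    rw [← h]; exact D.shift_rep hr c₀ c₁
  have h2 : inner ℂ Φ r = 0 := by
    rw [← D.shift_phi.inner_approx hr, inner_zero_left]
  have hc1 : c₁ = 0 := by
    have h3 : inner ℂ Φ (r + c₁ • Φ) = 0 := by rw [h1, inner_zero_right]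
    rw [inner_add_right, h2, zero_add, inner_smul_right] at h3
    exact (mul_eq_zero.mp h3).resolve_right (inner_self_ne_zero.mpr D.phi_ne)
  subst hc1
  have hr0 : r = 0 := by simpa using h1
  obtain ⟨c, hc, hco⟩ := D.coercive
  have hφ0 : φ = 0 := by
    obtain ⟨u, hu1, hu2⟩ := hr
    have e1 : Tendsto (fun n => c * ‖(u n : E)‖ ^ 2) atTop (𝓝 (c * ‖φ‖ ^ 2)) :=
      (hu1.norm.pow 2).const_mul c
    have e2 : Tendsto (fun n => (inner ℂ (u n : E) (A (u n) + (lam : ℂ) • (u n : E))).re) atTop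
        (𝓝 (inner ℂ φ r).re) := (Complex.continuous_re.tendsto _).comp (hu1.inner hu2)
    have h5 : c * ‖φ‖ ^ 2 ≤ (inner ℂ φ r).re := by
      refine le_of_tendsto_of_tendsto' e1 e2 fun n => ?_
      exact (hco (u n)).trans_eq (re_inner_shift _)
    rw [hr0, inner_zero_right, Complex.zero_re] at h5
    have : ‖φ‖ ^ 2 ≤ 0 := by nlinarith
    have := pow_eq_zero_iff (two_ne_zero) |>.mp (le_antisymm this (sq_nonneg _))
    exact norm_eq_zero.mp this
  refine ⟨hφ0, ?_, rfl⟩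
  rw [hφ0] at h
  have : c₀ • Φ = 0 := by simpa using h
  exact (smul_eq_zero.mp this).resolve_right D.phi_ne

/-- The abstract Green formula. -/
theorem green (D : DeficiencyData A lam Φ Ψ) {φ χ : E} (hφ : φ ∈ A.closure.domain)
    (hχ : χ ∈ A.closure.domain) {c₀ c₁ d₀ d₁ : ℂ} {g f : A.adjoint.domain}
    (hg : (g : E) = φ + c₁ • Ψ + c₀ • Φ) (hf : (f : E) = χ + d₁ • Ψ + d₀ • Φ) :
    inner ℂ (A.adjoint g) (f : E) - inner ℂ (g : E) (A.adjoint f) =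
      (‖Φ‖ ^ 2 : ℝ) * (conj c₁ * d₀ - conj c₀ * d₁) := by
  obtain ⟨r, hr⟩ := (D.mem_closure_iff φ).mp hφ
  obtain ⟨s, hs⟩ := (D.mem_closure_iff χ).mp hχ
  have sg := D.shift_rep hr c₀ c₁
  have sf := D.shift_rep hs d₀ d₁
  obtain ⟨_, ag⟩ := (D.shift_iff _ _).mp sg
  obtain ⟨_, af⟩ := (D.shift_iff _ _).mp sf
  have ag' : A.adjoint g = r + c₁ • Φ - (lam : ℂ) • (g : E) := by
    rw [hg, ← ag]; congr 1; exact Subtype.ext hg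
  have af' : A.adjoint f = s + d₁ • Φ - (lam : ℂ) • (f : E) := by
    rw [hf, ← af]; congr 1; exact Subtype.ext hf
  have k1 := sg.inner_approx hs
  have k2 := sf.inner_approx' hr
  have k3 := D.shift_phi.inner_approx' hr
  have k4 := D.shift_psi.inner_approx' hr
  have k5 := D.shift_phi.inner_approx' hs
  have k6 := D.shift_psi.inner_approx hs
  -- The terms in conj c₁ · d₁ cancel because ⟨Ψ, Φ⟩ = ⟨Φ, Ψ⟩. Those with φ and χ cancel because T*
  -- is adjoint to T̄, and only ‖Φ‖² survives.
  have k7 := D.real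
  have kN : inner ℂ Φ Φ = ((‖Φ‖ ^ 2 : ℝ) : ℂ) := by
    rw [inner_self_eq_norm_sq_to_K]; norm_cast
  rw [ag', af', inner_sub_left, inner_sub_right, inner_smul_left, inner_smul_right, hg, hf,
    Complex.conj_ofReal]
  simp only [inner_add_left, inner_add_right, inner_smul_left, inner_smul_right, inner_zero_right]
    at k1 k2 k3 k4 k5 k6 ⊢
  rw [kN] at *
  rw [k7] at *
  linear_combination k1 + d₁ * (-k4) - d₀ * k3

end DeficiencyData

end Abstract

/-! ### Self-adjoint extensions through boundary values -/

section Lagrangian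

/-- The standard symplectic form on pairs of boundary values. -/
def sympl (t s : (ℂ × ℂ) × (ℂ × ℂ)) : ℂ :=
  conj t.2.1 * s.1.1 + conj t.2.2 * s.1.2 - conj t.1.1 * s.2.1 - conj t.1.2 * s.2.2

/-- `L` is its own symplectic complement. -/
def IsLagrangian (L : Submodule ℂ ((ℂ × ℂ) × (ℂ × ℂ))) : Prop :=
  ∀ t, t ∈ L ↔ ∀ s ∈ L, sympl t s = 0

variable {E : Type*} [NormedAddCommGroup E] [InnerProductSpace ℂ E] [CompleteSpace E]

/-- `Tr` is a boundary-value relation for `A*`. -/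
structure IsTrace (A : E →ₗ.[ℂ] E) (Tr : E → (ℂ × ℂ) × (ℂ × ℂ) → Prop) (K : ℂ) : Prop where
  dense : Dense (A.domain : Set E)
  symm : ∀ u v : A.domain, inner ℂ (A u) (v : E) = inner ℂ (u : E) (A v)
  exists_trace : ∀ g ∈ A.adjoint.domain, ∃ t, Tr g t
  onto : ∀ t, ∃ g ∈ A.adjoint.domain, Tr g t
  zero : Tr 0 0
  add : ∀ {g h t s}, Tr g t → Tr h s → Tr (g + h) (t + s)
  smul : ∀ (c : ℂ) {g t}, Tr g t → Tr (c • g) (c • t)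
  ne : K ≠ 0
  green : ∀ (g f : A.adjoint.domain) (t s), Tr g t → Tr f s →
    inner ℂ (A.adjoint g) (f : E) - inner ℂ (g : E) (A.adjoint f) = K * sympl t s

variable {A : E →ₗ.[ℂ] E} {Tr : E → (ℂ × ℂ) × (ℂ × ℂ) → Prop} {K : ℂ}

theorem eq_zero_of_sympl {t : (ℂ × ℂ) × (ℂ × ℂ)} (h : ∀ s, sympl t s = 0) : t = 0 := by
  obtain ⟨⟨a, b⟩, c, d⟩ := t
  have h1 := h ((1, 0), 0, 0)
  have h2 := h ((0, 1), 0, 0)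
  have h3 := h ((0, 0), 1, 0)
  have h4 := h ((0, 0), 0, 1)
  simp [sympl] at h1 h2 h3 h4
  simp [h1, h2, h3, h4]

/-- Green's identity turns adjoints into symplectic complements: a restriction B of A* containing A
is symmetric when its set of traces is isotropic, and D(B*) consists of the vectors of D(A*) whose
trace is orthogonal to that set. Self-adjointness is thus equality of the set with its complement.
-/
theorem IsTrace.isSelfAdjointExtension_iff (T : IsTrace A Tr K)
    (S : Submodule ℂ ((ℂ × ℂ) × (ℂ × ℂ)) → Submodule ℂ E)
    (hS : ∀ L g, g ∈ S L ↔ ∃ t ∈ L, Tr g t) (B : E →ₗ.[ℂ] E) :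
    IsSelfAdjointExtension A B ↔ ∃ L, IsLagrangian L ∧ B = A.adjoint.domRestrict (S L) := by
  have hAA := le_adjoint_of_symm T.dense T.symm
  -- The boundary form of an element of D(A) against any element of D(A*) is zero. As the traces
  -- exhaust ℂ⁴ and the symplectic form is nondegenerate, its trace is zero.
  have ext_trace : ∀ u ∈ A.domain, Tr u 0 := by
    intro u hu
    obtain ⟨t, ht⟩ := T.exists_trace u (hAA.1 hu)
    suffices t = 0 by rwa [this] at ht
    refine eq_zero_of_sympl fun s => ?_
    obtain ⟨f, hf, hs⟩ := T.onto s
    have h1 := T.green ⟨u, hAA.1 hu⟩ ⟨f, hf⟩ t s ht hs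
    have h2 : A.adjoint ⟨u, hAA.1 hu⟩ = A ⟨u, hu⟩ := (hAA.2 (x := ⟨u, hu⟩) rfl).symm
    have h3 := LinearPMap.adjoint_isFormalAdjoint T.dense ⟨f, hf⟩ ⟨u, hu⟩
    rw [h2, ← inner_conj_symm, ← h3, inner_conj_symm, sub_self] at h1
    exact (mul_eq_zero.mp h1.symm).resolve_left T.ne
  constructor
  · rintro ⟨hAB, hB⟩
    have hBd := hB.dense_domain
    have hBs : ∀ u v : B.domain, inner ℂ (B u) (v : E) = inner ℂ (u : E) (B v) := by
      have := LinearPMap.adjoint_isFormalAdjoint hBd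
      rw [LinearPMap.isSelfAdjoint_def.mp hB] at this
      exact this
    have hBA : B ≤ A.adjoint := by
      refine LinearPMap.IsFormalAdjoint.le_adjoint T.dense fun x y => ?_
      have h1 : A x = B ⟨x, hAB.1 x.2⟩ := hAB.2 rfl
      rw [h1]
      exact hBs ⟨x, hAB.1 x.2⟩ y
    let L : Submodule ℂ ((ℂ × ℂ) × (ℂ × ℂ)) :=
      { carrier := {t | ∃ g ∈ B.domain, Tr g t}
        add_mem' := fun ⟨g, hg, h1⟩ ⟨h, hh, h2⟩ => ⟨g + h, B.domain.add_mem hg hh, T.add h1 h2⟩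
        zero_mem' := ⟨0, B.domain.zero_mem, T.zero⟩
        smul_mem' := fun c _ ⟨g, hg, h1⟩ => ⟨c • g, B.domain.smul_mem c hg, T.smul c h1⟩ }
    have hL : ∀ t, t ∈ L ↔ ∃ g ∈ B.domain, Tr g t := fun t => Iff.rfl
    have greenB : ∀ g (hg : g ∈ A.adjoint.domain) (f : B.domain) t s, Tr g t → Tr f s →
        inner ℂ (A.adjoint ⟨g, hg⟩) (f : E) - inner ℂ g (B f) = K * sympl t s := by
      intro g hg f t s h1 h2
      rw [← T.green ⟨g, hg⟩ ⟨f, hBA.1 f.2⟩ t s h1 h2]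
      congr 2
      exact hBA.2 rfl
    -- Orthogonality of the trace to L means ⟨A*g, f⟩ = ⟨g, Bf⟩ for all f in D(B), so g lies in
    -- D(B*) = D(B).
    have memB : ∀ g (hg : g ∈ A.adjoint.domain) t, Tr g t → (∀ s ∈ L, sympl t s = 0) →
        g ∈ B.domain := by
      intro g hg t ht h
      rw [← LinearPMap.isSelfAdjoint_def.mp hB]
      refine LinearPMap.mem_adjoint_domain_of_exists g ⟨A.adjoint ⟨g, hg⟩, fun f => ?_⟩
      obtain ⟨s, hs⟩ := T.exists_trace f (hBA.1 f.2)
      have := greenB g hg f t s ht hs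
      rw [h s ⟨f, f.2, hs⟩, mul_zero] at this
      exact sub_eq_zero.mp this
    have isoL : ∀ t ∈ L, ∀ s ∈ L, sympl t s = 0 := by
      rintro t ⟨g, hg, hgt⟩ s ⟨f, hf, hfs⟩
      have h1 := greenB g (hBA.1 hg) ⟨f, hf⟩ t s hgt hfs
      have h2 : A.adjoint ⟨g, hBA.1 hg⟩ = B ⟨g, hg⟩ := (hBA.2 (x := ⟨g, hg⟩) rfl).symm
      rw [h2, hBs ⟨g, hg⟩ ⟨f, hf⟩, sub_self] at h1
      exact (mul_eq_zero.mp h1.symm).resolve_left T.ne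
    refine ⟨L, fun t => ⟨isoL t, fun h => ?_⟩, ?_⟩
    · obtain ⟨g, hg, ht⟩ := T.onto t
      exact ⟨g, memB g hg t ht h, ht⟩
    · have hle : B ≤ A.adjoint.domRestrict (S L) := by
        refine ⟨fun g hg => ⟨?_, hBA.1 hg⟩, fun x y hxy => ?_⟩
        · obtain ⟨t, ht⟩ := T.exists_trace g (hBA.1 hg)
          exact (hS L g).mpr ⟨t, ⟨g, hg, ht⟩, ht⟩
        · rw [hBA.2 (y := ⟨y, y.2.2⟩) hxy]
          exact (LinearPMap.domRestrict_le.2 (x := y) rfl).symm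
      refine LinearPMap.eq_of_le_of_domain_eq hle (le_antisymm hle.1 ?_)
      rintro g ⟨hg1, hg2⟩
      obtain ⟨t, htL, ht⟩ := (hS L g).mp hg1
      exact memB g hg2 t ht (isoL t htL)
  · rintro ⟨L, hL, rfl⟩
    set B := A.adjoint.domRestrict (S L) with hBdef
    have hBA : B ≤ A.adjoint := LinearPMap.domRestrict_le
    have hAB : A ≤ B := by
      refine ⟨fun g hg => ⟨(hS L g).mpr ⟨0, L.zero_mem, ext_trace g hg⟩, hAA.1 hg⟩,
        fun x y hxy => ?_⟩
      rw [hBA.2 (x := y) (y := ⟨y, hBA.1 y.2⟩) rfl]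
      exact hAA.2 hxy
    have hBd : Dense (B.domain : Set E) := T.dense.mono hAB.1
    refine ⟨hAB, LinearPMap.isSelfAdjoint_def.mpr ?_⟩
    have hfa : B.IsFormalAdjoint B := by
      intro x y
      obtain ⟨t, htL, ht⟩ := (hS L x).mp x.2.1
      obtain ⟨s, hsL, hs⟩ := (hS L y).mp y.2.1
      have := T.green ⟨x, x.2.2⟩ ⟨y, y.2.2⟩ t s ht hs
      rw [(hL t).mp htL s hsL, mul_zero] at this
      rw [hBA.2 (x := x) (y := ⟨x, hBA.1 x.2⟩) rfl, hBA.2 (x := y) (y := ⟨y, hBA.1 y.2⟩) rfl]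
      exact sub_eq_zero.mp this
    have hBB := LinearPMap.IsFormalAdjoint.le_adjoint hBd hfa
    refine (LinearPMap.eq_of_le_of_domain_eq hBB (le_antisymm hBB.1 ?_)).symm
    -- Since B extends A, g lies in D(A*) and has a trace; testing against elements with arbitrary
    -- trace in L puts that trace in the symplectic complement of L, which is L.
    intro g hg
    have hfg := LinearPMap.adjoint_isFormalAdjoint hBd ⟨g, hg⟩
    have hext : ∀ u : A.domain, inner ℂ (B.adjoint ⟨g, hg⟩) (u : E) = inner ℂ g (A u) := fun u => by
      rw [hAB.2 (x := u) (y := ⟨u, hAB.1 u.2⟩) rfl]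
      exact hfg ⟨u, hAB.1 u.2⟩
    have hgA : g ∈ A.adjoint.domain := LinearPMap.mem_adjoint_domain_of_exists g ⟨_, hext⟩
    have hval : A.adjoint ⟨g, hgA⟩ = B.adjoint ⟨g, hg⟩ :=
      LinearPMap.adjoint_apply_eq T.dense ⟨g, hgA⟩ hext
    obtain ⟨t, ht⟩ := T.exists_trace g hgA
    refine ⟨(hS L g).mpr ⟨t, (hL t).mpr fun s hs => ?_, ht⟩, hgA⟩
    obtain ⟨f, hf, hfs⟩ := T.onto s
    have hfB : f ∈ B.domain := ⟨(hS L f).mpr ⟨s, hs, hfs⟩, hf⟩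
    have h1 := T.green ⟨g, hgA⟩ ⟨f, hf⟩ t s ht hfs
    have h2 := hfg ⟨f, hfB⟩
    rw [hBA.2 (x := ⟨f, hfB⟩) (y := ⟨f, hf⟩) rfl] at h2
    rw [hval, sub_eq_zero.mpr h2] at h1
    exact (mul_eq_zero.mp h1.symm).resolve_left T.ne

/-! ### Lagrangian subspaces -/

/-- The boundary condition `g₀⁻ = g₀⁺ = 0`. -/
def condF : Submodule ℂ ((ℂ × ℂ) × (ℂ × ℂ)) where
  carrier := {t | t.1.1 = 0 ∧ t.1.2 = 0}
  add_mem' := fun {s t} hs ht => by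
    simp only [mem_ofPred_eq, Prod.fst_add, Prod.snd_add] at *
    simp [hs, ht]
  zero_mem' := by simp
  smul_mem' := fun c t ht => by
    simp only [mem_ofPred_eq, Prod.smul_fst, Prod.smul_snd, smul_eq_mul] at *
    simp [ht]

/-- The boundary condition `g₀⁻ = 0`, `g₁⁺ = γ g₀⁺`. -/
def condR (γ : ℝ) : Submodule ℂ ((ℂ × ℂ) × (ℂ × ℂ)) where
  carrier := {t | t.1.1 = 0 ∧ t.2.2 = γ * t.1.2}
  add_mem' := fun {s t} hs ht => by
    simp only [mem_ofPred_eq, Prod.fst_add, Prod.snd_add] at *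
    rw [hs.1, ht.1, hs.2, ht.2]; constructor <;> ring
  zero_mem' := by simp
  smul_mem' := fun c t ht => by
    simp only [mem_ofPred_eq, Prod.smul_fst, Prod.smul_snd, smul_eq_mul] at *
    rw [ht.1, ht.2]; constructor <;> ring

/-- The boundary condition `g₀⁺ = 0`, `g₁⁻ = γ g₀⁻`. -/
def condL (γ : ℝ) : Submodule ℂ ((ℂ × ℂ) × (ℂ × ℂ)) where
  carrier := {t | t.1.2 = 0 ∧ t.2.1 = γ * t.1.1}
  add_mem' := fun {s t} hs ht => by
    simp only [mem_ofPred_eq, Prod.fst_add, Prod.snd_add] at *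
    rw [hs.1, ht.1, hs.2, ht.2]; constructor <;> ring
  zero_mem' := by simp
  smul_mem' := fun c t ht => by
    simp only [mem_ofPred_eq, Prod.smul_fst, Prod.smul_snd, smul_eq_mul] at *
    rw [ht.1, ht.2]; constructor <;> ring

/-- The boundary condition `g₀⁺ = a g₀⁻`, `g₁⁻ + ā g₁⁺ = γ g₀⁻`. -/
def condII (a : ℂ) (γ : ℝ) : Submodule ℂ ((ℂ × ℂ) × (ℂ × ℂ)) where
  carrier := {t | t.1.2 = a * t.1.1 ∧ t.2.1 + conj a * t.2.2 = γ * t.1.1}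
  add_mem' := fun {s t} hs ht => by
    simp only [mem_ofPred_eq, Prod.fst_add, Prod.snd_add] at *
    exact ⟨by linear_combination hs.1 + ht.1, by linear_combination hs.2 + ht.2⟩
  zero_mem' := by simp
  smul_mem' := fun c t ht => by
    simp only [mem_ofPred_eq, Prod.smul_fst, Prod.smul_snd, smul_eq_mul] at *
    exact ⟨by linear_combination c * ht.1, by linear_combination c * ht.2⟩

/-- The boundary condition `g₁⁻ = γ₁ g₀⁻ + ζ g₀⁺`, `g₁⁺ = ζ̄ g₀⁻ + γ₄ g₀⁺`. -/
def condIII (Γ : Fin 4 → ℝ) : Submodule ℂ ((ℂ × ℂ) × (ℂ × ℂ)) where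
  carrier := {t | t.2.1 = Γ 0 * t.1.1 + (Γ 1 + Complex.I * Γ 2) * t.1.2 ∧
    t.2.2 = (Γ 1 - Complex.I * Γ 2) * t.1.1 + Γ 3 * t.1.2}
  add_mem' := fun {s t} hs ht => by
    simp only [mem_ofPred_eq, Prod.fst_add, Prod.snd_add] at *
    exact ⟨by linear_combination hs.1 + ht.1, by linear_combination hs.2 + ht.2⟩
  zero_mem' := by simp
  smul_mem' := fun c t ht => by
    simp only [mem_ofPred_eq, Prod.smul_fst, Prod.smul_snd, smul_eq_mul] at *
    exact ⟨by linear_combination c * ht.1, by linear_combination c * ht.2⟩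

theorem mem_condF (t) : t ∈ condF ↔ t.1.1 = 0 ∧ t.1.2 = 0 := Iff.rfl

theorem mem_condR (γ t) : t ∈ condR γ ↔ t.1.1 = 0 ∧ t.2.2 = γ * t.1.2 := Iff.rfl

theorem mem_condL (γ t) : t ∈ condL γ ↔ t.1.2 = 0 ∧ t.2.1 = γ * t.1.1 := Iff.rfl

theorem mem_condII (a γ t) : t ∈ condII a γ ↔
    t.1.2 = a * t.1.1 ∧ t.2.1 + conj a * t.2.2 = γ * t.1.1 := Iff.rfl

theorem mem_condIII (Γ t) : t ∈ condIII Γ ↔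
    t.2.1 = Γ 0 * t.1.1 + (Γ 1 + Complex.I * Γ 2) * t.1.2 ∧
    t.2.2 = (Γ 1 - Complex.I * Γ 2) * t.1.1 + Γ 3 * t.1.2 := Iff.rfl

theorem condII_zero (γ : ℝ) : condII 0 γ = condL γ := by
  ext t
  simp [mem_condII, mem_condL]

theorem isLagrangian_condF : IsLagrangian condF := by
  rintro ⟨⟨a, b⟩, c, d⟩
  simp only [mem_condF, sympl]
  constructor
  · rintro ⟨rfl, rfl⟩ s ⟨h1, h2⟩
    simp [h1, h2]
  · intro h
    have h1 := h ((0, 0), 1, 0) ⟨rfl, rfl⟩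
    have h2 := h ((0, 0), 0, 1) ⟨rfl, rfl⟩
    simp at h1 h2
    exact ⟨h1, h2⟩

theorem isLagrangian_condII (a : ℂ) (γ : ℝ) : IsLagrangian (condII a γ) := by
  rintro ⟨⟨t1, t2⟩, t3, t4⟩
  simp only [mem_condII, sympl]
  constructor
  · rintro ⟨h1, h2⟩ s ⟨h3, h4⟩
    have h2' := congrArg conj h2
    simp only [map_add, map_mul, Complex.conj_conj, Complex.conj_ofReal] at h2'
    rw [h1, h3, map_mul]
    linear_combination s.1.1 * h2' - conj t1 * h4
  · intro h
    -- Two vectors spanning the plane suffice as tests: one with nonzero g₀, and one along the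
    -- kernel of (g₁⁻, g₁⁺) ↦ g₁⁻ + ā g₁⁺.
    have h1 := h ((1, a), γ, 0) (by simp)
    have h2 := h ((0, 0), -conj a, 1) (by simp)
    simp only at h1 h2
    have h1' := congrArg conj h1
    have h2' := congrArg conj h2
    simp only [map_add, map_sub, map_neg, map_mul, Complex.conj_conj, Complex.conj_ofReal, map_zero,
      map_one] at h1' h2'
    exact ⟨by linear_combination -h2', by linear_combination h1'⟩

theorem isLagrangian_condL (γ : ℝ) : IsLagrangian (condL γ) :=
  condII_zero γ ▸ isLagrangian_condII 0 γ

theorem isLagrangian_condR (γ : ℝ) : IsLagrangian (condR γ) := by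
  rintro ⟨⟨t1, t2⟩, t3, t4⟩
  simp only [mem_condR, sympl]
  constructor
  · rintro ⟨h1, h2⟩ s ⟨h3, h4⟩
    rw [h1, h2, h3, h4, map_mul, Complex.conj_ofReal, map_zero]
    ring
  · intro h
    have h1 := h ((0, 1), 0, γ) (by simp)
    have h2 := h ((0, 0), 1, 0) (by simp)
    simp only at h1 h2
    have h1' := congrArg conj h1
    have h2' := congrArg conj h2
    simp only [map_add, map_sub, map_mul, Complex.conj_conj, Complex.conj_ofReal, map_zero,
      map_one] at h1' h2'
    exact ⟨by linear_combination -h2', by linear_combination h1'⟩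

theorem isLagrangian_condIII (Γ : Fin 4 → ℝ) : IsLagrangian (condIII Γ) := by
  rintro ⟨⟨t1, t2⟩, t3, t4⟩
  simp only [mem_condIII, sympl]
  constructor
  · rintro ⟨h1, h2⟩ s ⟨h3, h4⟩
    rw [h1, h2, h3, h4]
    simp only [map_add, map_sub, map_mul, Complex.conj_ofReal, Complex.conj_I]
    ring
  · intro h
    have h1 := h ((1, 0), Γ 0, Γ 1 - Complex.I * Γ 2) (by simp)
    have h2 := h ((0, 1), Γ 1 + Complex.I * Γ 2, Γ 3) (by simp)
    simp only at h1 h2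
    have h1' := congrArg conj h1
    have h2' := congrArg conj h2
    simp only [map_add, map_sub, map_mul, Complex.conj_conj, Complex.conj_ofReal, map_zero,
      map_one, Complex.conj_I] at h1' h2'
    exact ⟨by linear_combination h1', by linear_combination h2'⟩

/-- Complements reverse inclusions: M ≤ L puts the complement of L, which is L, inside that of M,
which is M. -/
theorem IsLagrangian.eq_of_le {L M : Submodule ℂ ((ℂ × ℂ) × (ℂ × ℂ))} (hL : IsLagrangian L)
    (hM : IsLagrangian M) (h : M ≤ L) : L = M :=
  le_antisymm (fun t ht => (hM t).mpr fun s hs => (hL t).mp ht s (h hs)) h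

theorem ofReal_re_of_conj_eq {z : ℂ} (h : conj z = z) : ((z.re : ℝ) : ℂ) = z :=
  Complex.conj_eq_iff_re.mp h

/-- The cases are those of the projection of L to (g₀⁻, g₀⁺). In each one, generators are normalised
to (1, 0), (0, 1) or (1, a) in these components, isotropy supplies the reality or conjugacy of the
parameters, and `IsLagrangian.eq_of_le` reduces equality to the inclusion of the model plane in L.
-/
theorem isLagrangian_iff (L : Submodule ℂ ((ℂ × ℂ) × (ℂ × ℂ))) : IsLagrangian L ↔
    L = condF ∨ (∃ γ, L = condR γ) ∨ (∃ γ, L = condL γ) ∨ (∃ a γ, a ≠ 0 ∧ L = condII a γ) ∨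
      ∃ Γ, L = condIII Γ := by
  constructor
  swap
  · rintro (rfl | ⟨γ, rfl⟩ | ⟨γ, rfl⟩ | ⟨a, γ, -, rfl⟩ | ⟨Γ, rfl⟩)
    exacts [isLagrangian_condF, isLagrangian_condR γ, isLagrangian_condL γ,
      isLagrangian_condII a γ, isLagrangian_condIII Γ]
  intro hL
  by_cases h1 : ∃ s ∈ L, s.1.1 ≠ 0
  · obtain ⟨s, a, p, q, rfl, hs⟩ : ∃ s : (ℂ × ℂ) × (ℂ × ℂ), ∃ a p q, s = ((1, a), p, q) ∧ s ∈ L := by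
      obtain ⟨s, hs, h0⟩ := h1
      refine ⟨s.1.1⁻¹ • s, s.1.1⁻¹ * s.1.2, s.1.1⁻¹ * s.2.1, s.1.1⁻¹ * s.2.2, ?_,
        L.smul_mem _ hs⟩
      ext <;> simp [h0]
    -- A vector off the line through (1, a) makes the projection two-dimensional, and L is then the
    -- graph of a Hermitian matrix.
    by_cases h2 : ∃ t ∈ L, t.1.2 ≠ a * t.1.1
    · obtain ⟨t, r, w, rfl, ht⟩ : ∃ t : (ℂ × ℂ) × (ℂ × ℂ), ∃ r w, t = ((0, 1), r, w) ∧ t ∈ L := by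
        obtain ⟨t, ht, h0⟩ := h2
        have h0' : t.1.2 - t.1.1 * a ≠ 0 := by rw [mul_comm]; exact sub_ne_zero.mpr h0
        refine ⟨(t.1.2 - t.1.1 * a)⁻¹ • (t - t.1.1 • ((1, a), p, q)),
          (t.1.2 - t.1.1 * a)⁻¹ * (t.2.1 - t.1.1 * p), (t.1.2 - t.1.1 * a)⁻¹ * (t.2.2 - t.1.1 * q),
          ?_, L.smul_mem _ (L.sub_mem ht (L.smul_mem _ hs))⟩
        ext <;> simp [h0']
      obtain ⟨s', p', q', rfl, hs'⟩ : ∃ t : (ℂ × ℂ) × (ℂ × ℂ), ∃ p q, t = ((1, 0), p, q) ∧ t ∈ L :=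
        ⟨((1, a), p, q) - a • ((0, 1), r, w), p - a * r, q - a * w, by ext <;> simp,
          L.sub_mem hs (L.smul_mem _ ht)⟩
      -- Isotropy of the two generators: `e1` and `e2` make the diagonal entries real, `e3` makes
      -- the off-diagonal ones conjugate.
      have e1 := (hL _).mp hs' _ hs'
      have e2 := (hL _).mp ht _ ht
      have e3 := (hL _).mp hs' _ ht
      simp only [sympl, map_one, map_zero, mul_one, mul_zero, one_mul, zero_mul, add_zero, zero_add,
        sub_zero] at e1 e2 e3
      have hp := ofReal_re_of_conj_eq (sub_eq_zero.mp e1)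
      have hw := ofReal_re_of_conj_eq (sub_eq_zero.mp e2)
      have hr : r = r.re + Complex.I * r.im := by rw [mul_comm]; exact (Complex.re_add_im r).symm
      have hq : q' = r.re - Complex.I * r.im := by
        have : q' = conj r := by
          rw [← sub_eq_zero.mp e3, Complex.conj_conj]
        rw [this]
        conv_lhs => rw [hr]
        simp only [map_add, map_mul, Complex.conj_ofReal, Complex.conj_I]
        ring
      refine Or.inr (Or.inr (Or.inr (Or.inr ⟨![p'.re, r.re, r.im, w.re],
        hL.eq_of_le (isLagrangian_condIII _) ?_⟩)))
      intro x hx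
      rw [mem_condIII] at hx
      simp only [Matrix.cons_val_zero, Matrix.cons_val_one, Matrix.cons_val] at hx
      rw [← hr, ← hq, hp, hw] at hx
      have : x = x.1.1 • ((1, 0), p', q') + x.1.2 • ((0, 1), r, w) := by
        ext
        · simp
        · simp
        · simp [hx.1]; ring
        · simp [hx.2]; ring
      rw [this]
      exact L.add_mem (L.smul_mem _ hs') (L.smul_mem _ ht)
    · push Not at h2
      -- These vectors pair to zero with everything whose g₀ is a multiple of (1, a), hence belong
      -- to the complement of L, which is L.
      have hn : ∀ y : ℂ, (((0, 0), -conj a * y, y) : (ℂ × ℂ) × (ℂ × ℂ)) ∈ L := fun y => by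
        refine (hL _).mpr fun t ht => ?_
        simp [sympl, h2 t ht]; ring
      have e1 := (hL _).mp hs _ hs
      simp only [sympl, map_one, mul_one, one_mul] at e1
      have hγ : conj (p + conj a * q) = p + conj a * q := by
        simp only [map_add, map_mul, Complex.conj_conj]
        linear_combination e1
      have hγ' := ofReal_re_of_conj_eq hγ
      have hLe : L = condII a (p + conj a * q).re := by
        refine hL.eq_of_le (isLagrangian_condII _ _) fun x hx => ?_
        rw [mem_condII, hγ'] at hx
        have : x = x.1.1 • ((1, a), p, q) +
            ((0, 0), -conj a * (x.2.2 - x.1.1 * q), x.2.2 - x.1.1 * q) := by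
          ext
          · simp
          · simp [hx.1]; ring
          · simp; linear_combination hx.2
          · simp
        rw [this]
        exact L.add_mem (L.smul_mem _ hs) (hn _)
      by_cases ha : a = 0
      · subst ha
        exact Or.inr (Or.inr (Or.inl ⟨_, hLe.trans (condII_zero _)⟩))
      · exact Or.inr (Or.inr (Or.inr (Or.inl ⟨a, _, ha, hLe⟩)))
  · push Not at h1
    by_cases h2 : ∃ s ∈ L, s.1.2 ≠ 0
    · obtain ⟨s, p, q, rfl, hs⟩ : ∃ s : (ℂ × ℂ) × (ℂ × ℂ), ∃ p q, s = ((0, 1), p, q) ∧ s ∈ L := by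
        obtain ⟨s, hs, h0⟩ := h2
        refine ⟨s.1.2⁻¹ • s, s.1.2⁻¹ * s.2.1, s.1.2⁻¹ * s.2.2, ?_, L.smul_mem _ hs⟩
        ext <;> simp [h0, h1 s hs]
      have hn : ∀ y : ℂ, (((0, 0), y, 0) : (ℂ × ℂ) × (ℂ × ℂ)) ∈ L := fun y => by
        refine (hL _).mpr fun t ht => ?_
        simp [sympl, h1 t ht]
      have e1 := (hL _).mp hs _ hs
      simp only [sympl, map_one, map_zero, mul_one, one_mul, mul_zero, zero_mul, zero_add,
        sub_zero] at e1
      have hq := ofReal_re_of_conj_eq (sub_eq_zero.mp e1)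
      refine Or.inr (Or.inl ⟨q.re, hL.eq_of_le (isLagrangian_condR _) fun x hx => ?_⟩)
      rw [mem_condR, hq] at hx
      have : x = x.1.2 • ((0, 1), p, q) + ((0, 0), x.2.1 - x.1.2 * p, 0) := by
        ext
        · simp [hx.1]
        · simp
        · simp
        · simp [hx.2]; ring
      rw [this]
      exact L.add_mem (L.smul_mem _ hs) (hn _)
    · push Not at h2
      refine Or.inl (hL.eq_of_le isLagrangian_condF fun x hx => (hL x).mpr fun s hs => ?_)
      rw [mem_condF] at hx
      simp [sympl, hx, h1 s hs, h2 s hs]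

end Lagrangian

/-! ### Form domains and Friedrichs extensions -/

section Friedrichs

variable {E : Type*} [NormedAddCommGroup E] [InnerProductSpace ℂ E] [CompleteSpace E]
  {F : Type*} [NormedAddCommGroup F] [InnerProductSpace ℂ F] [CompleteSpace F]

/-- `A` is densely defined, symmetric and non-negative. -/
structure IsNonnegSymm (A : E →ₗ.[ℂ] E) : Prop where
  dense : Dense (A.domain : Set E)
  symm : ∀ u v : A.domain, inner ℂ (A u) (v : E) = inner ℂ (u : E) (A v)
  nonneg : ∀ u : A.domain, 0 ≤ (inner ℂ (u : E) (A u)).re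

variable {A : E →ₗ.[ℂ] E} {B : F →ₗ.[ℂ] F} {lam : ℝ} {Φ Ψ : E}

theorem DeficiencyData.isNonnegSymm (D : DeficiencyData A lam Φ Ψ) : IsNonnegSymm A :=
  ⟨D.dense, D.symm, D.nonneg⟩

namespace IsNonnegSymm

theorem inner_eq_re (h : IsNonnegSymm A) (u : A.domain) :
    inner ℂ (u : E) (A u) = ((inner ℂ (u : E) (A u)).re : ℂ) := by
  refine (ofReal_re_of_conj_eq ?_).symm
  rw [inner_conj_symm, h.symm]

theorem norm_inner (h : IsNonnegSymm A) (u : A.domain) :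
    ‖inner ℂ (u : E) (A u)‖ = (inner ℂ (u : E) (A u)).re := by
  rw [h.inner_eq_re u, Complex.norm_real, Complex.ofReal_re, Real.norm_of_nonneg (h.nonneg u)]

/-- This is the parallelogram law for the form of A with the non-negative value at u - v dropped. -/
theorem norm_inner_add_le (h : IsNonnegSymm A) (u v : A.domain) :
    ‖inner ℂ ((u + v : A.domain) : E) (A (u + v))‖ ≤
      2 * ‖inner ℂ (u : E) (A u)‖ + 2 * ‖inner ℂ (v : E) (A v)‖ := by
  have h1 := h.nonneg (u - v)
  rw [h.norm_inner, h.norm_inner, h.norm_inner]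
  simp only [LinearPMap.map_add, LinearPMap.map_sub, Submodule.coe_add, Submodule.coe_sub,
    inner_add_left, inner_add_right, inner_sub_left, inner_sub_right, Complex.add_re,
    Complex.sub_re] at h1 ⊢
  linarith

/-- The form domain, as a subspace. -/
def formDomain (h : IsNonnegSymm A) : Submodule ℂ E where
  carrier := {g | MemFormDomain A g}
  add_mem' := by
    rintro f g ⟨u, hu, hu'⟩ ⟨v, hv, hv'⟩
    refine ⟨fun n => u n + v n, hu.add hv, fun ε hε => ?_⟩
    obtain ⟨N, hN⟩ := hu' (ε / 4) (by positivity)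
    obtain ⟨M, hM⟩ := hv' (ε / 4) (by positivity)
    refine ⟨max N M, fun m hm n hn => ?_⟩
    have h1 := hN m (le_of_max_le_left hm) n (le_of_max_le_left hn)
    have h2 := hM m (le_of_max_le_right hm) n (le_of_max_le_right hn)
    have h3 := h.norm_inner_add_le (u m - u n) (v m - v n)
    rw [add_sub_add_comm]
    linarith
  zero_mem' := ⟨fun _ => 0, tendsto_const_nhds, fun ε hε => ⟨0, fun m _ n _ => by simpa⟩⟩
  smul_mem' := by
    rintro c g ⟨u, hu, hu'⟩
    refine ⟨fun n => c • u n, hu.const_smul c, fun ε hε => ?_⟩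
    obtain ⟨N, hN⟩ := hu' (ε / (‖c‖ ^ 2 + 1)) (by positivity)
    refine ⟨N, fun m hm n hn => ?_⟩
    have h1 := hN m hm n hn
    rw [lt_div_iff₀ (by positivity)] at h1
    rw [← smul_sub, LinearPMap.map_smul, Submodule.coe_smul, inner_smul_left, inner_smul_right,
      norm_mul, norm_mul, RCLike.norm_conj]
    nlinarith [norm_nonneg (inner ℂ ((u m - u n : A.domain) : E) (A (u m - u n)))]

/-- The Friedrichs extension. -/
def friedrichs (h : IsNonnegSymm A) : E →ₗ.[ℂ] E := A.adjoint.domRestrict h.formDomain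

theorem isFriedrichsExtension (h : IsNonnegSymm A) : IsFriedrichsExtension A h.friedrichs :=
  ⟨LinearPMap.domRestrict_le, fun _ => and_comm⟩

theorem memFormDomain_of_tendsto {u : ℕ → A.domain} {g r : E}
    (h1 : Tendsto (fun n => (u n : E)) atTop (𝓝 g)) (h2 : Tendsto (fun n => A (u n)) atTop (𝓝 r)) :
    MemFormDomain A g := by
  refine ⟨u, h1, fun ε hε => ?_⟩
  have c1 := h1.cauchySeq
  have c2 := h2.cauchySeq
  rw [Metric.cauchySeq_iff] at c1 c2
  obtain ⟨N, hN⟩ := c1 ε hε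
  obtain ⟨M, hM⟩ := c2 1 one_pos
  refine ⟨max N M, fun m hm n hn => ?_⟩
  have e1 := hN m (le_of_max_le_left hm) n (le_of_max_le_left hn)
  have e2 := hM m (le_of_max_le_right hm) n (le_of_max_le_right hn)
  rw [dist_eq_norm] at e1 e2
  refine (norm_inner_le_norm _ _).trans_lt ?_
  rw [LinearPMap.map_sub, Submodule.coe_sub]
  nlinarith [norm_nonneg ((u m : E) - u n), norm_nonneg (A (u m) - A (u n))]

theorem memFormDomain_of_mem_closure (h : IsNonnegSymm A) {g : E} (hg : g ∈ A.closure.domain) :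
    MemFormDomain A g := by
  obtain ⟨u, r, h1, h2⟩ := (mem_closure_domain_iff (isClosable_of_symm h.dense h.symm) g).mp hg
  exact memFormDomain_of_tendsto h1 h2

/-! ### Adjoints, form domains and Friedrichs extensions of orthogonal sums -/

theorem dense_orthSum (hA : IsNonnegSymm A) (hB : IsNonnegSymm B) :
    Dense ((orthSum A B).domain : Set (WithLp 2 (E × F))) := by
  have h1 : Dense ((A.domain : Set E) ×ˢ (B.domain : Set F)) := hA.dense.prod hB.dense
  have h2 := h1.preimage (WithLp.homeomorphProd 2 E F).isOpenMap
  exact h2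

theorem orthSum (hA : IsNonnegSymm A) (hB : IsNonnegSymm B) : IsNonnegSymm (orthSum A B) where
  dense := dense_orthSum hA hB
  symm u v := by
    rw [WithLp.prod_inner_apply, WithLp.prod_inner_apply]
    exact congrArg₂ (· + ·) (hA.symm ⟨u.1.fst, u.2.1⟩ ⟨v.1.fst, v.2.1⟩)
      (hB.symm ⟨u.1.snd, u.2.2⟩ ⟨v.1.snd, v.2.2⟩)
  nonneg u := by
    rw [WithLp.prod_inner_apply, Complex.add_re]
    exact add_nonneg (hA.nonneg ⟨u.1.fst, u.2.1⟩) (hB.nonneg ⟨u.1.snd, u.2.2⟩)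

theorem adjoint_orthSum (hA : IsNonnegSymm A) (hB : IsNonnegSymm B) :
    (Grushin.orthSum A B).adjoint = Grushin.orthSum A.adjoint B.adjoint := by
  have hle : Grushin.orthSum A.adjoint B.adjoint ≤ (Grushin.orthSum A B).adjoint := by
    refine LinearPMap.IsFormalAdjoint.le_adjoint (dense_orthSum hA hB) fun u v => ?_
    rw [WithLp.prod_inner_apply, WithLp.prod_inner_apply]
    refine congrArg₂ (· + ·) ?_ ?_
    · exact (LinearPMap.adjoint_isFormalAdjoint hA.dense).symm ⟨u.1.fst, u.2.1⟩ ⟨v.1.fst, v.2.1⟩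
    · exact (LinearPMap.adjoint_isFormalAdjoint hB.dense).symm ⟨u.1.snd, u.2.2⟩ ⟨v.1.snd, v.2.2⟩
  refine (LinearPMap.eq_of_le_of_domain_eq hle (le_antisymm hle.1 fun g hg => ?_)).symm
  obtain ⟨w, hw⟩ := (mem_adjoint_iff_exists (dense_orthSum hA hB) g).mp hg
  constructor
  · refine LinearPMap.mem_adjoint_domain_of_exists _ ⟨w.fst, fun x => ?_⟩
    -- Testing against vectors with one vanishing component isolates the adjoint condition for each
    -- summand.
    have := hw ⟨WithLp.toLp 2 ((x : E), (0 : F)), x.2, B.domain.zero_mem⟩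
    rw [WithLp.prod_inner_apply, WithLp.prod_inner_apply] at this
    have hB0 : B ⟨0, B.domain.zero_mem⟩ = 0 := LinearPMap.map_zero B
    simpa [Grushin.orthSum, hB0] using this
  · refine LinearPMap.mem_adjoint_domain_of_exists _ ⟨w.snd, fun x => ?_⟩
    have := hw ⟨WithLp.toLp 2 ((0 : E), (x : F)), A.domain.zero_mem, x.2⟩
    rw [WithLp.prod_inner_apply, WithLp.prod_inner_apply] at this
    have hA0 : A ⟨0, A.domain.zero_mem⟩ = 0 := LinearPMap.map_zero A
    simpa [Grushin.orthSum, hA0] using this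

/-- The form of the sum is the sum of two non-negative forms, so a sequence is Cauchy for it exactly
when both components are. -/
theorem memFormDomain_orthSum_iff (hA : IsNonnegSymm A) (hB : IsNonnegSymm B)
    (g : WithLp 2 (E × F)) : MemFormDomain (Grushin.orthSum A B) g ↔
      MemFormDomain A g.fst ∧ MemFormDomain B g.snd := by
  have hAB := hA.orthSum hB
  have split : ∀ d : (Grushin.orthSum A B).domain,
      ‖inner ℂ (d : WithLp 2 (E × F)) (Grushin.orthSum A B d)‖ =
      ‖inner ℂ (d.1.fst : E) (A ⟨d.1.fst, d.2.1⟩)‖ +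
        ‖inner ℂ (d.1.snd : F) (B ⟨d.1.snd, d.2.2⟩)‖ := fun d => by
    rw [hAB.norm_inner, hA.norm_inner ⟨d.1.fst, d.2.1⟩, hB.norm_inner ⟨d.1.snd, d.2.2⟩,
      WithLp.prod_inner_apply, Complex.add_re]
    rfl
  constructor
  · rintro ⟨u, h1, h2⟩
    refine ⟨⟨fun n => ⟨(u n).1.fst, (u n).2.1⟩, ?_, fun ε hε => ?_⟩,
      ⟨fun n => ⟨(u n).1.snd, (u n).2.2⟩, ?_, fun ε hε => ?_⟩⟩
    · exact ((WithLp.prod_continuous_ofLp 2 E F).fst.tendsto g).comp h1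
    · obtain ⟨N, hN⟩ := h2 ε hε
      refine ⟨N, fun m hm n hn => ?_⟩
      have := hN m hm n hn
      rw [split] at this
      exact lt_of_le_of_lt (le_add_of_nonneg_right (norm_nonneg _)) this
    · exact ((WithLp.prod_continuous_ofLp 2 E F).snd.tendsto g).comp h1
    · obtain ⟨N, hN⟩ := h2 ε hε
      refine ⟨N, fun m hm n hn => ?_⟩
      have := hN m hm n hn
      rw [split] at this
      exact lt_of_le_of_lt (le_add_of_nonneg_left (norm_nonneg _)) this
  · rintro ⟨⟨u, h1, h2⟩, v, h3, h4⟩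
    refine ⟨fun n => ⟨WithLp.toLp 2 ((u n : E), (v n : F)), (u n).2, (v n).2⟩, ?_, fun ε hε => ?_⟩
    · exact ((WithLp.prod_continuous_toLp 2 E F).tendsto (g.fst, g.snd)).comp (h1.prodMk_nhds h3)
    · obtain ⟨N, hN⟩ := h2 (ε / 2) (by positivity)
      obtain ⟨M, hM⟩ := h4 (ε / 2) (by positivity)
      refine ⟨max N M, fun m hm n hn => ?_⟩
      have e1 := hN m (le_of_max_le_left hm) n (le_of_max_le_left hn)
      have e2 := hM m (le_of_max_le_right hm) n (le_of_max_le_right hn)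
      rw [split]
      calc _ < ε / 2 + ε / 2 := add_lt_add e1 e2
        _ = ε := add_halves ε

theorem isFriedrichsExtension_orthSum (hA : IsNonnegSymm A) (hB : IsNonnegSymm B) :
    IsFriedrichsExtension (Grushin.orthSum A B)
      (Grushin.orthSum hA.friedrichs hB.friedrichs) := by
  rw [IsFriedrichsExtension, adjoint_orthSum hA hB]
  refine ⟨⟨fun g hg => ⟨hg.1.2, hg.2.2⟩, fun x y hxy => ?_⟩, fun g => ?_⟩
  · have e1 : x.1.fst = y.1.fst := by rw [hxy]
    have e2 : x.1.snd = y.1.snd := by rw [hxy]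
    refine congrArg (WithLp.toLp 2) (Prod.ext ?_ ?_)
    · exact (LinearPMap.domRestrict_le (f := A.adjoint)).2 e1
    · exact (LinearPMap.domRestrict_le (f := B.adjoint)).2 e2
  · rw [memFormDomain_orthSum_iff hA hB]
    constructor
    · rintro ⟨⟨h1, h2⟩, h3, h4⟩
      exact ⟨⟨h2, h4⟩, h1, h3⟩
    · rintro ⟨⟨h2, h4⟩, h1, h3⟩
      exact ⟨⟨h1, h2⟩, h3, h4⟩

end IsNonnegSymm

/-! ### Weak solutions of finite energy -/

namespace DeficiencyData

/-- The form of `T = A + lam` on the domain of `A`. -/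
def shiftForm (A : E →ₗ.[ℂ] E) (lam : ℝ) (u v : A.domain) : ℝ :=
  (inner ℂ (u : E) (A v + (lam : ℂ) • (v : E))).re

theorem shiftForm_comm (D : DeficiencyData A lam Φ Ψ) (u v : A.domain) :
    shiftForm A lam u v = shiftForm A lam v u := by
  rw [shiftForm, ← D.shift_self u v, ← inner_conj_symm, Complex.conj_re, shiftForm]

theorem shiftForm_add_left (u v w : A.domain) :
    shiftForm A lam (u + v) w = shiftForm A lam u w + shiftForm A lam v w := by
  rw [shiftForm, Submodule.coe_add, inner_add_left, Complex.add_re, shiftForm, shiftForm]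

theorem shiftForm_smul_left (t : ℝ) (u w : A.domain) :
    shiftForm A lam ((t : ℂ) • u) w = t * shiftForm A lam u w := by
  rw [shiftForm, Submodule.coe_smul, inner_smul_left, Complex.conj_ofReal, Complex.re_ofReal_mul,
    shiftForm]

/-- The weak solution of `T* ψ = f` in the form domain, by minimisation of the energy. -/
theorem exists_formSolution (D : DeficiencyData A lam Φ Ψ) (f : E) :
    ∃ ψ, MemFormDomain A ψ ∧ Shift A lam ψ f := by
  have hS := D.isNonnegSymm
  obtain ⟨c, hc, hco⟩ := D.coercive
  let b := shiftForm A lam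
  have bdef : ∀ u v : A.domain, b u v = (inner ℂ (u : E) (A v + (lam : ℂ) • (v : E))).re :=
    fun _ _ => rfl
  have b_comm : ∀ u v, b u v = b v u := D.shiftForm_comm
  have b_add : ∀ u v w, b (u + v) w = b u w + b v w := shiftForm_add_left
  have b_smul : ∀ (t : ℝ) u w, b ((t : ℂ) • u) w = t * b u w := shiftForm_smul_left
  have b_add' : ∀ u v w, b w (u + v) = b w u + b w v := fun u v w => by
    rw [b_comm, b_add, b_comm u, b_comm v]
  have b_smul' : ∀ (t : ℝ) u w, b w ((t : ℂ) • u) = t * b w u := fun t u w => by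
    rw [b_comm, b_smul, b_comm u]
  have b_co : ∀ u : A.domain, c * ‖(u : E)‖ ^ 2 ≤ b u u := fun u => (hco u).trans_eq (re_inner_shift u)
  have b_form : ∀ u : A.domain, ‖inner ℂ (u : E) (A u)‖ ≤ b u u := fun u => by
    rw [hS.norm_inner, bdef, ← re_inner_shift]
    nlinarith [D.lam_nonneg, sq_nonneg ‖(u : E)‖]
  -- Dirichlet's principle: a minimiser ψ of this energy satisfies b(ψ, v) = Re⟨f, v⟩ for all v. The
  -- infimum need not be attained in D(A), so the argument follows a minimising sequence.
  let J : A.domain → ℝ := fun u => b u u - 2 * (inner ℂ f (u : E)).re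
  have J_add : ∀ (u v : A.domain) (t : ℝ), J (u + (t : ℂ) • v) =
      J u + 2 * t * (b u v - (inner ℂ f (v : E)).re) + t ^ 2 * b v v := fun u v t => by
    simp only [J, b_add, b_add', b_smul, b_smul', Submodule.coe_add, Submodule.coe_smul,
      inner_add_right, inner_smul_right, Complex.add_re, Complex.re_ofReal_mul, b_comm v u]
    ring
  have J_bdd : BddBelow (range J) := by
    refine ⟨-(‖f‖ ^ 2 / c), ?_⟩
    rintro _ ⟨u, rfl⟩
    have h1 := b_co u
    have h2 : (inner ℂ f (u : E)).re ≤ ‖f‖ * ‖(u : E)‖ :=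
      (Complex.re_le_norm _).trans (norm_inner_le_norm _ _)
    have h3 : 0 ≤ c * (‖(u : E)‖ - ‖f‖ / c) ^ 2 := by positivity
    have h4 : c * (‖(u : E)‖ - ‖f‖ / c) ^ 2 =
        c * ‖(u : E)‖ ^ 2 - 2 * (‖f‖ * ‖(u : E)‖) + ‖f‖ ^ 2 / c := by
      field_simp
      ring
    simp only [J]
    linarith
  set I := ⨅ u, J u with hI
  have J_ge : ∀ u, I ≤ J u := fun u => ciInf_le J_bdd u
  have hex : ∀ n : ℕ, ∃ u, J u < I + 1 / ((n : ℝ) + 1) := fun n =>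
    exists_lt_of_ciInf_lt (lt_add_of_pos_right _ (by positivity))
  choose u hu using hex
  -- By the parallelogram law, J(u_m) + J(u_n) minus twice J at their midpoint equals half of b(u_m
  -- - u_n, u_m - u_n), and J at the midpoint is at least the infimum.
  have hdiff : ∀ m n, b (u m - u n) (u m - u n) ≤ 2 / ((m : ℝ) + 1) + 2 / ((n : ℝ) + 1) := by
    intro m n
    have e1 := J_add (u n) (u m - u n) 1
    have e2 := J_add (u n) (u m - u n) (1 / 2)
    have e3 := J_ge (u n + ((1 / 2 : ℝ) : ℂ) • (u m - u n))
    have e4 : u n + ((1 : ℝ) : ℂ) • (u m - u n) = u m := by simp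
    rw [e4] at e1
    have := hu m
    have := hu n
    have d1 : 2 / ((m : ℝ) + 1) = 2 * (1 / ((m : ℝ) + 1)) := by ring
    have d2 : 2 / ((n : ℝ) + 1) = 2 * (1 / ((n : ℝ) + 1)) := by ring
    rw [d1, d2]
    linarith
  have hsmall : ∀ ε > 0, ∃ N : ℕ, ∀ m ≥ N, ∀ n ≥ N, b (u m - u n) (u m - u n) < ε := by
    intro ε hε
    obtain ⟨N, hN⟩ := exists_nat_one_div_lt (show 0 < ε / 4 by positivity)
    refine ⟨N, fun m hm n hn => (hdiff m n).trans_lt ?_⟩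
    have k : ∀ j ≥ N, 2 / ((j : ℝ) + 1) < ε / 2 := fun j hj => by
      have h1 : 1 / ((j : ℝ) + 1) ≤ 1 / ((N : ℝ) + 1) := by
        apply one_div_le_one_div_of_le (by positivity)
        have : (N : ℝ) ≤ j := by exact_mod_cast hj
        linarith
      have h2 : 2 / ((j : ℝ) + 1) = 2 * (1 / ((j : ℝ) + 1)) := by ring
      linarith
    linarith [k m hm, k n hn]
  have hcs : CauchySeq fun n => (u n : E) := by
    rw [Metric.cauchySeq_iff]
    intro ε hε
    obtain ⟨N, hN⟩ := hsmall (c * ε ^ 2) (by positivity)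
    refine ⟨N, fun m hm n hn => ?_⟩
    have h1 := (b_co (u m - u n)).trans_lt (hN m hm n hn)
    rw [dist_eq_norm]
    rw [Submodule.coe_sub] at h1
    exact lt_of_pow_lt_pow_left₀ 2 hε.le (lt_of_mul_lt_mul_left h1 hc.le)
  obtain ⟨ψ, hψ⟩ := cauchySeq_tendsto_of_complete hcs
  refine ⟨ψ, ⟨u, hψ, fun ε hε => ?_⟩, ?_⟩
  · obtain ⟨N, hN⟩ := hsmall ε hε
    exact ⟨N, fun m hm n hn => (b_form _).trans_lt (hN m hm n hn)⟩
  have hre : ∀ v : A.domain,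
      (inner ℂ ψ (A v + (lam : ℂ) • (v : E))).re = (inner ℂ f (v : E)).re := by
    intro v
    have hlim : Tendsto (fun n => b (u n) v) atTop
        (𝓝 (inner ℂ ψ (A v + (lam : ℂ) • (v : E))).re) :=
      (Complex.continuous_re.tendsto _).comp (hψ.inner tendsto_const_nhds)
    set d := (inner ℂ ψ (A v + (lam : ℂ) • (v : E))).re - (inner ℂ f (v : E)).re with hd
    -- Limit of J(u_n + t v) ≥ I > J(u_n) - 1/(n+1). A quadratic polynomial in t that is
    -- non-negative and vanishes at 0 has no linear term.
    have hquad : ∀ t : ℝ, 0 ≤ b v v * (t * t) + 2 * d * t + 0 := by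
      intro t
      have l1 : Tendsto (fun n : ℕ => 1 / ((n : ℝ) + 1) +
          2 * t * (b (u n) v - (inner ℂ f (v : E)).re) + t ^ 2 * b v v) atTop
          (𝓝 (0 + 2 * t * d + t ^ 2 * b v v)) :=
        (tendsto_one_div_add_atTop_nhds_zero_nat.add ((hlim.sub_const _).const_mul _)).add_const _
      have l2 := ge_of_tendsto' l1 (b := 0) fun n => by
        have h1 := J_ge (u n + (t : ℂ) • v)
        rw [J_add] at h1
        linarith [hu n]
      linarith
    have hdisc := discrim_le_zero hquad
    rw [discrim] at hdisc
    have hd0 : d = 0 := by nlinarith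
    linarith
  intro v
  refine Complex.ext (hre v).symm ?_
  -- The variational argument only gives real parts; replacing v by iv gives the imaginary ones.
  have h1 := hre (Complex.I • v)
  rw [LinearPMap.map_smul, Submodule.coe_smul, smul_comm (lam : ℂ) Complex.I, ← smul_add,
    inner_smul_right, inner_smul_right, Complex.I_mul_re, Complex.I_mul_re] at h1
  linarith

/-- `Φ` does not lie in the form domain modulo `D(Ā)` and `Ψ`. -/
def FormSingular (A : E →ₗ.[ℂ] E) (Φ Ψ : E) : Prop :=
  ∀ φ ∈ A.closure.domain, ∀ c₀ c₁ : ℂ, MemFormDomain A (φ + c₁ • Ψ + c₀ • Φ) → c₀ = 0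

/-- The finite-energy solution ψ of T*ψ = Φ differs from Ψ by an element of ker T*, that is, ψ = Ψ +
cΦ. Singularity of Φ forces c = 0. -/
theorem memFormDomain_psi (D : DeficiencyData A lam Φ Ψ) (hsing : FormSingular A Φ Ψ) :
    MemFormDomain A Ψ := by
  obtain ⟨ψ, h1, h2⟩ := D.exists_formSolution Φ
  have h3 := h2.add (D.shift_psi.smul (-1))
  obtain ⟨c, hc⟩ := D.ker _ fun u => (h3 u).symm.trans (by simp)
  have h4 : ψ = 0 + (1 : ℂ) • Ψ + c • Φ := by rw [← hc]; module
  rw [h4] at h1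
  have h5 := hsing 0 A.closure.domain.zero_mem c 1 h1
  rw [h5] at h1
  simpa using h1

theorem memFormDomain_rep_iff (D : DeficiencyData A lam Φ Ψ) (hsing : FormSingular A Φ Ψ)
    {φ : E} (hφ : φ ∈ A.closure.domain) (c₀ c₁ : ℂ) :
    MemFormDomain A (φ + c₁ • Ψ + c₀ • Φ) ↔ c₀ = 0 := by
  refine ⟨hsing φ hφ c₀ c₁, ?_⟩
  rintro rfl
  have hS := D.isNonnegSymm
  rw [zero_smul, add_zero]
  exact hS.formDomain.add_mem (hS.memFormDomain_of_mem_closure hφ)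
    (hS.formDomain.smul_mem _ (D.memFormDomain_psi hsing))

end DeficiencyData

end Friedrichs

/-! ### The minimal operator -/

section MinOp

variable {U : Set ℝ}

theorem inner_toLp {f g : ℝ → ℂ} (hf : MemLp f 2 (volume.restrict U))
    (hg : MemLp g 2 (volume.restrict U)) :
    inner ℂ (hf.toLp f) (hg.toLp g) = ∫ x in U, conj (f x) * g x := by
  rw [L2.inner_def]
  refine integral_congr_ae ?_
  filter_upwards [hf.coeFn_toLp, hg.coeFn_toLp] with x h1 h2
  rw [h1, h2, RCLike.inner_apply, mul_comm]

theorem inner_eq_integral (g h : L2 U) : inner ℂ g h = ∫ x in U, conj (g x) * h x := by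
  rw [L2.inner_def]
  refine integral_congr_ae (Eventually.of_forall fun x => ?_)
  simp only [RCLike.inner_apply, mul_comm]

theorem locallyIntegrableOn_of_memLp {f : ℝ → ℂ}
    (hf : MemLp f 2 (volume.restrict U)) : LocallyIntegrableOn f U volume :=
  locallyIntegrableOn_of_locallyIntegrable_restrict (hf.locallyIntegrable one_le_two)

theorem ae_eq_zero_of_forall_testFn (hU : IsOpen U) {f : ℝ → ℂ}
    (hf : LocallyIntegrableOn f U volume)
    (h : ∀ φ ∈ testFn U, ∫ x in U, φ x * f x = 0) : f =ᵐ[volume.restrict U] 0 := by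
  have := hU.ae_eq_zero_of_integral_contDiff_smul_eq_zero hf fun η h1 h2 h3 => by
    have hs : tsupport (fun x => (η x : ℂ)) ⊆ tsupport η :=
      closure_mono fun x hx => by
        simp only [Function.mem_support] at hx ⊢
        exact_mod_cast hx
    have hη : (fun x => (η x : ℂ)) ∈ testFn U :=
      ⟨Complex.ofRealCLM.contDiff.comp h1, h2.comp_left (g := fun x : ℝ => (x : ℂ)) rfl,
        hs.trans h3⟩
    have h4 := h _ hη
    rw [setIntegral_eq_integral_of_forall_compl_eq_zero] at h4
    · simpa using h4
    · intro x hx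
      rw [image_eq_zero_of_notMem_tsupport fun h => hx (h3 h)]
      simp
  exact (ae_restrict_iff' hU.measurableSet).mpr this

theorem conj_mem_testFn {φ : ℝ → ℂ} (hφ : φ ∈ testFn U) : (fun x => conj (φ x)) ∈ testFn U := by
  refine ⟨(Complex.conjCLE.contDiff (n := ∞)).comp hφ.1,
    hφ.2.1.comp_left (g := fun z : ℂ => conj z) (map_zero _),
    (closure_mono fun x hx => ?_).trans hφ.2.2⟩
  simpa using hx

theorem testFn_eq_zero {φ : ℝ → ℂ} (hφ : φ ∈ testFn U) {x : ℝ} (hx : x ∉ U) : φ x = 0 :=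
  image_eq_zero_of_notMem_tsupport fun h => hx (hφ.2.2 h)

theorem hasDerivAt_testFn {φ : ℝ → ℂ} (hφ : φ ∈ testFn U) (x : ℝ) : HasDerivAt φ (deriv φ x) x :=
  (hφ.1.differentiable (by simp) x).hasDerivAt

theorem hasDerivAt_deriv_testFn {φ : ℝ → ℂ} (hφ : φ ∈ testFn U) (x : ℝ) :
    HasDerivAt (deriv φ) (deriv (deriv φ) x) x :=
  ((contDiff_deriv_testFn hφ.1).differentiable (by simp) x).hasDerivAt

theorem deriv_mem_testFn {φ : ℝ → ℂ} (hφ : φ ∈ testFn U) : deriv φ ∈ testFn U :=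
  ⟨contDiff_deriv_testFn hφ.1, hφ.2.1.deriv, (tsupport_deriv_subset).trans hφ.2.2⟩

theorem integrable_normSq_testFn {φ : ℝ → ℂ} (hφ : φ ∈ testFn U) :
    Integrable fun x => ‖φ x‖ ^ 2 := by
  have h1 : Continuous φ := hφ.1.continuous
  have h2 : Continuous fun x => ‖φ x‖ ^ 2 := h1.norm.pow 2
  have h3 : HasCompactSupport fun x => ‖φ x‖ ^ 2 := by
    refine hφ.2.1.mono fun x hx => ?_
    rw [Function.mem_support] at hx ⊢
    intro h
    simp [h] at hx
  exact h2.integrable_of_hasCompactSupport h3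

theorem dense_range_testIncl (hU : IsOpen U) :
    Dense ((LinearMap.range (testIncl U) : Submodule ℂ (L2 U)) : Set (L2 U)) := by
  rw [Submodule.dense_iff_topologicalClosure_eq_top, Submodule.topologicalClosure_eq_top_iff,
    Submodule.eq_bot_iff]
  intro g hg
  rw [Submodule.mem_orthogonal] at hg
  have h0 : (g : ℝ → ℂ) =ᵐ[volume.restrict U] 0 := by
    refine ae_eq_zero_of_forall_testFn hU (locallyIntegrableOn_of_memLp (Lp.memLp g))
      fun φ hφ => ?_
    have h1 := hg (testIncl U ⟨_, conj_mem_testFn hφ⟩) ⟨_, rfl⟩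
    have h2 : testIncl U ⟨_, conj_mem_testFn hφ⟩ = (testFn_memLp (conj_mem_testFn hφ)).toLp _ := rfl
    rw [h2, ← Lp.toLp_coeFn g (Lp.memLp g), inner_toLp] at h1
    simpa using h1
  exact (Lp.eq_zero_iff_ae_eq_zero).mpr h0

variable {α : ℝ} {k : ℤ}

theorem exists_testFn_of_mem (hU : IsOpen U) (h0 : (0 : ℝ) ∉ U) (u : (minOp α k hU h0).domain) :
    ∃ φ : testFn U, (u : L2 U) = (testFn_memLp φ.2).toLp φ.1 ∧
      minOp α k hU h0 u = (diffExpr_memLp α k hU h0 φ.2).toLp _ := by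
  obtain ⟨u, φ, rfl⟩ := u
  refine ⟨φ, rfl, ?_⟩
  change testAction α k hU h0 ((LinearEquiv.ofInjective (testIncl U) _).symm _) = _
  have : (LinearEquiv.ofInjective (testIncl U) (testIncl_injective hU)).symm
      ⟨testIncl U φ, φ, rfl⟩ = φ := by
    rw [LinearEquiv.symm_apply_eq]
    rfl
  erw [this]
  rfl

theorem exists_mem_of_testFn (hU : IsOpen U) (h0 : (0 : ℝ) ∉ U) {φ : ℝ → ℂ} (hφ : φ ∈ testFn U) :
    ∃ u : (minOp α k hU h0).domain, (u : L2 U) = (testFn_memLp hφ).toLp φ ∧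
      minOp α k hU h0 u = (diffExpr_memLp α k hU h0 hφ).toLp _ := by
  refine ⟨⟨testIncl U ⟨φ, hφ⟩, ⟨φ, hφ⟩, rfl⟩, rfl, ?_⟩
  obtain ⟨ψ, h1, h2⟩ := exists_testFn_of_mem (α := α) (k := k) hU h0
    ⟨testIncl U ⟨φ, hφ⟩, ⟨φ, hφ⟩, rfl⟩
  have : (⟨φ, hφ⟩ : testFn U) = ψ := testIncl_injective hU h1
  subst this
  exact h2

theorem integral_conj_mul_neg_deriv2 {φ ψ : ℝ → ℂ} (hφ : φ ∈ testFn U) (hψ : ψ ∈ testFn U) :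
    ∫ x, conj (φ x) * -deriv (deriv ψ) x = ∫ x, conj (deriv φ x) * deriv ψ x := by
  have hd : ∀ x, HasDerivAt (fun y => conj (φ y)) (conj (deriv φ x)) x := fun x =>
    (hasDerivAt_testFn hφ x).star
  have c1 : Continuous fun x => conj (φ x) := (conj_mem_testFn hφ).1.continuous
  have c1' : HasCompactSupport fun x => conj (φ x) := (conj_mem_testFn hφ).2.1
  have c2 : Continuous fun x => conj (deriv φ x) := (conj_mem_testFn (deriv_mem_testFn hφ)).1.continuous
  have c2' : HasCompactSupport fun x => conj (deriv φ x) :=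
    (conj_mem_testFn (deriv_mem_testFn hφ)).2.1
  have c3 := (deriv_mem_testFn hψ).1.continuous
  have c4 := (deriv_mem_testFn (deriv_mem_testFn hψ)).1.continuous
  have := integral_mul_deriv_eq_deriv_mul_of_integrable (u := fun y => conj (φ y)) (v := deriv ψ)
    (u' := fun y => conj (deriv φ y)) (v' := deriv (deriv ψ)) (fun x _ => hd x)
    (fun x _ => hasDerivAt_deriv_testFn hψ x)
    ((c1.mul c4).integrable_of_hasCompactSupport c1'.mul_right)
    ((c2.mul c3).integrable_of_hasCompactSupport c2'.mul_right)
    ((c1.mul c3).integrable_of_hasCompactSupport c1'.mul_right)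
  simp only [mul_neg, integral_neg, this, neg_neg]

theorem integrable_potential (α : ℝ) (k : ℤ) (hU : IsOpen U) (h0 : (0 : ℝ) ∉ U) {φ ψ : ℝ → ℂ}
    (hφ : φ ∈ testFn U) (hψ : ψ ∈ testFn U) :
    Integrable fun x => conj (φ x) * ((potential α k x : ℂ) * ψ x) := by
  have hc' : HasCompactSupport (fun x => conj (φ x) * ((potential α k x : ℂ) * ψ x)) :=
    hψ.2.1.mul_left.mul_left
  have hon : ContinuousOn (fun x => conj (φ x) * ((potential α k x : ℂ) * ψ x)) U :=
    (conj_mem_testFn hφ).1.continuous.continuousOn.mul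
      ((Complex.continuous_ofReal.comp_continuousOn (continuousOn_potential α k h0)).mul
        hψ.1.continuous.continuousOn)
  refine (hon.continuous_of_tsupport_subset hU ?_).integrable_of_hasCompactSupport hc'
  exact (tsupport_mul_subset_left (f := fun x => conj (φ x))).trans (conj_mem_testFn hφ).2.2

theorem setIntegral_eq_integral_testFn {φ f : ℝ → ℂ} (hφ : φ ∈ testFn U) :
    ∫ x in U, conj (φ x) * f x = ∫ x, conj (φ x) * f x :=
  setIntegral_eq_integral_of_forall_compl_eq_zero fun x hx => by
    rw [testFn_eq_zero hφ hx, map_zero, zero_mul]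

theorem integral_conj_mul_diffExpr (α : ℝ) (k : ℤ) (hU : IsOpen U) (h0 : (0 : ℝ) ∉ U) {φ ψ : ℝ → ℂ}
    (hφ : φ ∈ testFn U) (hψ : ψ ∈ testFn U) :
    ∫ x in U, conj (φ x) * diffExpr α k ψ x =
      (∫ x, conj (deriv φ x) * deriv ψ x) + ∫ x, conj (φ x) * ((potential α k x : ℂ) * ψ x) := by
  rw [setIntegral_eq_integral_testFn hφ, ← integral_conj_mul_neg_deriv2 hφ hψ, ← integral_add]
  · exact integral_congr_ae (Eventually.of_forall fun x => by simp only [diffExpr]; ring)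
  · have c1 := (conj_mem_testFn hφ)
    exact (c1.1.continuous.mul
      (deriv_mem_testFn (deriv_mem_testFn hψ)).1.continuous.neg).integrable_of_hasCompactSupport
      c1.2.1.mul_right
  · exact integrable_potential α k hU h0 hφ hψ

theorem conj_mul_self_eq (z : ℂ) : conj z * z = ((‖z‖ ^ 2 : ℝ) : ℂ) := by
  rw [← Complex.normSq_eq_conj_mul_self, Complex.normSq_eq_norm_sq]

theorem integral_conj_mul_diffExpr_self (α : ℝ) (k : ℤ) (hU : IsOpen U) (h0 : (0 : ℝ) ∉ U)
    {φ : ℝ → ℂ} (hφ : φ ∈ testFn U) :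
    ∫ x in U, conj (φ x) * diffExpr α k φ x =
      (((∫ x, ‖deriv φ x‖ ^ 2) + ∫ x, potential α k x * ‖φ x‖ ^ 2 : ℝ) : ℂ) := by
  rw [integral_conj_mul_diffExpr α k hU h0 hφ hφ, Complex.ofReal_add, ← integral_complex_ofReal,
    ← integral_complex_ofReal]
  congr 1
  · exact integral_congr_ae (Eventually.of_forall fun x => conj_mul_self_eq _)
  · refine integral_congr_ae (Eventually.of_forall fun x => ?_)
    simp only [Complex.ofReal_mul, ← conj_mul_self_eq]
    ring

theorem integrable_potential_normSq (α : ℝ) (k : ℤ) (hU : IsOpen U) (h0 : (0 : ℝ) ∉ U) {φ : ℝ → ℂ}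
    (hφ : φ ∈ testFn U) : Integrable fun x => potential α k x * ‖φ x‖ ^ 2 := by
  refine (integrable_potential α k hU h0 hφ hφ).re.congr (Eventually.of_forall fun x => ?_)
  have : conj (φ x) * ((potential α k x : ℂ) * φ x) =
      ((potential α k x * ‖φ x‖ ^ 2 : ℝ) : ℂ) := by
    rw [Complex.ofReal_mul, ← conj_mul_self_eq]; ring
  simp only [this]
  exact Complex.ofReal_re _

theorem potential_nonneg (hα : 0 ≤ α) (k : ℤ) (x : ℝ) : 0 ≤ potential α k x := by
  unfold potential
  positivity

/-- The shift that makes the operator coercive. -/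
def shiftConst (k : ℤ) : ℝ := if k = 0 then 1 else 0

/-- For k = 0 the potential has no positive lower bound, whence the shift by 1. For k ≠ 0 the term
k²|x|^(2α) is at least 1 when |x| ≥ 1, and the inverse-square term is at least α(2+α)/4 when |x| ≤
1. The latter bound is void for α = 0, where the potential is the constant k². -/
theorem exists_potential_lower (hα : 0 ≤ α) (k : ℤ) :
    ∃ c > 0, ∀ x ≠ 0, c ≤ potential α k x + shiftConst k := by
  by_cases hk : k = 0
  · refine ⟨1, one_pos, fun x _ => ?_⟩
    rw [shiftConst, if_pos hk]
    linarith [potential_nonneg hα k x]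
  have hk1 : (1 : ℝ) ≤ (k : ℝ) ^ 2 := by
    have : (1 : ℤ) ≤ k ^ 2 := by
      have := sq_pos_of_ne_zero hk
      omega
    exact_mod_cast this
  rw [shiftConst, if_neg hk]
  rcases hα.eq_or_lt with rfl | hα
  · refine ⟨1, one_pos, fun x _ => ?_⟩
    simpa [potential] using hk1
  refine ⟨min 1 (α * (2 + α) / 4), by positivity, fun x hx => ?_⟩
  rw [add_zero]
  have hx2 : 0 < x ^ 2 := by positivity
  rcases le_total 1 |x| with h | h
  · refine (min_le_left _ _).trans ?_
    have h1 : 1 ≤ |x| ^ (2 * α) := Real.one_le_rpow h (by positivity)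
    have h2 : 0 ≤ α * (2 + α) / (4 * x ^ 2) := by positivity
    unfold potential
    nlinarith
  · refine (min_le_right _ _).trans ?_
    have h1 : x ^ 2 ≤ 1 := by rw [← sq_abs]; exact pow_le_one₀ (abs_nonneg x) h
    have h2 : α * (2 + α) / 4 ≤ α * (2 + α) / (4 * x ^ 2) := by
      apply div_le_div_of_nonneg_left (by positivity) (by positivity)
      linarith
    have h3 : 0 ≤ (k : ℝ) ^ 2 * |x| ^ (2 * α) := by positivity
    unfold potential
    linarith

theorem norm_sq_toLp {f : ℝ → ℂ} (hf : MemLp f 2 (volume.restrict U)) :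
    ‖hf.toLp f‖ ^ 2 = ∫ x in U, ‖f x‖ ^ 2 := by
  have h1 := inner_toLp hf hf
  rw [inner_self_eq_norm_sq_to_K] at h1
  have h2 : ∫ x in U, conj (f x) * f x = ((∫ x in U, ‖f x‖ ^ 2 : ℝ) : ℂ) := by
    rw [← integral_complex_ofReal]
    exact integral_congr_ae (Eventually.of_forall fun x => conj_mul_self_eq _)
  rw [h2] at h1
  refine Complex.ofReal_injective ?_
  rw [← h1, Complex.ofReal_pow]
  rfl

theorem re_inner_minOp (hU : IsOpen U) (h0 : (0 : ℝ) ∉ U) {φ : ℝ → ℂ} (hφ : φ ∈ testFn U) :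
    (inner ℂ ((testFn_memLp hφ).toLp φ) ((diffExpr_memLp α k hU h0 hφ).toLp _)).re =
      (∫ x, ‖deriv φ x‖ ^ 2) + ∫ x, potential α k x * ‖φ x‖ ^ 2 := by
  rw [inner_toLp, integral_conj_mul_diffExpr_self α k hU h0 hφ, Complex.ofReal_re]

theorem isNonnegSymm_minOp (hα : 0 ≤ α) (k : ℤ) (hU : IsOpen U) (h0 : (0 : ℝ) ∉ U) :
    IsNonnegSymm (minOp α k hU h0) where
  dense := dense_range_testIncl hU
  symm u v := by
    obtain ⟨φ, h1, h2⟩ := exists_testFn_of_mem hU h0 u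
    obtain ⟨ψ, h3, h4⟩ := exists_testFn_of_mem hU h0 v
    rw [h1, h2, h3, h4, ← inner_conj_symm, inner_toLp, inner_toLp,
      integral_conj_mul_diffExpr α k hU h0 φ.2 ψ.2, integral_conj_mul_diffExpr α k hU h0 ψ.2 φ.2,
      map_add, ← integral_conj, ← integral_conj]
    congr 1
    · refine integral_congr_ae (Eventually.of_forall fun x => ?_)
      simp only [map_mul, Complex.conj_conj, mul_comm]
    · refine integral_congr_ae (Eventually.of_forall fun x => ?_)
      simp only [map_mul, Complex.conj_conj, Complex.conj_ofReal]
      ring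
  nonneg u := by
    obtain ⟨φ, h1, h2⟩ := exists_testFn_of_mem hU h0 u
    rw [h1, h2, re_inner_minOp hU h0 φ.2]
    refine add_nonneg (integral_nonneg fun x => by positivity) (integral_nonneg fun x => ?_)
    exact mul_nonneg (potential_nonneg hα k x) (by positivity)

theorem coercive_minOp (hα : 0 ≤ α) (k : ℤ) (hU : IsOpen U) (h0 : (0 : ℝ) ∉ U) :
    ∃ c > 0, ∀ u : (minOp α k hU h0).domain, c * ‖(u : L2 U)‖ ^ 2 ≤
      (inner ℂ (u : L2 U) (minOp α k hU h0 u)).re + shiftConst k * ‖(u : L2 U)‖ ^ 2 := by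
  obtain ⟨c, hc, hV⟩ := exists_potential_lower hα k
  refine ⟨c, hc, fun u => ?_⟩
  obtain ⟨⟨φ, hφ⟩, h1, h2⟩ := exists_testFn_of_mem hU h0 u
  have hint := integrable_normSq_testFn hφ
  have hres : ∫ x in U, ‖φ x‖ ^ 2 = ∫ x, ‖φ x‖ ^ 2 :=
    setIntegral_eq_integral_of_forall_compl_eq_zero fun x hx => by
      rw [testFn_eq_zero hφ hx]; simp
  rw [h1, h2, re_inner_minOp hU h0 hφ, norm_sq_toLp, hres]
  have e1 : 0 ≤ ∫ x, ‖deriv φ x‖ ^ 2 := integral_nonneg fun x => by positivity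
  have e2 : c * ∫ x, ‖φ x‖ ^ 2 ≤
      (∫ x, potential α k x * ‖φ x‖ ^ 2) + shiftConst k * ∫ x, ‖φ x‖ ^ 2 := by
    rw [← integral_const_mul, ← integral_const_mul, ← integral_add
      (integrable_potential_normSq α k hU h0 hφ) (hint.const_mul _)]
    refine integral_mono (hint.const_mul _)
      ((integrable_potential_normSq α k hU h0 hφ).add (hint.const_mul _)) fun x => ?_
    simp only
    -- The lower bound on the potential excludes the origin, but φ vanishes there.
    by_cases hx : x = 0
    · rw [testFn_eq_zero hφ (hx ▸ h0)]; simp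
    · rw [← add_mul]
      exact mul_le_mul_of_nonneg_right (hV x hx) (by positivity)
  linarith

/-! ### Boundary behaviour at the origin -/

/-- Finite energy limits a function vanishing at 0 to growth √|x|, by integrating φ' from the
origin. The constant enters additively, which lets AM–GM replace Cauchy–Schwarz. -/
theorem norm_testFn_le {φ : ℝ → ℂ} (hφ : φ ∈ testFn U) (h0 : (0 : ℝ) ∉ U) {x : ℝ} (hx : x ≠ 0) :
    ‖φ x‖ ≤ √|x| / 2 * (1 + ∫ y, ‖deriv φ y‖ ^ 2) := by
  have hc := (deriv_mem_testFn hφ).1.continuous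
  have hint := integrable_normSq_testFn (deriv_mem_testFn hφ)
  have h1 : φ x = ∫ y in (0)..x, deriv φ y := by
    rw [intervalIntegral.integral_eq_sub_of_hasDerivAt (fun y _ => hasDerivAt_testFn hφ y)
      (hc.intervalIntegrable _ _), testFn_eq_zero hφ h0, sub_zero]
  set s := √|x| with hs
  have hs0 : 0 < s := Real.sqrt_pos.mpr (abs_pos.mpr hx)
  have hss : s * s = |x| := Real.mul_self_sqrt (abs_nonneg x)
  rw [h1]
  refine (intervalIntegral.norm_integral_le_integral_norm_uIoc).trans ?_
  -- The weight s = √|x| balances the two terms: over an interval of length s² the constant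
  -- integrates to s/2.
  have hpt : ∀ y, ‖deriv φ y‖ ≤ s⁻¹ / 2 + s / 2 * ‖deriv φ y‖ ^ 2 := fun y => by
    have : 0 ≤ s / 2 * (s⁻¹ - ‖deriv φ y‖) ^ 2 := by positivity
    have e : s / 2 * (s⁻¹ - ‖deriv φ y‖) ^ 2 =
        s⁻¹ / 2 + s / 2 * ‖deriv φ y‖ ^ 2 - ‖deriv φ y‖ := by
      field_simp
      ring
    linarith
  have hfin : volume (uIoc 0 x) ≠ ⊤ := by rw [uIoc]; exact measure_Ioc_lt_top.ne
  calc ∫ y in uIoc 0 x, ‖deriv φ y‖ ≤ ∫ y in uIoc 0 x, (s⁻¹ / 2 + s / 2 * ‖deriv φ y‖ ^ 2) := by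
        refine setIntegral_mono ?_ ?_ hpt
        · exact ((hc.norm.intervalIntegrable 0 x).def')
        · exact (integrableOn_const hfin).add (hint.integrableOn.const_mul _)
    _ = s⁻¹ / 2 * |x| + s / 2 * ∫ y in uIoc 0 x, ‖deriv φ y‖ ^ 2 := by
        have hconst : Integrable (fun _ : ℝ => s⁻¹ / 2) (volume.restrict (uIoc 0 x)) :=
          integrableOn_const hfin
        rw [integral_add hconst (hint.integrableOn.const_mul _),
          integral_const_mul, setIntegral_const]
        simp [Measure.real, Real.volume_uIoc, mul_comm]
    _ ≤ s⁻¹ / 2 * |x| + s / 2 * ∫ y, ‖deriv φ y‖ ^ 2 := by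
        refine add_le_add le_rfl (mul_le_mul_of_nonneg_left ?_ (by positivity))
        exact setIntegral_le_integral hint (Eventually.of_forall fun y => by positivity)
    _ = s / 2 * (1 + ∫ y, ‖deriv φ y‖ ^ 2) := by
        rw [← hss]; field_simp

theorem HasLimits.unique (hU : IsOpen U) (hcl : (0 : ℝ) ∈ closure U) {g : L2 U} {g₀ g₁ h₀ h₁ : ℂ}
    (h : HasLimits α g g₀ g₁) (h' : HasLimits α g h₀ h₁) : g₀ = h₀ ∧ g₁ = h₁ := by
  obtain ⟨f, fc, fe, f0, f1⟩ := h
  obtain ⟨f', fc', fe', f0', f1'⟩ := h'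
  have heq : EqOn f f' U := Measure.eqOn_open_of_ae_eq (fe.symm.trans fe') hU fc fc'
  have hne : (𝓝[U] (0 : ℝ)).NeBot := mem_closure_iff_nhdsWithin_neBot.mp hcl
  have hev : f =ᶠ[𝓝[U] 0] f' := heq.eventuallyEq_nhdsWithin
  have e0 : g₀ = h₀ := by
    refine tendsto_nhds_unique f0 (f0'.congr' ?_)
    filter_upwards [hev] with x hx
    rw [hx]
  subst e0
  refine ⟨rfl, tendsto_nhds_unique f1 (f1'.congr' ?_)⟩
  filter_upwards [hev] with x hx
  rw [hx]

theorem ae_tendsto_subseq {u : ℕ → L2 U} {g : L2 U} {φ : ℕ → ℝ → ℂ}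
    (h : Tendsto u atTop (𝓝 g)) (hφ : ∀ n, u n =ᵐ[volume.restrict U] φ n) :
    ∃ ns : ℕ → ℕ, StrictMono ns ∧
      ∀ᵐ x ∂volume.restrict U, Tendsto (fun i => φ (ns i) x) atTop (𝓝 (g x)) := by
  obtain ⟨ns, h1, h2⟩ := (tendstoInMeasure_of_tendsto_Lp h).exists_seq_tendsto_ae
  refine ⟨ns, h1, ?_⟩
  filter_upwards [h2, ae_all_iff.mpr hφ] with x hx hx'
  simpa only [hx'] using hx

/-- A fixed member φ_N of the approximating sequence vanishes near 0, and the others differ from it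
by O(√|x|) uniformly. So the limit is O(√|x|) there, and multiplying by |x|^(α/2) with α ≥ 0 keeps
it vanishing at 0. -/
theorem eq_zero_of_memFormDomain (hα : 0 ≤ α) (hU : IsOpen U) (h0 : (0 : ℝ) ∉ U)
    (hcl : (0 : ℝ) ∈ closure U) {g : L2 U} (hg : MemFormDomain (minOp α k hU h0) g) {g₀ g₁ : ℂ}
    (hl : HasLimits α g g₀ g₁) : g₀ = 0 := by
  obtain ⟨u, hu1, hu2⟩ := hg
  choose φ hφ1 hφ2 using fun n => exists_testFn_of_mem hU h0 (u n)
  obtain ⟨N, hN⟩ := hu2 1 one_pos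
  -- The difference has energy below 1, and `norm_testFn_le` then gives √|x|/2 · (1 + 1).
  have hbd : ∀ n ≥ N, ∀ x ≠ 0, ‖(φ n).1 x - (φ N).1 x‖ ≤ √|x| := by
    intro n hn x hx
    have h1 := hN n hn N le_rfl
    have hd := (φ n - φ N).2
    have e1 : ((u n - u N : (minOp α k hU h0).domain) : L2 U) =
        (testFn_memLp hd).toLp (φ n - φ N).1 := by
      rw [Submodule.coe_sub, hφ1, hφ1]; rfl
    have e2 : minOp α k hU h0 (u n - u N) = (diffExpr_memLp α k hU h0 hd).toLp _ := by
      obtain ⟨v, hv1, hv2⟩ := exists_mem_of_testFn (α := α) (k := k) hU h0 hd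
      rw [← hv2]
      congr 1
      exact Subtype.ext (e1.trans hv1.symm)
    rw [(isNonnegSymm_minOp hα k hU h0).norm_inner, e1, e2, re_inner_minOp hU h0 hd] at h1
    have h2 : 0 ≤ ∫ x, potential α k x * ‖(φ n - φ N).1 x‖ ^ 2 := integral_nonneg fun x =>
      mul_nonneg (potential_nonneg hα k x) (by positivity)
    have h3 := norm_testFn_le hd h0 hx
    have h4 : 0 ≤ √|x| := Real.sqrt_nonneg _
    change ‖(φ n - φ N).1 x‖ ≤ _
    nlinarith
  have hvan : ∀ᶠ x in 𝓝 (0 : ℝ), (φ N).1 x = 0 := by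
    have : (tsupport (φ N).1)ᶜ ∈ 𝓝 (0 : ℝ) :=
      (isClosed_tsupport _).isOpen_compl.mem_nhds fun h => h0 ((φ N).2.2.2 h)
    filter_upwards [this] with x hx
    exact image_eq_zero_of_notMem_tsupport hx
  obtain ⟨δ, hδ, hδ'⟩ := Metric.eventually_nhds_iff_ball.mp hvan
  obtain ⟨ns, hns, hae⟩ := ae_tendsto_subseq hu1 (φ := fun n => (φ n).1) fun n => by
    rw [hφ1]; exact MemLp.coeFn_toLp _
  obtain ⟨f, fc, fe, f0, -⟩ := hl
  have hfae : ∀ᵐ x ∂volume.restrict U, x ∈ Metric.ball (0 : ℝ) δ → x ≠ 0 → ‖f x‖ ≤ √|x| := by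
    filter_upwards [hae, fe] with x hx hx' hball hne
    rw [hx'] at hx
    refine le_of_tendsto hx.norm ?_
    filter_upwards [hns.tendsto_atTop.eventually_ge_atTop N] with i hi
    have := hbd (ns i) hi x hne
    rwa [hδ' x hball, sub_zero] at this
  have hfall : ∀ x ∈ U ∩ Metric.ball 0 δ, ‖f x‖ ≤ √|x| := by
    have hopen : IsOpen (U ∩ Metric.ball (0 : ℝ) δ) := hU.inter Metric.isOpen_ball
    -- The inequality holds almost everywhere; its positive part is continuous, so it holds
    -- everywhere.
    have : EqOn (fun x => max (‖f x‖ - √|x|) 0) (fun _ => 0) (U ∩ Metric.ball 0 δ) := by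
      refine Measure.eqOn_open_of_ae_eq (μ := volume) ?_ hopen ?_ continuousOn_const
      · refine (ae_restrict_iff' hopen.measurableSet).mpr ?_
        filter_upwards [(ae_restrict_iff' hU.measurableSet).mp hfae] with x hx hx'
        exact max_eq_right (sub_nonpos.mpr (hx hx'.1 hx'.2 fun h => h0 (h ▸ hx'.1)))
      · have hfc : ContinuousOn (fun x => ‖f x‖) (U ∩ Metric.ball 0 δ) :=
          (fc.mono inter_subset_left).norm
        have : Continuous fun x : ℝ => √|x| := Real.continuous_sqrt.comp continuous_abs
        exact (hfc.sub this.continuousOn).sup continuousOn_const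
    intro x hx
    have := this hx
    simp only [max_eq_right_iff] at this
    linarith
  have hne : (𝓝[U] (0 : ℝ)).NeBot := mem_closure_iff_nhdsWithin_neBot.mp hcl
  refine tendsto_nhds_unique f0 ?_
  have hsq : Tendsto (fun x : ℝ => √|x|) (𝓝[U] 0) (𝓝 0) := by
    have : Continuous fun x : ℝ => √|x| := Real.continuous_sqrt.comp continuous_abs
    have h := this.tendsto 0
    rw [abs_zero, Real.sqrt_zero] at h
    exact h.mono_left nhdsWithin_le_nhds
  refine squeeze_zero_norm' ?_ hsq
  filter_upwards [self_mem_nhdsWithin, nhdsWithin_le_nhds (Metric.ball_mem_nhds (0 : ℝ) hδ),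
    nhdsWithin_le_nhds (Metric.ball_mem_nhds (0 : ℝ) one_pos)] with x h1 h2 h3
  rw [mem_ball_zero_iff, Real.norm_eq_abs] at h3
  rw [norm_mul, Complex.norm_real, Real.norm_of_nonneg (by positivity)]
  calc _ ≤ 1 * √|x| := mul_le_mul (Real.rpow_le_one (abs_nonneg x) h3.le (by positivity))
        (hfall x ⟨h1, h2⟩) (norm_nonneg _) zero_le_one
    _ = √|x| := one_mul _

end MinOp

/-! ### The differential equation on the half-line -/

section HalfLineODE

/-- The differential expression `-φ'' + q φ`. -/
def schrodinger (q : ℝ → ℝ) (φ : ℝ → ℂ) (x : ℝ) : ℂ := -deriv (deriv φ) x + (q x : ℂ) * φ x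

variable {q : ℝ → ℝ} {y y' r φ : ℝ → ℂ}

theorem eventually_eq_zero_of_nonpos (hφ : φ ∈ testFn (Ioi 0)) {x : ℝ} (hx : x ≤ 0) :
    φ =ᶠ[𝓝 x] 0 :=
  notMem_tsupport_iff_eventuallyEq.mp fun h => hx.not_gt (hφ.2.2 h)

theorem exists_tsupport_subset_Icc (hφ : φ ∈ testFn (Ioi 0)) :
    ∃ δ > 0, ∃ M > 0, tsupport φ ⊆ Icc δ M := by
  rcases (tsupport φ).eq_empty_or_nonempty with h | h
  · exact ⟨1, one_pos, 1, one_pos, h ▸ empty_subset _⟩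
  · obtain ⟨δ, h1, h2⟩ := hφ.2.1.isCompact.exists_isLeast h
    obtain ⟨M, h3, h4⟩ := hφ.2.1.isCompact.exists_isGreatest h
    exact ⟨δ, hφ.2.2 h1, M, hφ.2.2 h3, fun x hx => ⟨h2 hx, h4 hx⟩⟩

/-- Lagrange's identity for -y'' + qy = r. It extends to x ≤ 0, where y is arbitrary, because φ
vanishes near such points; integration over the whole line then leaves no boundary terms. -/
theorem hasDerivAt_wronskian_testFn (hφ : φ ∈ testFn (Ioi 0))
    (hy : ∀ x > 0, HasDerivAt y (y' x) x)
    (hy' : ∀ x > 0, HasDerivAt y' ((q x : ℂ) * y x - r x) x) (x : ℝ) :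
    HasDerivAt (fun t => y' t * φ t - y t * deriv φ t)
      (y x * schrodinger q φ x - r x * φ x) x := by
  rcases le_or_gt x 0 with hx | hx
  · have h1 := eventually_eq_zero_of_nonpos hφ hx
    have h2 := eventually_eq_zero_of_nonpos (deriv_mem_testFn hφ) hx
    have h3 := eventually_eq_zero_of_nonpos (deriv_mem_testFn (deriv_mem_testFn hφ)) hx
    have e : y x * schrodinger q φ x - r x * φ x = 0 := by
      simp [schrodinger, h1.eq_of_nhds, h3.eq_of_nhds]
    rw [e]
    refine (hasDerivAt_const x (0 : ℂ)).congr_of_eventuallyEq ?_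
    filter_upwards [h1, h2] with t ht1 ht2
    simp [ht1, ht2]
  · refine (((hy' x hx).mul (hasDerivAt_testFn hφ x)).sub
      ((hy x hx).mul (hasDerivAt_deriv_testFn hφ x))).congr_deriv ?_
    simp only [schrodinger]
    ring

theorem continuous_mul_testFn {f : ℝ → ℂ} (hf : ContinuousOn f (Ioi 0)) (hφ : φ ∈ testFn (Ioi 0)) :
    Continuous fun x => f x * φ x :=
  (hf.mul hφ.1.continuous.continuousOn).continuous_of_tsupport_subset isOpen_Ioi
    ((tsupport_mul_subset_right (f := f)).trans hφ.2.2)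

theorem continuous_mul_schrodinger {f : ℝ → ℂ} (hf : ContinuousOn f (Ioi 0))
    (hq : ContinuousOn q (Ioi 0)) (hφ : φ ∈ testFn (Ioi 0)) :
    Continuous fun x => f x * schrodinger q φ x := by
  have h1 := continuous_mul_testFn hf (deriv_mem_testFn (deriv_mem_testFn hφ))
  have h2 := continuous_mul_testFn (hf.mul (Complex.continuous_ofReal.comp_continuousOn hq)) hφ
  refine (h1.neg.add h2).congr fun x => ?_
  simp only [schrodinger, Pi.add_apply, Pi.neg_apply, Pi.mul_apply, Function.comp_apply]
  ring

theorem schrodinger_eq_zero {x : ℝ} (hx : x ∉ tsupport φ) :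
    schrodinger q φ x = 0 := by
  have h1 : φ x = 0 := image_eq_zero_of_notMem_tsupport hx
  have h2 : deriv (deriv φ) x = 0 := image_eq_zero_of_notMem_tsupport fun h =>
    hx ((tsupport_deriv_subset.trans tsupport_deriv_subset) h)
  rw [schrodinger, h1, h2]
  simp

theorem continuousOn_of_hasDerivAt (hy : ∀ x > 0, HasDerivAt y (y' x) x) :
    ContinuousOn y (Ioi 0) := fun x hx => (hy x hx).continuousAt.continuousWithinAt

theorem intervalIntegral_wronskian_testFn (hq : ContinuousOn q (Ioi 0))
    (hr : ContinuousOn r (Ioi 0)) (hφ : φ ∈ testFn (Ioi 0))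
    (hy : ∀ x > 0, HasDerivAt y (y' x) x)
    (hy' : ∀ x > 0, HasDerivAt y' ((q x : ℂ) * y x - r x) x) (x : ℝ) :
    ∫ t in (0)..x, (y t * schrodinger q φ t - r t * φ t) = y' x * φ x - y x * deriv φ x := by
  rw [intervalIntegral.integral_eq_sub_of_hasDerivAt
    (fun t _ => hasDerivAt_wronskian_testFn hφ hy hy' t)]
  · rw [testFn_eq_zero hφ self_notMem_Ioi, testFn_eq_zero (deriv_mem_testFn hφ) self_notMem_Ioi]
    ring
  · exact ((continuous_mul_schrodinger (continuousOn_of_hasDerivAt hy) hq hφ).sub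
      (continuous_mul_testFn hr hφ)).intervalIntegrable _ _

theorem setIntegral_mul_schrodinger (hq : ContinuousOn q (Ioi 0))
    (hr : ContinuousOn r (Ioi 0)) (hφ : φ ∈ testFn (Ioi 0))
    (hy : ∀ x > 0, HasDerivAt y (y' x) x)
    (hy' : ∀ x > 0, HasDerivAt y' ((q x : ℂ) * y x - r x) x) :
    ∫ x in Ioi 0, y x * schrodinger q φ x = ∫ x in Ioi 0, r x * φ x := by
  have hyc := continuousOn_of_hasDerivAt hy
  have hyc' := continuousOn_of_hasDerivAt hy'
  have s1 : HasCompactSupport fun x => y x * schrodinger q φ x :=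
    HasCompactSupport.intro hφ.2.1.isCompact fun x hx => by
      rw [schrodinger_eq_zero hx, mul_zero]
  have s2 : HasCompactSupport fun x => r x * φ x := hφ.2.1.mul_left
  have i1 : Integrable fun x => y x * schrodinger q φ x :=
    (continuous_mul_schrodinger hyc hq hφ).integrable_of_hasCompactSupport s1
  have i2 : Integrable fun x => r x * φ x :=
    (continuous_mul_testFn hr hφ).integrable_of_hasCompactSupport s2
  have s3 : HasCompactSupport fun x => y' x * φ x := hφ.2.1.mul_left
  have s4 : HasCompactSupport fun x => y x * deriv φ x := hφ.2.1.deriv.mul_left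
  have i3 : Integrable fun t => y' t * φ t - y t * deriv φ t :=
    ((continuous_mul_testFn hyc' hφ).integrable_of_hasCompactSupport s3).sub
      ((continuous_mul_testFn hyc (deriv_mem_testFn hφ)).integrable_of_hasCompactSupport s4)
  have h0 := integral_eq_zero_of_hasDerivAt_of_integrable (hasDerivAt_wronskian_testFn hφ hy hy')
    (i1.sub i2) i3
  rw [integral_sub i1 i2, sub_eq_zero] at h0
  rw [setIntegral_eq_integral_of_forall_compl_eq_zero,
    setIntegral_eq_integral_of_forall_compl_eq_zero, h0]
  · intro x hx
    rw [testFn_eq_zero hφ hx, mul_zero]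
  · intro x hx
    rw [schrodinger_eq_zero fun h => hx (hφ.2.2 h), mul_zero]

/-- Bootstrapping: the equation expresses y'' through y, so y and y' gain one derivative together.
-/
theorem contDiffOn_of_ode (hq : ContDiffOn ℝ ∞ q (Ioi 0)) (hr : ContDiffOn ℝ ∞ r (Ioi 0))
    (hy : ∀ x > 0, HasDerivAt y (y' x) x)
    (hy' : ∀ x > 0, HasDerivAt y' ((q x : ℂ) * y x - r x) x) : ContDiffOn ℝ ∞ y (Ioi 0) := by
  have step : ∀ {f f' : ℝ → ℂ} {n : ℕ}, (∀ x > 0, HasDerivAt f (f' x) x) →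
      ContDiffOn ℝ n f' (Ioi 0) → ContDiffOn ℝ (n + 1 : ℕ) f (Ioi 0) := by
    intro f f' n hf hf'
    rw [Nat.cast_succ, contDiffOn_succ_iff_deriv_of_isOpen isOpen_Ioi]
    refine ⟨fun x hx => (hf x hx).differentiableAt.differentiableWithinAt, by simp, ?_⟩
    exact hf'.congr fun x hx => (hf x hx).deriv
  have main : ∀ n : ℕ, ContDiffOn ℝ n y (Ioi 0) ∧ ContDiffOn ℝ n y' (Ioi 0) := by
    intro n
    induction n with
    | zero => exact ⟨contDiffOn_zero.mpr (continuousOn_of_hasDerivAt hy),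
        contDiffOn_zero.mpr (continuousOn_of_hasDerivAt hy')⟩
    | succ n ih =>
      refine ⟨step hy ih.2, step hy' ?_⟩
      have hq' : ContDiffOn ℝ n (fun x => (q x : ℂ)) (Ioi 0) :=
        Complex.ofRealCLM.contDiff.comp_contDiffOn (hq.of_le (by exact_mod_cast le_top))
      exact (hq'.mul ih.1).sub (hr.of_le (by exact_mod_cast le_top))
  exact contDiffOn_infty.mpr fun n => (main n).1

theorem contDiff_of_contDiffOn_of_eq_zero {f : ℝ → ℂ} {δ : ℝ} (hδ : 0 < δ)
    (hf : ContDiffOn ℝ ∞ f (Ioi 0)) (h0 : ∀ x < δ, f x = 0) : ContDiff ℝ ∞ f := by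
  rw [contDiff_iff_contDiffAt]
  intro x
  rcases lt_or_ge x δ with h | h
  · refine (contDiffAt_const (c := (0 : ℂ))).congr_of_eventuallyEq ?_
    filter_upwards [Iio_mem_nhds h] with t ht
    exact h0 t ht
  · exact hf.contDiffAt (Ioi_mem_nhds (hδ.trans_le h))

/-! ### Functions as functionals on test functions -/

theorem integrable_mul_testFn {U : Set ℝ} {f : ℝ → ℂ} (hf : LocallyIntegrableOn f U volume)
    (hφ : φ ∈ testFn U) : Integrable (fun x => φ x * f x) := by
  have h1 : IntegrableOn f (tsupport φ) :=
    hf.integrableOn_compact_subset hφ.2.2 hφ.2.1.isCompact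
  have h2 := h1.continuousOn_mul hφ.1.continuous.continuousOn hφ.2.1.isCompact
  refine (integrableOn_iff_integrable_of_support_subset ?_).mp h2
  exact fun x hx => subset_tsupport φ fun h => hx (by simp [h])

/-- Integration against `f`, as a functional on the test functions. -/
def testFunctional {U : Set ℝ} (f : ℝ → ℂ) (hf : LocallyIntegrableOn f U volume) :
    testFn U →ₗ[ℂ] ℂ where
  toFun φ := ∫ x in U, φ.1 x * f x
  map_add' φ ψ := by
    rw [← integral_add (integrable_mul_testFn hf φ.2).restrict
      (integrable_mul_testFn hf ψ.2).restrict]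
    exact integral_congr_ae (Eventually.of_forall fun x => add_mul _ _ _)
  map_smul' c φ := by
    rw [RingHom.id_apply, smul_eq_mul, ← integral_const_mul]
    exact integral_congr_ae (Eventually.of_forall fun x => mul_assoc _ _ _)

/-- A linear functional vanishing on the common kernel of two others is a combination of them.
Applied to integration functionals, this identifies weak solutions of the differential equation
without any regularity theory. -/
theorem exists_lin_comb_of_ker {U : Set ℝ} (hU : IsOpen U) {f g h : ℝ → ℂ}
    (hf : LocallyIntegrableOn f U volume) (hg : LocallyIntegrableOn g U volume)
    (hh : LocallyIntegrableOn h U volume)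
    (H : ∀ η ∈ testFn U, ∫ x in U, η x * f x = 0 → ∫ x in U, η x * g x = 0 →
      ∫ x in U, η x * h x = 0) :
    ∃ c d : ℂ, h =ᵐ[volume.restrict U] fun x => c * f x + d * g x := by
  have hmem : testFunctional h hh ∈
      Submodule.span ℂ (range ![testFunctional f hf, testFunctional g hg]) := by
    refine mem_span_of_iInf_ker_le_ker fun η hη => ?_
    simp only [Submodule.mem_iInf, Fin.forall_fin_two, LinearMap.mem_ker] at hη
    exact H η.1 η.2 hη.1 hη.2
  rw [Matrix.range_cons, Matrix.range_cons, Matrix.range_empty, union_empty,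
    singleton_union, Submodule.mem_span_pair] at hmem
  obtain ⟨c, d, hcd⟩ := hmem
  refine ⟨c, d, ?_⟩
  have hloc : LocallyIntegrableOn (fun x => h x - (c * f x + d * g x)) U volume :=
    hh.sub (LocallyIntegrableOn.add (fun x hx => (hf x hx).smul c) fun x hx => (hg x hx).smul d)
  have h0 := ae_eq_zero_of_forall_testFn hU hloc fun φ hφ => by
    have e1 : (testFunctional h hh) ⟨φ, hφ⟩ = _ := (LinearMap.congr_fun hcd ⟨φ, hφ⟩).symm
    simp only [testFunctional, LinearMap.add_apply, LinearMap.smul_apply, LinearMap.coe_mk,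
      AddHom.coe_mk, smul_eq_mul] at e1
    have i1 := (integrable_mul_testFn hf hφ).restrict (s := U)
    have i2 := (integrable_mul_testFn hg hφ).restrict (s := U)
    have i3 := (integrable_mul_testFn hh hφ).restrict (s := U)
    have e2 : ∀ x, φ x * (h x - (c * f x + d * g x)) =
        φ x * h x - (c * (φ x * f x) + d * (φ x * g x)) := fun x => by ring
    simp_rw [e2]
    have i4 : Integrable (fun x => c * (φ x * f x) + d * (φ x * g x)) (volume.restrict U) :=
      (i1.const_mul c).add (i2.const_mul d)
    rw [integral_sub i3 i4, integral_add (i1.const_mul c) (i2.const_mul d), integral_const_mul,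
      integral_const_mul, e1, sub_self]
  filter_upwards [h0] with x hx
  exact sub_eq_zero.mp hx

theorem norm_setIntegral_mul_sq_le {S : Set ℝ} {f h : ℝ → ℂ} (hf : MemLp f 2 (volume.restrict S))
    (hh : MemLp h 2 (volume.restrict S)) :
    ‖∫ x in S, f x * h x‖ ^ 2 ≤ (∫ x in S, ‖f x‖ ^ 2) * ∫ x in S, ‖h x‖ ^ 2 := by
  have hf' : MemLp (fun x => conj (f x)) 2 (volume.restrict S) := hf.star
  have h1 := norm_inner_le_norm (𝕜 := ℂ) (hf'.toLp _) (hh.toLp _)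
  rw [inner_toLp] at h1
  simp only [Complex.conj_conj] at h1
  have h2 := pow_le_pow_left₀ (norm_nonneg _) h1 2
  rw [mul_pow, norm_sq_toLp, norm_sq_toLp] at h2
  simpa using h2

theorem exists_bound_of_tendsto {f : ℝ → ℝ} {l : ℝ} (hf : ContinuousOn f (Ioi 0))
    (hl : Tendsto f (𝓝[>] 0) (𝓝 l)) (R : ℝ) : ∃ C > 0, ∀ x ∈ Ioc 0 R, |f x| ≤ C := by
  have h1 : ∀ᶠ x in 𝓝[>] (0 : ℝ), |f x| < |l| + 1 :=
    hl.abs.eventually_lt_const (lt_add_one _)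
  obtain ⟨δ, hδ, hδ'⟩ := mem_nhdsGT_iff_exists_Ioo_subset.mp h1
  obtain ⟨C, hC⟩ := isCompact_Icc.exists_bound_of_continuousOn
    (hf.mono fun x (hx : x ∈ Icc δ R) => lt_of_lt_of_le hδ hx.1)
  refine ⟨max C (|l| + 1), lt_max_of_lt_right (by positivity), fun x hx => ?_⟩
  rcases lt_or_ge x δ with h | h
  · exact le_max_of_le_right (hδ' ⟨hx.1, h⟩).le
  · exact le_max_of_le_left (hC x ⟨h, hx.2⟩)

end HalfLineODE

/-! ### A principal and a recessive solution on the half-line -/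

/-- A decaying solution `Φ` and a growing solution `F` of `y'' = q y` on `(0,∞)`, together with
their asymptotics at the origin. -/
structure SolPair (α : ℝ) (q Φ Φ' F F' : ℝ → ℝ) (a b κ : ℝ) : Prop where
  hα0 : 0 ≤ α
  hα1 : α < 1
  q_smooth : ContDiffOn ℝ ∞ q (Ioi 0)
  dPhi : ∀ x > 0, HasDerivAt Φ (Φ' x) x
  dPhi' : ∀ x > 0, HasDerivAt Φ' (q x * Φ x) x
  dF : ∀ x > 0, HasDerivAt F (F' x) x
  dF' : ∀ x > 0, HasDerivAt F' (q x * F x) x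
  Phi_pos : ∀ x > 0, 0 < Φ x
  F_pos : ∀ x > 0, 0 < F x
  F'_nonneg : ∀ x > 0, 0 ≤ F' x
  decay : ∀ x ≥ 1, Φ' x ≤ -(1 / 2) * Φ x
  a_pos : 0 < a
  b_pos : 0 < b
  lim_Phi : Tendsto (fun x => x ^ (α / 2) * Φ x) (𝓝[>] 0) (𝓝 a)
  lim_Phi' : Tendsto (fun x => x ^ (-(1 + α / 2)) * (Φ x - a * x ^ (-(α / 2)))) (𝓝[>] 0)
    (𝓝 (-(κ * a)))
  lim_F : Tendsto (fun x => x ^ (-(1 + α / 2)) * F x) (𝓝[>] 0) (𝓝 b)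

namespace SolPair

variable {α : ℝ} {q Φ Φ' F F' : ℝ → ℝ} {a b κ : ℝ}

theorem tendsto_rpow_zero {p : ℝ} (hp : 0 < p) :
    Tendsto (fun x : ℝ => x ^ p) (𝓝[>] 0) (𝓝 0) := by
  have h := (Real.continuousAt_rpow_const 0 p (Or.inr hp.le)).tendsto
  rw [Real.zero_rpow hp.ne'] at h
  exact h.mono_left nhdsWithin_le_nhds

/-- The Wronskian w is constant. No asymptotics of the derivatives are assumed, so its value is
found from (F/Φ)' = w/Φ²: the quotient of F/Φ by t^(1+α) tends to b/a directly, and to w/((1+α)a²)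
by l'Hôpital. -/
theorem wronskian_eq (S : SolPair α q Φ Φ' F F' a b κ) {x : ℝ} (hx : 0 < x) :
    Φ x * F' x - Φ' x * F x = a * b * (1 + α) := by
  have hα0 := S.hα0
  have hd : ∀ t > 0, HasDerivAt (fun t => Φ t * F' t - Φ' t * F t) 0 t := fun t ht => by
    refine (((S.dPhi t ht).mul (S.dF' t ht)).sub ((S.dPhi' t ht).mul (S.dF t ht))).congr_deriv ?_
    ring
  set w := Φ x * F' x - Φ' x * F x with hw
  have hconst : ∀ t > 0, Φ t * F' t - Φ' t * F t = w := fun t ht =>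
    isOpen_Ioi.is_const_of_deriv_eq_zero isPreconnected_Ioi
      (fun s hs => (hd s hs).differentiableAt.differentiableWithinAt)
      (fun s hs => (hd s hs).deriv) ht hx
  have hrat : Tendsto (fun t => F t / Φ t / t ^ (1 + α)) (𝓝[>] 0) (𝓝 (b / a)) := by
    refine (S.lim_F.div S.lim_Phi S.a_pos.ne').congr' ?_
    filter_upwards [self_mem_nhdsWithin] with t (ht : 0 < t)
    have := (S.Phi_pos t ht).ne'
    have h1 := (Real.rpow_pos_of_pos ht (1 + α / 2)).ne'
    have h2 := (Real.rpow_pos_of_pos ht (α / 2)).ne'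
    have h3 : t ^ (1 + α) = t ^ (1 + α / 2) * t ^ (α / 2) := by
      rw [← Real.rpow_add ht]; congr 1; ring
    rw [Pi.div_apply, Real.rpow_neg ht.le, h3]
    generalize t ^ (1 + α / 2) = u at h1
    generalize t ^ (α / 2) = v at h2
    field_simp
  have hrat0 : Tendsto (fun t => F t / Φ t) (𝓝[>] 0) (𝓝 0) := by
    have := hrat.mul (tendsto_rpow_zero (p := 1 + α) (by linarith))
    rw [mul_zero] at this
    refine this.congr' ?_
    filter_upwards [self_mem_nhdsWithin] with t (ht : 0 < t)
    exact div_mul_cancel₀ _ (Real.rpow_pos_of_pos ht _).ne'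
  have hlh : Tendsto (fun t => F t / Φ t / t ^ (1 + α)) (𝓝[>] 0) (𝓝 (w / ((1 + α) * a ^ 2))) := by
    refine HasDerivAt.lhopital_zero_nhdsGT (f' := fun t => w / Φ t ^ 2)
      (g' := fun t => (1 + α) * t ^ α) ?_ ?_ ?_ hrat0 (tendsto_rpow_zero (by linarith)) ?_
    · filter_upwards [self_mem_nhdsWithin] with t (ht : 0 < t)
      refine ((S.dF t ht).div (S.dPhi t ht) (S.Phi_pos t ht).ne').congr_deriv ?_
      rw [← hconst t ht]
      ring
    · filter_upwards [self_mem_nhdsWithin] with t (ht : 0 < t)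
      refine (Real.hasDerivAt_rpow_const (p := 1 + α) (Or.inl ht.ne')).congr_deriv ?_
      rw [add_sub_cancel_left]
    · filter_upwards [self_mem_nhdsWithin] with t (ht : 0 < t)
      have := Real.rpow_pos_of_pos ht α
      positivity
    · have hne : (1 + α) * a ^ 2 ≠ 0 := by have := S.a_pos; positivity
      refine ((tendsto_const_nhds (x := w)).div
        ((S.lim_Phi.pow 2).const_mul (1 + α)) hne).congr' ?_
      filter_upwards [self_mem_nhdsWithin] with t (ht : 0 < t)
      have : t ^ α = (t ^ (α / 2)) ^ 2 := by
        rw [← Real.rpow_natCast, ← Real.rpow_mul ht.le]; congr 1; push_cast; ring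
      simp only [this, Pi.div_apply]
      rw [mul_pow, div_div]
      congr 1
      ring
  have := tendsto_nhds_unique hlh hrat
  have ha := S.a_pos.ne'
  rw [div_eq_div_iff (by positivity) ha] at this
  have h2 : a * (w - a * b * (1 + α)) = 0 := by linear_combination this
  exact sub_eq_zero.mp ((mul_eq_zero.mp h2).resolve_left ha)

theorem wr_pos (S : SolPair α q Φ Φ' F F' a b κ) : 0 < a * b * (1 + α) := by
  have := S.a_pos
  have := S.b_pos
  have := S.hα0
  positivity

theorem Phi_cont (S : SolPair α q Φ Φ' F F' a b κ) : ContinuousOn Φ (Ioi 0) :=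
  fun x hx => (S.dPhi x hx).continuousAt.continuousWithinAt

theorem F_cont (S : SolPair α q Φ Φ' F F' a b κ) : ContinuousOn F (Ioi 0) :=
  fun x hx => (S.dF x hx).continuousAt.continuousWithinAt

theorem exists_Phi_bound (S : SolPair α q Φ Φ' F F' a b κ) (R : ℝ) :
    ∃ C > 0, ∀ x ∈ Ioc 0 R, Φ x ≤ C * x ^ (-(α / 2)) := by
  have hc : ContinuousOn (fun x => x ^ (α / 2) * Φ x) (Ioi 0) :=
    (continuousOn_id.rpow_const fun x (hx : 0 < x) => Or.inl hx.ne').mul S.Phi_cont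
  obtain ⟨C, hC, h⟩ := exists_bound_of_tendsto hc S.lim_Phi R
  refine ⟨C, hC, fun x hx => ?_⟩
  have h1 := (le_abs_self _).trans (h x hx)
  rw [Real.rpow_neg hx.1.le, ← div_eq_mul_inv, le_div_iff₀ (Real.rpow_pos_of_pos hx.1 _), mul_comm]
  exact h1

theorem exists_F_bound (S : SolPair α q Φ Φ' F F' a b κ) (R : ℝ) :
    ∃ C > 0, ∀ x ∈ Ioc 0 R, F x ≤ C * x ^ (1 + α / 2) := by
  have hc : ContinuousOn (fun x => x ^ (-(1 + α / 2)) * F x) (Ioi 0) :=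
    (continuousOn_id.rpow_const fun x (hx : 0 < x) => Or.inl hx.ne').mul S.F_cont
  obtain ⟨C, hC, h⟩ := exists_bound_of_tendsto hc S.lim_F R
  refine ⟨C, hC, fun x hx => ?_⟩
  have h1 := (le_abs_self _).trans (h x hx)
  rwa [Real.rpow_neg hx.1.le, ← div_eq_inv_mul, div_le_iff₀ (Real.rpow_pos_of_pos hx.1 _)] at h1

/-- Φ² is bounded by a multiple of x^(-α), which is integrable at the origin because α < 1. -/
theorem memLp_Phi_Ioc (S : SolPair α q Φ Φ' F F' a b κ) (R : ℝ) :
    MemLp Φ 2 (volume.restrict (Ioc 0 R)) := by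
  obtain ⟨C, hC, h⟩ := S.exists_Phi_bound R
  have hα1 := S.hα1
  have hm : AEStronglyMeasurable Φ (volume.restrict (Ioc 0 R)) :=
    (S.Phi_cont.mono Ioc_subset_Ioi_self).aestronglyMeasurable measurableSet_Ioc
  rw [memLp_two_iff_integrable_sq hm]
  have hi : IntegrableOn (fun x : ℝ => C ^ 2 * x ^ (-α)) (Ioc 0 R) := by
    rcases le_total R 0 with hR | hR
    · rw [Ioc_eq_empty hR.not_gt]; exact integrableOn_empty
    · have := intervalIntegral.intervalIntegrable_rpow' (a := 0) (b := R) (r := -α) (by linarith)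
      exact ((intervalIntegrable_iff_integrableOn_Ioc_of_le hR).mp this).const_mul _
  refine hi.mono' (hm.pow 2) ?_
  refine (ae_restrict_iff' measurableSet_Ioc).mpr (Eventually.of_forall fun x hx => ?_)
  rw [Real.norm_of_nonneg (by positivity)]
  have h1 := pow_le_pow_left₀ (S.Phi_pos x hx.1).le (h x hx) 2
  have h2 : (x ^ (-(α / 2))) ^ 2 = x ^ (-α) := by
    rw [← Real.rpow_natCast, ← Real.rpow_mul hx.1.le]; congr 1; push_cast; ring
  rwa [mul_pow, h2] at h1

/-- The rate matters, not only finiteness: together with the rate x^(3+α) for F² it makes both terms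
of the variation-of-constants formula O(x^(3/2)). -/
theorem setIntegral_Phi_sq_le (S : SolPair α q Φ Φ' F F' a b κ) :
    ∃ C > 0, ∀ x ∈ Ioc (0 : ℝ) 1, ∫ y in Ioc 0 x, Φ y ^ 2 ≤ C * x ^ (1 - α) := by
  obtain ⟨C, hC, h⟩ := S.exists_Phi_bound 1
  have hα1 := S.hα1
  refine ⟨C ^ 2 / (1 - α), div_pos (by positivity) (by linarith), fun x hx => ?_⟩
  have hi : IntegrableOn (fun y : ℝ => y ^ (-α)) (Ioc 0 x) :=
    (intervalIntegrable_iff_integrableOn_Ioc_of_le hx.1.le).mp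
      (intervalIntegral.intervalIntegrable_rpow' (by linarith))
  have h1 : ∫ y in Ioc 0 x, Φ y ^ 2 ≤ ∫ y in Ioc 0 x, C ^ 2 * y ^ (-α) := by
    refine setIntegral_mono_on ((memLp_two_iff_integrable_sq
      (S.memLp_Phi_Ioc x).1).mp (S.memLp_Phi_Ioc x)) (hi.const_mul _) measurableSet_Ioc
      fun y hy => ?_
    have h1 := pow_le_pow_left₀ (S.Phi_pos y hy.1).le (h y ⟨hy.1, hy.2.trans hx.2⟩) 2
    have h2 : (y ^ (-(α / 2))) ^ 2 = y ^ (-α) := by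
      rw [← Real.rpow_natCast, ← Real.rpow_mul hy.1.le]; congr 1; push_cast; ring
    rwa [mul_pow, h2] at h1
  refine h1.trans_eq ?_
  rw [integral_const_mul, ← intervalIntegral.integral_of_le hx.1.le,
    integral_rpow (Or.inl (by linarith)), Real.zero_rpow (by linarith)]
  rw [show -α + 1 = 1 - α by ring]
  ring

theorem memLp_F_Ioc (S : SolPair α q Φ Φ' F F' a b κ) (R : ℝ) :
    MemLp F 2 (volume.restrict (Ioc 0 R)) := by
  obtain ⟨C, hC, h⟩ := S.exists_F_bound R
  have hα0 := S.hα0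
  refine MemLp.of_bound ((S.F_cont.mono Ioc_subset_Ioi_self).aestronglyMeasurable
    measurableSet_Ioc) (C * R ^ (1 + α / 2)) ?_
  refine (ae_restrict_iff' measurableSet_Ioc).mpr (Eventually.of_forall fun x hx => ?_)
  rw [Real.norm_of_nonneg (S.F_pos x hx.1).le]
  exact (h x hx).trans (mul_le_mul_of_nonneg_left
    (Real.rpow_le_rpow hx.1.le hx.2 (by positivity)) hC.le)

theorem setIntegral_F_sq_le (S : SolPair α q Φ Φ' F F' a b κ) :
    ∃ C > 0, ∀ x ∈ Ioc (0 : ℝ) 1, ∫ y in Ioc 0 x, F y ^ 2 ≤ C * x ^ (3 + α) := by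
  obtain ⟨C, hC, h⟩ := S.exists_F_bound 1
  have hα0 := S.hα0
  refine ⟨C ^ 2, by positivity, fun x hx => ?_⟩
  have h1 : ∫ y in Ioc 0 x, F y ^ 2 ≤ ∫ y in Ioc 0 x, C ^ 2 * x ^ (2 + α) := by
    refine setIntegral_mono_on ((memLp_two_iff_integrable_sq
      (S.memLp_F_Ioc x).1).mp (S.memLp_F_Ioc x)) (integrableOn_const measure_Ioc_lt_top.ne)
      measurableSet_Ioc fun y hy => ?_
    have h1 := pow_le_pow_left₀ (S.F_pos y hy.1).le ((h y ⟨hy.1, hy.2.trans hx.2⟩).trans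
      (mul_le_mul_of_nonneg_left (Real.rpow_le_rpow hy.1.le hy.2 (by positivity)) hC.le)) 2
    have h2 : (x ^ (1 + α / 2)) ^ 2 = x ^ (2 + α) := by
      rw [← Real.rpow_natCast, ← Real.rpow_mul hx.1.le]; congr 1; push_cast; ring
    rwa [mul_pow, h2] at h1
  refine h1.trans_eq ?_
  rw [setIntegral_const, Measure.real, Real.volume_Ioc, sub_zero, ENNReal.toReal_ofReal hx.1.le,
    smul_eq_mul, show 3 + α = 1 + (2 + α) by ring, Real.rpow_add hx.1 1, Real.rpow_one]
  ring

/-! The decaying solution is square-integrable. -/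

/-- The condition `decay` says that Φ(t) e^(t/2) is nonincreasing on [1, ∞). -/
theorem Phi_le_exp (S : SolPair α q Φ Φ' F F' a b κ) {x y : ℝ} (hx : 1 ≤ x) (hxy : x ≤ y) :
    Φ y ≤ Φ x * Real.exp (-(y - x) / 2) := by
  have hanti : AntitoneOn (fun t => Φ t * Real.exp (t / 2)) (Ici 1) := by
    refine antitoneOn_of_hasDerivWithinAt_nonpos (convex_Ici 1)
      (f' := fun t => Φ' t * Real.exp (t / 2) + Φ t * (Real.exp (t / 2) * (1 / 2))) ?_ ?_ ?_
    · exact (S.Phi_cont.mono fun t (ht : 1 ≤ t) => zero_lt_one.trans_le ht).mul (by fun_prop)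
    · intro t ht
      rw [interior_Ici] at ht
      have ht0 : (0 : ℝ) < t := zero_lt_one.trans ht
      exact ((S.dPhi t ht0).mul ((hasDerivAt_id t).div_const 2).exp).hasDerivWithinAt
    · intro t ht
      rw [interior_Ici] at ht
      have := S.decay t (le_of_lt ht)
      have h2 := Real.exp_pos (t / 2)
      nlinarith
  have h := hanti (mem_Ici.mpr hx) (mem_Ici.mpr (hx.trans hxy)) hxy
  simp only at h
  have e : Φ x * Real.exp (-(y - x) / 2) = Φ x * Real.exp (x / 2) * Real.exp (-(y / 2)) := by
    rw [mul_assoc, ← Real.exp_add]; congr 2; ring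
  rw [e]
  calc Φ y = Φ y * Real.exp (y / 2) * Real.exp (-(y / 2)) := by
        rw [mul_assoc, ← Real.exp_add, add_neg_cancel, Real.exp_zero, mul_one]
    _ ≤ _ := mul_le_mul_of_nonneg_right h (Real.exp_pos _).le

theorem memLp_two_of_Ioc_of_Ioi {f : ℝ → ℝ} (h1 : MemLp f 2 (volume.restrict (Ioc 0 1)))
    (h2 : MemLp f 2 (volume.restrict (Ioi 1))) : MemLp f 2 (volume.restrict (Ioi 0)) := by
  have hm : AEStronglyMeasurable f (volume.restrict (Ioi 0)) := by
    rw [← Ioc_union_Ioi_eq_Ioi zero_le_one]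
    exact aestronglyMeasurable_union_iff.mpr ⟨h1.1, h2.1⟩
  rw [memLp_two_iff_integrable_sq hm, ← Ioc_union_Ioi_eq_Ioi zero_le_one]
  exact IntegrableOn.union (show IntegrableOn _ _ volume from (memLp_two_iff_integrable_sq h1.1).mp h1)
    ((memLp_two_iff_integrable_sq h2.1).mp h2)

/-- The weight x + 1 is there for Ψ, which at infinity is only controlled by (x + 1)Φ. -/
theorem memLp_linear_mul_Phi_Ioi (S : SolPair α q Φ Φ' F F' a b κ) :
    MemLp (fun x => (x + 1) * Φ x) 2 (volume.restrict (Ioi 1)) := by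
  have hm : AEStronglyMeasurable (fun x => (x + 1) * Φ x) (volume.restrict (Ioi 1)) :=
    (((continuous_id.add continuous_const).continuousOn).mul
      (S.Phi_cont.mono fun t (ht : 1 < t) => zero_lt_one.trans ht)).aestronglyMeasurable
      measurableSet_Ioi
  rw [memLp_two_iff_integrable_sq hm]
  have hi : IntegrableOn (fun x : ℝ => (8 * Φ 1) ^ 2 * Real.exp 1 * Real.exp (-(1 / 2) * x))
      (Ioi 1) := (integrableOn_exp_mul_Ioi (by norm_num) 1).const_mul _
  refine hi.mono' (hm.pow 2) ?_
  refine (ae_restrict_iff' measurableSet_Ioi).mpr (Eventually.of_forall fun x (hx : 1 < x) => ?_)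
  rw [Real.norm_of_nonneg (by positivity)]
  have h1 := S.Phi_le_exp le_rfl hx.le
  -- The rate 1/4 spends half of the decay e^(-x/2) of Φ and leaves an integrable square.
  have h2 : x + 1 ≤ 8 * Real.exp (x / 4) := by
    have := Real.add_one_le_exp (x / 4)
    linarith
  have h3 : (x + 1) * Φ x ≤ 8 * Real.exp (x / 4) * (Φ 1 * Real.exp (-(x - 1) / 2)) :=
    mul_le_mul h2 h1 (S.Phi_pos x (by linarith)).le (by positivity)
  refine (pow_le_pow_left₀ (mul_nonneg (by linarith) (S.Phi_pos x (by linarith)).le) h3 2).trans_eq ?_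
  have e : (Real.exp (x / 4) * Real.exp (-(x - 1) / 2)) ^ 2 =
      Real.exp 1 * Real.exp (-(1 / 2) * x) := by
    rw [← Real.exp_add, ← Real.exp_add, ← Real.exp_nat_mul]
    congr 1
    push_cast
    ring
  calc _ = (8 * Φ 1) ^ 2 * (Real.exp (x / 4) * Real.exp (-(x - 1) / 2)) ^ 2 := by ring
    _ = _ := by rw [e]; ring

theorem memLp_Phi (S : SolPair α q Φ Φ' F F' a b κ) : MemLp Φ 2 (volume.restrict (Ioi 0)) := by
  refine memLp_two_of_Ioc_of_Ioi (S.memLp_Phi_Ioc 1) ?_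
  refine S.memLp_linear_mul_Phi_Ioi.mono' ((S.Phi_cont.mono fun t (ht : 1 < t) =>
    zero_lt_one.trans ht).aestronglyMeasurable measurableSet_Ioi) ?_
  refine (ae_restrict_iff' measurableSet_Ioi).mpr (Eventually.of_forall fun x (hx : 1 < x) => ?_)
  have := S.Phi_pos x (by linarith)
  rw [Real.norm_of_nonneg this.le]
  nlinarith

theorem integrable_Phi_sq (S : SolPair α q Φ Φ' F F' a b κ) :
    IntegrableOn (fun x => Φ x ^ 2) (Ioi 0) :=
  (memLp_two_iff_integrable_sq S.memLp_Phi.1).mp S.memLp_Phi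

/-- `F Φ` is bounded. -/
theorem exists_FPhi_bound (S : SolPair α q Φ Φ' F F' a b κ) :
    ∃ C > 0, ∀ x > 0, F x * Φ x ≤ C := by
  have hlim : Tendsto (fun x => F x * Φ x) (𝓝[>] 0) (𝓝 (b * a * 0)) := by
    refine ((S.lim_F.mul S.lim_Phi).mul (tendsto_rpow_zero one_pos)).congr' ?_
    filter_upwards [self_mem_nhdsWithin] with t (ht : 0 < t)
    rw [Real.rpow_neg ht.le, Real.rpow_add ht, Real.rpow_one]
    have h2 := (Real.rpow_pos_of_pos ht (α / 2)).ne'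
    field_simp
  obtain ⟨C, hC, h⟩ := exists_bound_of_tendsto (S.F_cont.mul S.Phi_cont) hlim 1
  refine ⟨max C (2 * (a * b * (1 + α))), lt_max_of_lt_left hC, fun x hx => ?_⟩
  rcases le_total x 1 with h1 | h1
  · exact ((le_abs_self _).trans (h x ⟨hx, h1⟩)).trans (le_max_left _ _)
  -- For x ≥ 1 the Wronskian ΦF' - Φ'F is at least -Φ'F, which is at least FΦ/2.
  · refine le_trans ?_ (le_max_right _ _)
    have h2 := S.wronskian_eq hx
    have h3 := S.decay x h1
    have h4 := mul_nonneg (S.Phi_pos x hx).le (S.F'_nonneg x hx)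
    have h5 := S.F_pos x hx
    nlinarith

theorem F_mono (S : SolPair α q Φ Φ' F F' a b κ) : MonotoneOn F (Ioi 0) :=
  monotoneOn_of_hasDerivWithinAt_nonneg (convex_Ioi 0) S.F_cont
    (fun x hx => (S.dF x (by simpa using hx)).hasDerivWithinAt)
    fun x hx => S.F'_nonneg x (by simpa using hx)

end SolPair

/-! ### Boundary values of functions -/

/-- The function version of `HasLimits`. -/
def FunLimits (α : ℝ) (U : Set ℝ) (f : ℝ → ℂ) (g₀ g₁ : ℂ) : Prop :=
  ContinuousOn f U ∧
    Tendsto (fun x : ℝ => ((|x| ^ (α / 2) : ℝ) : ℂ) * f x) (𝓝[U] 0) (𝓝 g₀) ∧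
    Tendsto (fun x : ℝ => ((|x| ^ (-(1 + α / 2)) : ℝ) : ℂ) *
      (f x - g₀ * ((|x| ^ (-(α / 2)) : ℝ) : ℂ))) (𝓝[U] 0) (𝓝 g₁)

theorem FunLimits.hasLimits {α : ℝ} {U : Set ℝ} {f : ℝ → ℂ} {g₀ g₁ : ℂ} (h : FunLimits α U f g₀ g₁)
    {g : L2 U} (hg : g =ᵐ[volume.restrict U] f) : HasLimits α g g₀ g₁ :=
  ⟨f, h.1, hg, h.2.1, h.2.2⟩

theorem FunLimits.add {α : ℝ} {U : Set ℝ} {f f' : ℝ → ℂ} {g₀ g₁ h₀ h₁ : ℂ}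
    (h : FunLimits α U f g₀ g₁) (h' : FunLimits α U f' h₀ h₁) :
    FunLimits α U (fun x => f x + f' x) (g₀ + h₀) (g₁ + h₁) := by
  refine ⟨h.1.add h'.1, (h.2.1.add h'.2.1).congr fun x => ?_, (h.2.2.add h'.2.2).congr fun x => ?_⟩
  · ring
  · ring

theorem FunLimits.const_mul {α : ℝ} {U : Set ℝ} {f : ℝ → ℂ} {g₀ g₁ : ℂ} (c : ℂ)
    (h : FunLimits α U f g₀ g₁) : FunLimits α U (fun x => c * f x) (c * g₀) (c * g₁) := by
  refine ⟨continuousOn_const.mul h.1, (h.2.1.const_mul c).congr fun x => ?_,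
    (h.2.2.const_mul c).congr fun x => ?_⟩
  · ring
  · ring

/-- The exponent 3/2 exceeds 1 + α/2 exactly because α < 1, so both weighted limits vanish. -/
theorem funLimits_of_le {α : ℝ} (hα0 : 0 ≤ α) (hα1 : α < 1) {f : ℝ → ℂ} (hf : ContinuousOn f (Ioi 0))
    {C : ℝ} (hC : ∀ x ∈ Ioc (0 : ℝ) 1, ‖f x‖ ≤ C * x ^ (3 / 2 : ℝ)) :
    FunLimits α (Ioi 0) f 0 0 := by
  have key : ∀ p : ℝ, -(3 / 2) < p →
      Tendsto (fun x : ℝ => ((|x| ^ p : ℝ) : ℂ) * f x) (𝓝[>] 0) (𝓝 0) := by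
    intro p hp
    have h1 : Tendsto (fun x : ℝ => C * x ^ (p + 3 / 2)) (𝓝[>] 0) (𝓝 0) := by
      simpa using (SolPair.tendsto_rpow_zero (p := p + 3 / 2) (by linarith)).const_mul C
    refine squeeze_zero_norm' ?_ h1
    filter_upwards [Ioc_mem_nhdsGT zero_lt_one] with x hx
    rw [norm_mul, Complex.norm_real, abs_of_pos hx.1,
      Real.norm_of_nonneg (Real.rpow_nonneg hx.1.le _), Real.rpow_add hx.1]
    have := mul_le_mul_of_nonneg_left (hC x hx) (Real.rpow_nonneg hx.1.le p)
    linarith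
  refine ⟨hf, key _ (by linarith), ?_⟩
  simpa using key (-(1 + α / 2)) (by linarith)

namespace SolPair

/-! ### Variation of constants -/

/-- The solution of `-y'' + q y = h` with vanishing boundary values at the origin. -/
def varSol (Φ F : ℝ → ℝ) (w : ℝ) (h : ℝ → ℂ) (x : ℝ) : ℂ :=
  (w : ℂ)⁻¹ * ((Φ x : ℂ) * (∫ t in (0)..x, (F t : ℂ) * h t) -
    (F x : ℂ) * ∫ t in (0)..x, (Φ t : ℂ) * h t)

variable {α : ℝ} {q Φ Φ' F F' : ℝ → ℝ} {a b κ : ℝ}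

theorem wronskian_eq' (S : SolPair α q Φ Φ' F F' a b κ) {x : ℝ} (hx : 0 < x) :
    (Φ x : ℂ) * F' x - Φ' x * F x = ((a * b * (1 + α) : ℝ) : ℂ) := by
  exact_mod_cast S.wronskian_eq hx

theorem wr_ne (S : SolPair α q Φ Φ' F F' a b κ) : ((a * b * (1 + α) : ℝ) : ℂ) ≠ 0 :=
  Complex.ofReal_ne_zero.mpr S.wr_pos.ne'

theorem q_cont (S : SolPair α q Φ Φ' F F' a b κ) : ContinuousOn q (Ioi 0) := S.q_smooth.continuousOn

theorem cPhi (S : SolPair α q Φ Φ' F F' a b κ) :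
    ∀ x > 0, HasDerivAt (fun t => (Φ t : ℂ)) (Φ' x : ℂ) x := fun x hx => (S.dPhi x hx).ofReal_comp

theorem cPhi' (S : SolPair α q Φ Φ' F F' a b κ) :
    ∀ x > 0, HasDerivAt (fun t => (Φ' t : ℂ)) ((q x : ℂ) * Φ x - 0) x := fun x hx => by
  simpa using (S.dPhi' x hx).ofReal_comp

theorem cF (S : SolPair α q Φ Φ' F F' a b κ) :
    ∀ x > 0, HasDerivAt (fun t => (F t : ℂ)) (F' x : ℂ) x := fun x hx => (S.dF x hx).ofReal_comp

theorem cF' (S : SolPair α q Φ Φ' F F' a b κ) :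
    ∀ x > 0, HasDerivAt (fun t => (F' t : ℂ)) ((q x : ℂ) * F x - 0) x := fun x hx => by
  simpa using (S.dF' x hx).ofReal_comp

theorem setIntegral_Phi_mul_schrodinger (S : SolPair α q Φ Φ' F F' a b κ) {φ : ℝ → ℂ}
    (hφ : φ ∈ testFn (Ioi 0)) : ∫ x in Ioi 0, (Φ x : ℂ) * schrodinger q φ x = 0 := by
  rw [setIntegral_mul_schrodinger (r := fun _ => 0) S.q_cont continuousOn_const hφ S.cPhi S.cPhi']
  simp

/-- By Lagrange's identity the integrals against Φ and F equal Φ'φ - Φφ' and F'φ - Fφ'. Inserted in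
the formula, they combine to the Wronskian times φ. -/
theorem varSol_schrodinger (S : SolPair α q Φ Φ' F F' a b κ) {φ : ℝ → ℂ} (hφ : φ ∈ testFn (Ioi 0))
    {x : ℝ} (hx : 0 < x) : varSol Φ F (a * b * (1 + α)) (schrodinger q φ) x = φ x := by
  have h1 := intervalIntegral_wronskian_testFn (r := fun _ => 0) S.q_cont continuousOn_const hφ
    S.cPhi S.cPhi' x
  have h2 := intervalIntegral_wronskian_testFn (r := fun _ => 0) S.q_cont continuousOn_const hφ
    S.cF S.cF' x
  simp only [zero_mul, sub_zero] at h1 h2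
  rw [varSol, h1, h2, ← S.wronskian_eq' hx]
  have := S.wr_ne
  rw [← S.wronskian_eq' hx] at this
  field_simp
  ring

/-- The derivative of `varSol`. -/
def varSolDeriv (Φ Φ' F F' : ℝ → ℝ) (w : ℝ) (h : ℝ → ℂ) (x : ℝ) : ℂ :=
  (w : ℂ)⁻¹ * ((Φ' x : ℂ) * (∫ t in (0)..x, (F t : ℂ) * h t) -
    (F' x : ℂ) * ∫ t in (0)..x, (Φ t : ℂ) * h t)

theorem hasDerivAt_varSol {w : ℝ} {η : ℝ → ℂ} {x : ℝ}
    (dΦ : HasDerivAt (fun t => (Φ t : ℂ)) (Φ' x : ℂ) x)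
    (dF : HasDerivAt (fun t => (F t : ℂ)) (F' x : ℂ) x)
    (hP : HasDerivAt (fun y => ∫ t in (0)..y, (F t : ℂ) * η t) ((F x : ℂ) * η x) x)
    (hQ : HasDerivAt (fun y => ∫ t in (0)..y, (Φ t : ℂ) * η t) ((Φ x : ℂ) * η x) x) :
    HasDerivAt (varSol Φ F w η) (varSolDeriv Φ Φ' F F' w η x) x := by
  refine (((dΦ.mul hP).sub (dF.mul hQ)).const_mul (w : ℂ)⁻¹).congr_deriv ?_
  rw [varSolDeriv]
  ring

theorem hasDerivAt_varSolDeriv (S : SolPair α q Φ Φ' F F' a b κ) {η : ℝ → ℂ} {x : ℝ} (hx : 0 < x)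
    (hP : HasDerivAt (fun y => ∫ t in (0)..y, (F t : ℂ) * η t) ((F x : ℂ) * η x) x)
    (hQ : HasDerivAt (fun y => ∫ t in (0)..y, (Φ t : ℂ) * η t) ((Φ x : ℂ) * η x) x) :
    HasDerivAt (varSolDeriv Φ Φ' F F' (a * b * (1 + α)) η)
      ((q x : ℂ) * varSol Φ F (a * b * (1 + α)) η x - η x) x := by
  refine ((((S.cPhi' x hx).mul hP).sub ((S.cF' x hx).mul hQ)).const_mul
    ((a * b * (1 + α) : ℝ) : ℂ)⁻¹).congr_deriv ?_
  have hne := S.wr_ne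
  have hw := S.wronskian_eq' hx
  rw [varSol]
  generalize ((a * b * (1 + α) : ℝ) : ℂ) = w at *
  have : η x = w⁻¹ * ((Φ x : ℂ) * F' x - Φ' x * F x) * η x := by
    rw [hw, inv_mul_cancel₀ hne, one_mul]
  linear_combination this

/-- Orthogonality to Φ and F makes both primitives vanish beyond the support of η as well as before
it. The solution of Ty = η is then compactly supported in (0, ∞). -/
theorem varSol_mem_testFn (S : SolPair α q Φ Φ' F F' a b κ) {η : ℝ → ℂ} (hη : η ∈ testFn (Ioi 0))
    (hΦ : ∫ x in Ioi 0, η x * (Φ x : ℂ) = 0) (hF : ∫ x in Ioi 0, η x * (F x : ℂ) = 0) :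
    varSol Φ F (a * b * (1 + α)) η ∈ testFn (Ioi 0) ∧
      ∀ x > 0, schrodinger q (varSol Φ F (a * b * (1 + α)) η) x = η x := by
  obtain ⟨δ, hδ, M, hM, hsub⟩ := exists_tsupport_subset_Icc hη
  have hout : ∀ x ∉ Icc δ M, η x = 0 := fun x hx =>
    image_eq_zero_of_notMem_tsupport fun h => hx (hsub h)
  have prim : ∀ {f : ℝ → ℝ}, ContinuousOn f (Ioi 0) → ∫ x in Ioi 0, η x * (f x : ℂ) = 0 →
      (∀ x, HasDerivAt (fun y => ∫ t in (0)..y, (f t : ℂ) * η t) ((f x : ℂ) * η x) x) ∧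
      ∀ x ∉ Icc δ M, ∫ t in (0)..x, (f t : ℂ) * η t = 0 := by
    intro f hf h0
    have hc : Continuous fun x => (f x : ℂ) * η x :=
      continuous_mul_testFn (Complex.continuous_ofReal.comp_continuousOn hf) hη
    refine ⟨fun x => intervalIntegral.integral_hasDerivAt_right (hc.intervalIntegrable _ _)
      hc.aestronglyMeasurable.stronglyMeasurableAtFilter hc.continuousAt, fun x hx => ?_⟩
    rcases lt_or_ge x δ with h | h
    · refine (intervalIntegral.integral_congr fun t ht => ?_).trans intervalIntegral.integral_zero
      have : t ∉ Icc δ M := fun h' => by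
        rw [uIcc, mem_Icc] at ht
        have := ht.2.trans_lt (max_lt hδ h)
        linarith [h'.1]
      simp [hout t this]
    -- To the right of the support the integral up to x is already the integral over (0, ∞), which
    -- is 0 by assumption.
    · have hMx : M < x := not_le.mp fun h' => hx ⟨h, h'⟩
      rw [intervalIntegral.integral_of_le (hM.trans hMx).le,
        ← h0, ← setIntegral_eq_of_subset_of_forall_sdiff_eq_zero measurableSet_Ioi
          (show Ioc 0 x ⊆ Ioi 0 from Ioc_subset_Ioi_self)]
      · exact integral_congr_ae (Eventually.of_forall fun t => mul_comm _ _)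
      · intro t ht
        have : t ∉ Icc δ M := fun h' => ht.2 ⟨ht.1, h'.2.trans hMx.le⟩
        simp [hout t this]
  obtain ⟨dP, zP⟩ := prim S.F_cont hF
  obtain ⟨dQ, zQ⟩ := prim S.Phi_cont hΦ
  have zero_out : ∀ x ∉ Icc δ M, varSol Φ F (a * b * (1 + α)) η x = 0 := fun x hx => by
    simp [varSol, zP x hx, zQ x hx]
  have d1 : ∀ x > 0, HasDerivAt (varSol Φ F (a * b * (1 + α)) η)
      (varSolDeriv Φ Φ' F F' (a * b * (1 + α)) η x) x := fun x hx =>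
    hasDerivAt_varSol (S.cPhi x hx) (S.cF x hx) (dP x) (dQ x)
  have d2 := fun x (hx : x > 0) => S.hasDerivAt_varSolDeriv hx (dP x) (dQ x)
  refine ⟨⟨?_, HasCompactSupport.intro isCompact_Icc zero_out, ?_⟩, fun x hx => ?_⟩
  · exact contDiff_of_contDiffOn_of_eq_zero hδ
      (contDiffOn_of_ode S.q_smooth hη.1.contDiffOn d1 d2)
      fun x hx => zero_out x fun h => hx.not_ge h.1
  · refine (closure_minimal (fun x hx => ?_) isClosed_Icc).trans
      fun x (hx : x ∈ Icc δ M) => lt_of_lt_of_le hδ hx.1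
    by_contra h
    exact hx (zero_out x h)
  · have e1 : deriv (varSol Φ F (a * b * (1 + α)) η) =ᶠ[𝓝 x]
        varSolDeriv Φ Φ' F F' (a * b * (1 + α)) η := by
      filter_upwards [Ioi_mem_nhds hx] with t ht
      exact (d1 t ht).deriv
    rw [schrodinger, e1.deriv_eq, (d2 x hx).deriv]
    ring

theorem locallyIntegrableOn_ofReal {f : ℝ → ℝ} (hf : ContinuousOn f (Ioi 0)) :
    LocallyIntegrableOn (fun x => (f x : ℂ)) (Ioi 0) volume :=
  (Complex.continuous_ofReal.comp_continuousOn hf).locallyIntegrableOn measurableSet_Ioi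

/-- Square-integrable weak solutions are multiples of `Φ`. -/
theorem ae_eq_of_weak_solution (S : SolPair α q Φ Φ' F F' a b κ) {g : ℝ → ℂ}
    (hg : MemLp g 2 (volume.restrict (Ioi 0)))
    (h : ∀ φ ∈ testFn (Ioi 0), ∫ x in Ioi 0, schrodinger q φ x * g x = 0) :
    ∃ c : ℂ, g =ᵐ[volume.restrict (Ioi 0)] fun x => c * (Φ x : ℂ) := by
  obtain ⟨c, d, hcd⟩ := exists_lin_comb_of_ker isOpen_Ioi
    (locallyIntegrableOn_ofReal S.Phi_cont) (locallyIntegrableOn_ofReal S.F_cont)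
    (locallyIntegrableOn_of_memLp hg) fun η hη h1 h2 => by
      -- A test function orthogonal to Φ and F is the image of a test function, hence is annihilated
      -- by g; so g is a combination of Φ and F.
      obtain ⟨hm, he⟩ := S.varSol_mem_testFn hη h1 h2
      rw [← h _ hm]
      refine setIntegral_congr_fun measurableSet_Ioi fun x hx => ?_
      simp only [he x hx]
  refine ⟨c, ?_⟩
  suffices hd : d = 0 by simpa [hd] using hcd
  by_contra hd
  have hPhi : MemLp (fun x => (Φ x : ℂ)) 2 (volume.restrict (Ioi 0)) := S.memLp_Phi.ofReal
  have hF1 : MemLp (fun x => d * (F x : ℂ)) 2 (volume.restrict (Ioi 0)) := by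
    refine (hg.sub (hPhi.const_mul c)).ae_eq ?_
    filter_upwards [hcd] with x hx
    simp only [Pi.sub_apply, hx]
    ring
  have hF2' : IntegrableOn (fun x => ‖d * (F x : ℂ)‖ ^ 2) (Ioi 0) :=
    (memLp_two_iff_integrable_sq_norm hF1.1).mp hF1
  have hF2 := hF2'.mono_set (Ioi_subset_Ioi zero_le_one)
  have hd' : 0 < ‖d‖ := norm_pos_iff.mpr hd
  -- F is increasing and positive, so |dF|² dominates a positive constant on (1, ∞), against
  -- square-integrability.
  have hF3 : IntegrableOn (fun _ : ℝ => (‖d‖ * F 1) ^ 2) (Ioi 1) := by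
    refine hF2.mono' aestronglyMeasurable_const ?_
    refine (ae_restrict_iff' measurableSet_Ioi).mpr (Eventually.of_forall fun x (hx : 1 < x) => ?_)
    have h0 : (0 : ℝ) < x := zero_lt_one.trans hx
    have h1 := S.F_mono (mem_Ioi.mpr zero_lt_one) (mem_Ioi.mpr h0) hx.le
    have h2 := S.F_pos 1 one_pos
    rw [Real.norm_of_nonneg (by positivity), norm_mul, Complex.norm_real,
      Real.norm_of_nonneg (S.F_pos x h0).le]
    gcongr
  rw [integrableOn_const_iff (by finiteness)] at hF3
  have h2 := S.F_pos 1 one_pos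
  rcases hF3 with h0 | h0
  · have : 0 < (‖d‖ * F 1) ^ 2 := by positivity
    exact this.ne' (enorm_eq_zero.mp h0)
  · simp at h0

/-! ### Variation of constants with square-integrable right-hand side -/

theorem memLp_restrict_Ioc {h : ℝ → ℂ} (hh : MemLp h 2 (volume.restrict (Ioi 0))) (x : ℝ) :
    MemLp h 2 (volume.restrict (Ioc 0 x)) :=
  hh.mono_measure (Measure.restrict_mono Ioc_subset_Ioi_self le_rfl)

theorem integrableOn_Ioc_mul {f : ℝ → ℝ} {h : ℝ → ℂ} {x : ℝ} (hf : MemLp f 2 (volume.restrict (Ioc 0 x)))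
    (hh : MemLp h 2 (volume.restrict (Ioi 0))) : IntegrableOn (fun t => (f t : ℂ) * h t) (Ioc 0 x) :=
  MemLp.integrable_mul (p := 2) (q := 2) hf.ofReal (memLp_restrict_Ioc hh x)

theorem continuousOn_varSol (S : SolPair α q Φ Φ' F F' a b κ) {h : ℝ → ℂ}
    (hh : MemLp h 2 (volume.restrict (Ioi 0))) (w : ℝ) : ContinuousOn (varSol Φ F w h) (Ioi 0) := by
  have prim : ∀ {f : ℝ → ℝ}, (∀ R, MemLp f 2 (volume.restrict (Ioc 0 R))) →
      ContinuousOn (fun x => ∫ t in (0)..x, (f t : ℂ) * h t) (Ioi 0) := by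
    intro f hf x hx
    have hx0 : (0 : ℝ) < x := hx
    have hi : IntervalIntegrable (fun t => (f t : ℂ) * h t) volume 0 (x + 1) :=
      (intervalIntegrable_iff_integrableOn_Ioc_of_le (by linarith)).mpr
        (integrableOn_Ioc_mul (hf (x + 1)) hh)
    have hc := intervalIntegral.continuousOn_primitive_interval' hi left_mem_uIcc
    refine (hc.continuousAt ?_).continuousWithinAt
    rw [uIcc_of_le (by linarith)]
    exact Icc_mem_nhds hx0 (lt_add_one x)
  exact continuousOn_const.mul (((Complex.continuous_ofReal.comp_continuousOn S.Phi_cont).mul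
    (prim S.memLp_F_Ioc)).sub ((Complex.continuous_ofReal.comp_continuousOn S.F_cont).mul
    (prim S.memLp_Phi_Ioc)))

theorem norm_intervalIntegral_le {f : ℝ → ℝ} {h : ℝ → ℂ} {x B : ℝ} (hx : 0 < x) (hB : 0 ≤ B)
    (hf : MemLp f 2 (volume.restrict (Ioc 0 x))) (hh : MemLp h 2 (volume.restrict (Ioi 0)))
    (hfB : ∫ y in Ioc 0 x, f y ^ 2 ≤ B ^ 2) :
    ‖∫ t in (0)..x, (f t : ℂ) * h t‖ ≤ B * √(∫ t in Ioi 0, ‖h t‖ ^ 2) := by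
  have h1 := norm_setIntegral_mul_sq_le hf.ofReal (memLp_restrict_Ioc hh x)
  have h2 : ∫ t in Ioc 0 x, ‖h t‖ ^ 2 ≤ ∫ t in Ioi 0, ‖h t‖ ^ 2 :=
    setIntegral_mono_set ((memLp_two_iff_integrable_sq_norm hh.1).mp hh)
      (Eventually.of_forall fun t => by positivity) (Ioc_subset_Ioi_self).eventuallyLE
  have h3 : ∫ y in Ioc 0 x, ‖((f y : ℝ) : ℂ)‖ ^ 2 = ∫ y in Ioc 0 x, f y ^ 2 := by
    simp
  have h0 : 0 ≤ ∫ t in Ioi 0, ‖h t‖ ^ 2 := integral_nonneg fun t => by positivity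
  rw [intervalIntegral.integral_of_le hx.le]
  refine le_of_sq_le_sq ?_ (by positivity)
  rw [mul_pow, Real.sq_sqrt h0]
  refine h1.trans (mul_le_mul (h3.le.trans hfB) h2 (integral_nonneg fun t => by positivity)
    (by positivity))

/-- Cauchy–Schwarz on (0, x]. The growth of each solution multiplies the L² norm of the other:
x^(-α/2) · x^((3+α)/2) and x^(1+α/2) · x^((1-α)/2) are both x^(3/2). -/
theorem exists_varSol_bound (S : SolPair α q Φ Φ' F F' a b κ) {h : ℝ → ℂ}
    (hh : MemLp h 2 (volume.restrict (Ioi 0))) :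
    ∃ C, ∀ x ∈ Ioc (0 : ℝ) 1, ‖varSol Φ F (a * b * (1 + α)) h x‖ ≤ C * x ^ (3 / 2 : ℝ) := by
  obtain ⟨C₁, hC₁, h1⟩ := S.exists_Phi_bound 1
  obtain ⟨C₂, hC₂, h2⟩ := S.exists_F_bound 1
  obtain ⟨C₃, hC₃, h3⟩ := S.setIntegral_Phi_sq_le
  obtain ⟨C₄, hC₄, h4⟩ := S.setIntegral_F_sq_le
  set H := √(∫ t in Ioi 0, ‖h t‖ ^ 2)
  have hH : 0 ≤ H := Real.sqrt_nonneg _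
  refine ⟨(a * b * (1 + α))⁻¹ * (C₁ * (√C₄ * H) + C₂ * (√C₃ * H)), fun x hx => ?_⟩
  have hx0 := hx.1
  have e1 : ‖∫ t in (0)..x, (F t : ℂ) * h t‖ ≤ √C₄ * x ^ ((3 + α) / 2) * H := by
    refine norm_intervalIntegral_le hx0 (by positivity) (S.memLp_F_Ioc x) hh ((h4 x hx).trans_eq ?_)
    rw [mul_pow, Real.sq_sqrt hC₄.le, ← Real.rpow_natCast, ← Real.rpow_mul hx0.le]
    congr 2
    push_cast
    ring
  have e2 : ‖∫ t in (0)..x, (Φ t : ℂ) * h t‖ ≤ √C₃ * x ^ ((1 - α) / 2) * H := by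
    refine norm_intervalIntegral_le hx0 (by positivity) (S.memLp_Phi_Ioc x) hh
      ((h3 x hx).trans_eq ?_)
    rw [mul_pow, Real.sq_sqrt hC₃.le, ← Real.rpow_natCast, ← Real.rpow_mul hx0.le]
    congr 2
    push_cast
    ring
  have p1 : x ^ (-(α / 2)) * x ^ ((3 + α) / 2) = x ^ (3 / 2 : ℝ) := by
    rw [← Real.rpow_add hx0]; congr 1; ring
  have p2 : x ^ (1 + α / 2) * x ^ ((1 - α) / 2) = x ^ (3 / 2 : ℝ) := by
    rw [← Real.rpow_add hx0]; congr 1; ring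
  rw [varSol, norm_mul, norm_inv, Complex.norm_real, Real.norm_of_nonneg S.wr_pos.le,
    mul_assoc (a * b * (1 + α))⁻¹]
  refine mul_le_mul_of_nonneg_left ?_ (inv_nonneg.mpr S.wr_pos.le)
  refine (norm_sub_le _ _).trans ?_
  rw [norm_mul, norm_mul, Complex.norm_real, Complex.norm_real,
    Real.norm_of_nonneg (S.Phi_pos x hx0).le, Real.norm_of_nonneg (S.F_pos x hx0).le, add_mul]
  refine add_le_add ?_ ?_
  · refine (mul_le_mul (h1 x hx) e1 (norm_nonneg _) (by positivity)).trans_eq ?_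
    rw [← p1]; ring
  · refine (mul_le_mul (h2 x hx) e2 (norm_nonneg _) (by positivity)).trans_eq ?_
    rw [← p2]; ring

theorem funLimits_varSol (S : SolPair α q Φ Φ' F F' a b κ) {h : ℝ → ℂ}
    (hh : MemLp h 2 (volume.restrict (Ioi 0))) :
    FunLimits α (Ioi 0) (varSol Φ F (a * b * (1 + α)) h) 0 0 := by
  obtain ⟨C, hC⟩ := S.exists_varSol_bound hh
  exact funLimits_of_le S.hα0 S.hα1 (S.continuousOn_varSol hh _) hC

/-- Limits, in the graph norm, of test functions have vanishing boundary values. -/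
theorem hasLimits_of_tendsto (S : SolPair α q Φ Φ' F F' a b κ) {u v : ℕ → L2 (Ioi 0)}
    {g h : L2 (Ioi 0)} (hu : Tendsto u atTop (𝓝 g)) (hv : Tendsto v atTop (𝓝 h))
    {φ : ℕ → ℝ → ℂ} (hφ : ∀ n, φ n ∈ testFn (Ioi 0))
    (huφ : ∀ n, u n =ᵐ[volume.restrict (Ioi 0)] φ n)
    (hvφ : ∀ n, v n =ᵐ[volume.restrict (Ioi 0)] schrodinger q (φ n)) : HasLimits α g 0 0 := by
  refine (S.funLimits_varSol (Lp.memLp h)).hasLimits ?_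
  obtain ⟨ns, hns, hae⟩ := ae_tendsto_subseq hu huφ
  -- The integral over (0, x] is an inner product with f cut off at x, an element of L², and so
  -- passes to the limit.
  have prim : ∀ {f : ℝ → ℝ} (x : ℝ), 0 < x → MemLp f 2 (volume.restrict (Ioc 0 x)) →
      Tendsto (fun n => ∫ t in (0)..x, (f t : ℂ) * schrodinger q (φ n) t) atTop
        (𝓝 (∫ t in (0)..x, (f t : ℂ) * h t)) := by
    intro f x hx hf
    have hf2 : MemLp ((Ioc 0 x).indicator fun t => (f t : ℂ)) 2 (volume.restrict (Ioi 0)) := by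
      rw [memLp_indicator_iff_restrict measurableSet_Ioc, Measure.restrict_restrict measurableSet_Ioc,
        inter_eq_left.mpr Ioc_subset_Ioi_self]
      exact hf.ofReal
    have hinner : ∀ k : L2 (Ioi 0), inner ℂ (hf2.toLp _) k = ∫ t in (0)..x, (f t : ℂ) * k t := by
      intro k
      have hs : (volume.restrict (Ioi (0 : ℝ))).restrict (Ioc 0 x) = volume.restrict (Ioc 0 x) := by
        rw [Measure.restrict_restrict measurableSet_Ioc, inter_eq_left.mpr Ioc_subset_Ioi_self]
      rw [inner_eq_integral, intervalIntegral.integral_of_le hx.le, ← hs,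
        ← integral_indicator measurableSet_Ioc]
      refine integral_congr_ae ?_
      filter_upwards [hf2.coeFn_toLp] with t ht
      rw [ht]
      by_cases hm : t ∈ Ioc 0 x
      · rw [indicator_of_mem hm, indicator_of_mem hm, Complex.conj_ofReal]
      · rw [indicator_of_notMem hm, indicator_of_notMem hm, map_zero, zero_mul]
    have hl : Tendsto (fun n => inner ℂ (hf2.toLp _) (v n)) atTop (𝓝 (inner ℂ (hf2.toLp _) h)) :=
      tendsto_const_nhds.inner hv
    rw [hinner] at hl
    refine hl.congr fun n => ?_
    rw [hinner, intervalIntegral.integral_of_le hx.le, intervalIntegral.integral_of_le hx.le]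
    refine integral_congr_ae ?_
    filter_upwards [ae_restrict_of_ae_restrict_of_subset Ioc_subset_Ioi_self (hvφ n)] with t ht
    rw [ht]
  filter_upwards [hae, ae_restrict_mem measurableSet_Ioi] with x hx hx0
  -- The identity φ_n = varSol(Tφ_n) thus converges pointwise, and along a subsequence φ_n converges
  -- almost everywhere to g.
  have hlim : Tendsto (fun n => varSol Φ F (a * b * (1 + α)) (schrodinger q (φ n)) x) atTop
      (𝓝 (varSol Φ F (a * b * (1 + α)) h x)) :=
    (((prim x hx0 (S.memLp_F_Ioc x)).const_mul _).sub
      ((prim x hx0 (S.memLp_Phi_Ioc x)).const_mul _)).const_mul _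
  refine tendsto_nhds_unique hx ((hlim.comp hns.tendsto_atTop).congr fun i => ?_)
  exact S.varSol_schrodinger (hφ (ns i)) hx0

end SolPair

namespace SolPair

variable {α : ℝ} {q Φ Φ' F F' : ℝ → ℝ} {a b κ : ℝ}

/-! ### The square-integrable solution of `-y'' + q y = Φ` -/

/-- The Green operator of the pair `Φ`, `F`, applied to `Φ`. -/
def psiSol (Φ F : ℝ → ℝ) (w x : ℝ) : ℝ :=
  w⁻¹ * (Φ x * (∫ t in Ioc 0 x, F t * Φ t) + F x * ∫ t in Ioi x, Φ t ^ 2)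

theorem integrableOn_FPhi (S : SolPair α q Φ Φ' F F' a b κ) (x : ℝ) :
    IntegrableOn (fun t => F t * Φ t) (Ioc 0 x) :=
  MemLp.integrable_mul (p := 2) (q := 2) (S.memLp_F_Ioc x) (S.memLp_Phi_Ioc x)

/-- Writing the integral over (x, ∞) as the full norm minus the integral over (0, x] separates a
particular solution with zero boundary values from the multiple of F that carries those of Ψ. -/
theorem psiSol_eq (S : SolPair α q Φ Φ' F F' a b κ) (w : ℝ) {x : ℝ} (hx : 0 < x) :
    (psiSol Φ F w x : ℂ) = varSol Φ F w (fun t => (Φ t : ℂ)) x +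
      ((w⁻¹ * ∫ t in Ioi 0, Φ t ^ 2 : ℝ) : ℂ) * F x := by
  have e1 : ∫ t in Ioi 0, Φ t ^ 2 = (∫ t in Ioc 0 x, Φ t ^ 2) + ∫ t in Ioi x, Φ t ^ 2 := by
    rw [← Ioc_union_Ioi_eq_Ioi hx.le, setIntegral_union (Ioc_disjoint_Ioi le_rfl) measurableSet_Ioi
      (S.integrable_Phi_sq.mono_set Ioc_subset_Ioi_self)
      (S.integrable_Phi_sq.mono_set (Ioi_subset_Ioi hx.le))]
  have e2 : ∫ t in (0)..x, (F t : ℂ) * (Φ t : ℂ) = ((∫ t in Ioc 0 x, F t * Φ t : ℝ) : ℂ) := by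
    rw [intervalIntegral.integral_of_le hx.le, ← integral_complex_ofReal]
    simp
  have e3 : ∫ t in (0)..x, (Φ t : ℂ) * (Φ t : ℂ) = ((∫ t in Ioc 0 x, Φ t ^ 2 : ℝ) : ℂ) := by
    rw [intervalIntegral.integral_of_le hx.le, ← integral_complex_ofReal]
    simp [sq]
  rw [varSol, e2, e3, e1, psiSol]
  push_cast
  ring

theorem memLp_ofReal_Phi (S : SolPair α q Φ Φ' F F' a b κ) :
    MemLp (fun t => (Φ t : ℂ)) 2 (volume.restrict (Ioi 0)) := S.memLp_Phi.ofReal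

theorem continuousOn_psiSol (S : SolPair α q Φ Φ' F F' a b κ) (w : ℝ) :
    ContinuousOn (psiSol Φ F w) (Ioi 0) := by
  have h : ContinuousOn (fun x => ((psiSol Φ F w x : ℝ) : ℂ)) (Ioi 0) :=
    ((S.continuousOn_varSol S.memLp_ofReal_Phi w).add
      (continuousOn_const.mul (Complex.continuous_ofReal.comp_continuousOn S.F_cont))).congr
      fun x hx => S.psiSol_eq w hx
  exact Complex.continuous_re.comp_continuousOn h

theorem setIntegral_psiSol_mul_schrodinger (S : SolPair α q Φ Φ' F F' a b κ) {φ : ℝ → ℂ}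
    (hφ : φ ∈ testFn (Ioi 0)) :
    ∫ x in Ioi 0, (psiSol Φ F (a * b * (1 + α)) x : ℂ) * schrodinger q φ x =
      ∫ x in Ioi 0, (Φ x : ℂ) * φ x := by
  have prim : ∀ {f : ℝ → ℝ}, ContinuousOn f (Ioi 0) →
      (∀ R, MemLp f 2 (volume.restrict (Ioc 0 R))) → ∀ x > 0,
      HasDerivAt (fun y => ∫ t in (0)..y, (f t : ℂ) * (Φ t : ℂ)) ((f x : ℂ) * (Φ x : ℂ)) x := by
    intro f hf hf2 x hx
    have hc : ContinuousOn (fun t => (f t : ℂ) * (Φ t : ℂ)) (Ioi 0) :=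
      (Complex.continuous_ofReal.comp_continuousOn hf).mul
        (Complex.continuous_ofReal.comp_continuousOn S.Phi_cont)
    exact intervalIntegral.integral_hasDerivAt_right
      ((intervalIntegrable_iff_integrableOn_Ioc_of_le hx.le).mpr
        (integrableOn_Ioc_mul (hf2 x) S.memLp_ofReal_Phi))
      (hc.stronglyMeasurableAtFilter isOpen_Ioi x hx) (hc.continuousAt (Ioi_mem_nhds hx))
  set N : ℂ := (((a * b * (1 + α))⁻¹ * ∫ t in Ioi 0, Φ t ^ 2 : ℝ) : ℂ)
  rw [← setIntegral_mul_schrodinger (r := fun x => (Φ x : ℂ))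
    (y := fun x => varSol Φ F (a * b * (1 + α)) (fun t => (Φ t : ℂ)) x + N * F x)
    (y' := fun x => varSolDeriv Φ Φ' F F' (a * b * (1 + α)) (fun t => (Φ t : ℂ)) x + N * F' x)
    S.q_cont (Complex.continuous_ofReal.comp_continuousOn S.Phi_cont) hφ]
  · refine setIntegral_congr_fun measurableSet_Ioi fun x hx => ?_
    simp only [S.psiSol_eq _ hx]
    rfl
  · intro x hx
    exact (hasDerivAt_varSol (S.cPhi x hx) (S.cF x hx) (prim S.F_cont S.memLp_F_Ioc x hx)
      (prim S.Phi_cont S.memLp_Phi_Ioc x hx)).add ((S.cF x hx).const_mul N)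
  · intro x hx
    refine ((S.hasDerivAt_varSolDeriv hx (prim S.F_cont S.memLp_F_Ioc x hx)
      (prim S.Phi_cont S.memLp_Phi_Ioc x hx)).add ((S.cF' x hx).const_mul N)).congr_deriv ?_
    ring

/-- For t ≥ x ≥ 1 one has Φ(t)² ≤ Φ(x)² e^(-(t-x)), and the exponential has integral 1. -/
theorem setIntegral_Ioi_Phi_sq_le (S : SolPair α q Φ Φ' F F' a b κ) {x : ℝ} (hx : 1 ≤ x) :
    ∫ t in Ioi x, Φ t ^ 2 ≤ Φ x ^ 2 := by
  have hx0 : 0 < x := zero_lt_one.trans_le hx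
  have h1 : ∫ t in Ioi x, Φ t ^ 2 ≤ ∫ t in Ioi x, Φ x ^ 2 * Real.exp x * Real.exp (-1 * t) := by
    refine setIntegral_mono_on (S.integrable_Phi_sq.mono_set (Ioi_subset_Ioi hx0.le))
      ((integrableOn_exp_mul_Ioi (by norm_num) x).const_mul _) measurableSet_Ioi fun t ht => ?_
    have h := pow_le_pow_left₀ (S.Phi_pos t (hx0.trans ht)).le (S.Phi_le_exp hx (le_of_lt ht)) 2
    refine h.trans_eq ?_
    rw [mul_pow, ← Real.exp_nat_mul, mul_assoc, ← Real.exp_add]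
    congr 2
    push_cast
    ring
  refine h1.trans_eq ?_
  rw [integral_const_mul, integral_exp_mul_Ioi (by norm_num)]
  have : Real.exp x * Real.exp (-1 * x) = 1 := by rw [← Real.exp_add]; simp
  linear_combination Φ x ^ 2 * this

/-- The bound FΦ ≤ C controls both integrals. On (0, 1] the function is dominated by a combination
of Φ and F; on (1, ∞) the two terms are at most CxΦ and CΦ, up to the Wronskian. -/
theorem memLp_psiSol (S : SolPair α q Φ Φ' F F' a b κ) :
    MemLp (psiSol Φ F (a * b * (1 + α))) 2 (volume.restrict (Ioi 0)) := by
  obtain ⟨C, hC, hFP⟩ := S.exists_FPhi_bound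
  have hw := inv_pos.mpr S.wr_pos
  have hI0 : ∀ x, 0 ≤ ∫ t in Ioc 0 x, F t * Φ t := fun x =>
    setIntegral_nonneg measurableSet_Ioc fun t ht => (mul_pos (S.F_pos t ht.1) (S.Phi_pos t ht.1)).le
  have hI : ∀ x > 0, ∫ t in Ioc 0 x, F t * Φ t ≤ C * x := fun x hx => by
    refine (setIntegral_mono_on (S.integrableOn_FPhi x) (integrableOn_const measure_Ioc_lt_top.ne)
      measurableSet_Ioc fun t ht => hFP t ht.1).trans_eq ?_
    rw [setIntegral_const, Measure.real, Real.volume_Ioc, sub_zero, ENNReal.toReal_ofReal hx.le,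
      smul_eq_mul, mul_comm]
  have hJ0 : ∀ x, 0 ≤ ∫ t in Ioi x, Φ t ^ 2 := fun x =>
    setIntegral_nonneg measurableSet_Ioi fun t _ => sq_nonneg _
  have hnn : ∀ x > 0, 0 ≤ psiSol Φ F (a * b * (1 + α)) x := fun x hx => by
    have := (S.Phi_pos x hx).le
    have := (S.F_pos x hx).le
    have := hI0 x
    have := hJ0 x
    unfold psiSol
    positivity
  refine memLp_two_of_Ioc_of_Ioi ?_ ?_
  · have hd : MemLp (fun x => (a * b * (1 + α))⁻¹ * (C * Φ x + (∫ t in Ioi 0, Φ t ^ 2) * F x)) 2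
        (volume.restrict (Ioc 0 1)) :=
      (((S.memLp_Phi_Ioc 1).const_mul C).add ((S.memLp_F_Ioc 1).const_mul _)).const_mul _
    refine hd.mono' (((S.continuousOn_psiSol _).mono Ioc_subset_Ioi_self).aestronglyMeasurable
      measurableSet_Ioc) ?_
    refine (ae_restrict_iff' measurableSet_Ioc).mpr (Eventually.of_forall fun x hx => ?_)
    rw [Real.norm_of_nonneg (hnn x hx.1), psiSol]
    refine mul_le_mul_of_nonneg_left (add_le_add ?_ ?_) hw.le
    · rw [mul_comm]
      refine mul_le_mul_of_nonneg_right ((hI x hx.1).trans ?_) (S.Phi_pos x hx.1).le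
      nlinarith [hx.2]
    · rw [mul_comm]
      refine mul_le_mul_of_nonneg_right ?_ (S.F_pos x hx.1).le
      exact setIntegral_mono_set S.integrable_Phi_sq (Eventually.of_forall fun t => sq_nonneg _)
        (Ioi_subset_Ioi hx.1.le).eventuallyLE
  · refine (S.memLp_linear_mul_Phi_Ioi.const_mul ((a * b * (1 + α))⁻¹ * C)).mono'
      (((S.continuousOn_psiSol _).mono (Ioi_subset_Ioi zero_le_one)).aestronglyMeasurable
        measurableSet_Ioi) ?_
    refine (ae_restrict_iff' measurableSet_Ioi).mpr (Eventually.of_forall fun x (hx : 1 < x) => ?_)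
    have hx0 : 0 < x := zero_lt_one.trans hx
    rw [Real.norm_of_nonneg (hnn x hx0), psiSol, mul_assoc _ C]
    refine mul_le_mul_of_nonneg_left ?_ hw.le
    have h1 := mul_le_mul_of_nonneg_left (hI x hx0) (S.Phi_pos x hx0).le
    have h2 := mul_le_mul_of_nonneg_left (S.setIntegral_Ioi_Phi_sq_le hx.le) (S.F_pos x hx0).le
    have h3 := mul_le_mul_of_nonneg_right (hFP x hx0) (S.Phi_pos x hx0).le
    linarith

theorem funLimits_Phi (S : SolPair α q Φ Φ' F F' a b κ) :
    FunLimits α (Ioi 0) (fun x => (Φ x : ℂ)) a (-(κ * a) : ℝ) := by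
  refine ⟨Complex.continuous_ofReal.comp_continuousOn S.Phi_cont, ?_, ?_⟩
  · refine ((Complex.continuous_ofReal.tendsto _).comp S.lim_Phi).congr' ?_
    filter_upwards [self_mem_nhdsWithin] with x (hx : 0 < x)
    rw [abs_of_pos hx, Function.comp_apply]
    push_cast
    rfl
  · refine ((Complex.continuous_ofReal.tendsto _).comp S.lim_Phi').congr' ?_
    filter_upwards [self_mem_nhdsWithin] with x (hx : 0 < x)
    rw [abs_of_pos hx, Function.comp_apply]
    push_cast
    rfl

theorem funLimits_F (S : SolPair α q Φ Φ' F F' a b κ) :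
    FunLimits α (Ioi 0) (fun x => (F x : ℂ)) 0 b := by
  have h1 : Tendsto (fun x : ℝ => ((x ^ (-(1 + α / 2)) * F x : ℝ) : ℂ)) (𝓝[>] 0) (𝓝 (b : ℂ)) :=
    (Complex.continuous_ofReal.tendsto b).comp S.lim_F
  have h2 : Tendsto (fun x : ℝ => ((x ^ (1 + α) : ℝ) : ℂ)) (𝓝[>] 0) (𝓝 ((0 : ℝ) : ℂ)) :=
    (Complex.continuous_ofReal.tendsto 0).comp
      (tendsto_rpow_zero (p := 1 + α) (by linarith [S.hα0]))
  refine ⟨Complex.continuous_ofReal.comp_continuousOn S.F_cont, ?_, ?_⟩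
  · have h3 := h1.mul h2
    rw [Complex.ofReal_zero, mul_zero] at h3
    refine h3.congr' ?_
    filter_upwards [self_mem_nhdsWithin] with x (hx : 0 < x)
    rw [abs_of_pos hx, ← Complex.ofReal_mul, ← Complex.ofReal_mul, mul_right_comm, ← Real.rpow_add hx]
    congr 3
    ring
  · refine h1.congr' ?_
    filter_upwards [self_mem_nhdsWithin] with x (hx : 0 < x)
    rw [abs_of_pos hx, zero_mul, sub_zero, Complex.ofReal_mul]

theorem FunLimits.congr {f f' : ℝ → ℂ} {U : Set ℝ} {g₀ g₁ : ℂ} (h : FunLimits α U f g₀ g₁)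
    (hf : EqOn f' f U) : FunLimits α U f' g₀ g₁ := by
  refine ⟨h.1.congr hf, h.2.1.congr' ?_, h.2.2.congr' ?_⟩
  · filter_upwards [self_mem_nhdsWithin] with x hx
    rw [hf hx]
  · filter_upwards [self_mem_nhdsWithin] with x hx
    rw [hf hx]

/-- Only the multiple of F in `psiSol_eq` counts. It gives ‖Φ‖² b divided by the Wronskian ab(1+α).
-/
theorem funLimits_psiSol (S : SolPair α q Φ Φ' F F' a b κ) :
    FunLimits α (Ioi 0) (fun x => (psiSol Φ F (a * b * (1 + α)) x : ℂ)) 0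
      ((∫ t in Ioi 0, Φ t ^ 2) / (a * (1 + α)) : ℝ) := by
  have h := (S.funLimits_varSol S.memLp_ofReal_Phi).add
    (S.funLimits_F.const_mul (((a * b * (1 + α))⁻¹ * ∫ t in Ioi 0, Φ t ^ 2 : ℝ) : ℂ))
  have e : (((a * b * (1 + α))⁻¹ * ∫ t in Ioi 0, Φ t ^ 2 : ℝ) : ℂ) * b =
      (((∫ t in Ioi 0, Φ t ^ 2) / (a * (1 + α)) : ℝ) : ℂ) := by
    rw [← Complex.ofReal_mul]
    congr 1
    have := S.a_pos
    have := S.b_pos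
    have := S.hα0
    field_simp
  rw [mul_zero, add_zero, zero_add, e] at h
  exact FunLimits.congr h fun x hx => S.psiSol_eq _ hx

theorem normSq_pos (S : SolPair α q Φ Φ' F F' a b κ) : 0 < ∫ t in Ioi 0, Φ t ^ 2 := by
  rw [setIntegral_pos_iff_support_of_nonneg_ae (Eventually.of_forall fun t => sq_nonneg _)
    S.integrable_Phi_sq]
  have : Function.support (fun t => Φ t ^ 2) ∩ Ioi 0 = Ioi 0 :=
    inter_eq_right.mpr fun t ht => (pow_pos (S.Phi_pos t ht) 2).ne'
  rw [this]
  simp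

end SolPair

/-! ### The minimal operators on the two half-lines -/

section HalfLines

variable {α : ℝ} {k : ℤ} {U : Set ℝ}

/-- The shifted potential. -/
def shiftedPotential (α : ℝ) (k : ℤ) (x : ℝ) : ℝ := potential α k x + shiftConst k

theorem shiftedPotential_neg (α : ℝ) (k : ℤ) (x : ℝ) :
    shiftedPotential α k (-x) = shiftedPotential α k x := by
  simp [shiftedPotential, potential]

theorem diffExpr_add_shift (φ : ℝ → ℂ) (x : ℝ) :
    diffExpr α k φ x + (shiftConst k : ℂ) * φ x = schrodinger (shiftedPotential α k) φ x := by
  rw [diffExpr, schrodinger, shiftedPotential]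
  push_cast
  ring

theorem toLp_add_shift_ae (hU : IsOpen U) (h0 : (0 : ℝ) ∉ U) {φ : ℝ → ℂ} (hφ : φ ∈ testFn U) :
    ((diffExpr_memLp α k hU h0 hφ).toLp _ + (shiftConst k : ℂ) • (testFn_memLp hφ).toLp φ : L2 U)
      =ᵐ[volume.restrict U] schrodinger (shiftedPotential α k) φ := by
  filter_upwards [Lp.coeFn_add ((diffExpr_memLp α k hU h0 hφ).toLp _)
      ((shiftConst k : ℂ) • (testFn_memLp hφ).toLp φ),
    Lp.coeFn_smul (shiftConst k : ℂ) ((testFn_memLp hφ).toLp φ),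
    (diffExpr_memLp α k hU h0 hφ).coeFn_toLp, (testFn_memLp hφ).coeFn_toLp] with x h1 h2 h3 h4
  rw [h1, Pi.add_apply, h2, Pi.smul_apply, h3, h4, smul_eq_mul, diffExpr_add_shift]

theorem inner_add_shift (hU : IsOpen U) (h0 : (0 : ℝ) ∉ U) {φ : ℝ → ℂ} (hφ : φ ∈ testFn U)
    (g : L2 U) :
    inner ℂ g ((diffExpr_memLp α k hU h0 hφ).toLp _ +
      (shiftConst k : ℂ) • (testFn_memLp hφ).toLp φ) =
      ∫ x in U, conj (g x) * schrodinger (shiftedPotential α k) φ x := by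
  rw [inner_eq_integral]
  refine integral_congr_ae ?_
  filter_upwards [toLp_add_shift_ae (α := α) (k := k) hU h0 hφ] with x hx
  rw [hx]

theorem deficiencyData_minOp (hα : 0 ≤ α) (hU : IsOpen U) (h0 : (0 : ℝ) ∉ U) {Φ Ψ : ℝ → ℝ}
    (hΦ : MemLp (fun x => (Φ x : ℂ)) 2 (volume.restrict U))
    (hΨ : MemLp (fun x => (Ψ x : ℂ)) 2 (volume.restrict U))
    (h1 : ∀ φ ∈ testFn U, ∫ x in U, (Φ x : ℂ) * schrodinger (shiftedPotential α k) φ x = 0)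
    (h2 : ∀ φ ∈ testFn U, ∫ x in U, (Ψ x : ℂ) * schrodinger (shiftedPotential α k) φ x =
      ∫ x in U, (Φ x : ℂ) * φ x)
    (h3 : ∀ g : ℝ → ℂ, MemLp g 2 (volume.restrict U) →
      (∀ φ ∈ testFn U, ∫ x in U, schrodinger (shiftedPotential α k) φ x * g x = 0) →
      ∃ c : ℂ, g =ᵐ[volume.restrict U] fun x => c * (Φ x : ℂ))
    (hne : hΦ.toLp _ ≠ 0) :
    DeficiencyData (minOp α k hU h0) (shiftConst k) (hΦ.toLp _) (hΨ.toLp _) where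
  dense := (isNonnegSymm_minOp hα k hU h0).dense
  symm := (isNonnegSymm_minOp hα k hU h0).symm
  nonneg := (isNonnegSymm_minOp hα k hU h0).nonneg
  lam_nonneg := by unfold shiftConst; split_ifs <;> norm_num
  coercive := coercive_minOp hα k hU h0
  phi := fun u => by
    obtain ⟨φ, e1, e2⟩ := exists_testFn_of_mem hU h0 u
    rw [e1, e2, inner_add_shift hU h0 φ.2, ← h1 φ.1 φ.2]
    refine integral_congr_ae ?_
    filter_upwards [hΦ.coeFn_toLp] with x hx
    rw [hx, Complex.conj_ofReal]
  psi := fun u => by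
    obtain ⟨φ, e1, e2⟩ := exists_testFn_of_mem hU h0 u
    rw [e1, e2, inner_add_shift hU h0 φ.2, inner_toLp]
    have h := h2 φ.1 φ.2
    simp only [Complex.conj_ofReal]
    rw [← h]
    refine integral_congr_ae ?_
    filter_upwards [hΨ.coeFn_toLp] with x hx
    rw [hx, Complex.conj_ofReal]
  ker := fun g hg => by
    -- The inner product conjugates its first argument, so the conjugate of g is the weak solution;
    -- Φ is real, and conjugating back only changes the coefficient.
    obtain ⟨c, hc⟩ := h3 (fun x => conj (g x)) (Lp.memLp g).star fun φ hφ => by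
      obtain ⟨u, e1, e2⟩ := exists_mem_of_testFn (α := α) (k := k) hU h0 hφ
      have := hg u
      rw [e1, e2, inner_add_shift hU h0 hφ] at this
      rw [← this]
      exact integral_congr_ae (Eventually.of_forall fun x => mul_comm _ _)
    refine ⟨conj c, Lp.ext ?_⟩
    filter_upwards [hc, hΦ.coeFn_toLp, Lp.coeFn_smul (conj c) (hΦ.toLp _)] with x e1 e2 e3
    rw [e3, Pi.smul_apply, e2, smul_eq_mul, ← Complex.conj_conj (g x), e1, map_mul,
      Complex.conj_ofReal]
  phi_ne := hne
  real := by
    rw [inner_toLp, inner_toLp]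
    simp only [Complex.conj_ofReal, mul_comm]

/-- The data on a half-line that determine the adjoint of the minimal operator and the boundary
values of the elements of its domain. -/
structure HalfLineData (α : ℝ) (k : ℤ) {U : Set ℝ} (hU : IsOpen U) (h0 : (0 : ℝ) ∉ U)
    (a κ : ℝ) : Prop where
  memLp_Phi : MemLp (PhiT α k) 2 (volume.restrict U)
  memLp_Psi : MemLp (PsiT α k) 2 (volume.restrict U)
  deficiency : DeficiencyData (minOp α k hU h0) (shiftConst k) (memLp_Phi.toLp _) (memLp_Psi.toLp _)
  limits_Phi : FunLimits α U (PhiT α k) a (-(κ * a) : ℝ)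
  limits_Psi : FunLimits α U (PsiT α k) 0 (normSqPhi α k / (a * (1 + α)) : ℝ)
  limits_closure : ∀ φ ∈ (minOp α k hU h0).closure.domain, HasLimits α φ 0 0
  normSq : ∫ x in U, ‖PhiT α k x‖ ^ 2 = normSqPhi α k

section Positive

variable {Φ' F' : ℝ → ℝ} {a b κ : ℝ}

theorem Psi_eq_psiSol (S : SolPair α (shiftedPotential α k) (Phi α k) Φ' (Fsol α k) F' a b κ)
    {x : ℝ} (hx : 0 < x) : Psi α k x = SolPair.psiSol (Phi α k) (Fsol α k) (wronskian α k) x := by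
  have e1 : EqOn (fun ρ => green α k x ρ * Phi α k ρ)
      (fun ρ => (wronskian α k)⁻¹ * Phi α k x * (Fsol α k ρ * Phi α k ρ)) (Ioc 0 x) := fun ρ hρ => by
    simp only [green]
    split_ifs with h
    · ring
    -- On the diagonal the two branches of the Green kernel agree.
    · obtain rfl : ρ = x := le_antisymm hρ.2 (not_lt.mp h)
      ring
  have e2 : EqOn (fun ρ => green α k x ρ * Phi α k ρ)
      (fun ρ => (wronskian α k)⁻¹ * Fsol α k x * Phi α k ρ ^ 2) (Ioi x) := fun ρ hρ => by
    simp only [green, if_neg (not_lt.mpr (le_of_lt (mem_Ioi.mp hρ)))]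
    ring
  have i1 := (S.integrableOn_FPhi x).const_mul ((wronskian α k)⁻¹ * Phi α k x)
  have i2 := (S.integrable_Phi_sq.mono_set (Ioi_subset_Ioi hx.le)).const_mul
    ((wronskian α k)⁻¹ * Fsol α k x)
  rw [Psi, ← Ioc_union_Ioi_eq_Ioi hx.le, setIntegral_union (Ioc_disjoint_Ioi le_rfl)
    measurableSet_Ioi (IntegrableOn.congr_fun i1 e1.symm measurableSet_Ioc)
    (IntegrableOn.congr_fun i2 e2.symm measurableSet_Ioi), setIntegral_congr_fun measurableSet_Ioc e1,
    setIntegral_congr_fun measurableSet_Ioi e2, integral_const_mul, integral_const_mul,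
    SolPair.psiSol]
  ring

theorem halfLineData_pos (S : SolPair α (shiftedPotential α k) (Phi α k) Φ' (Fsol α k) F' a b κ)
    (hw : wronskian α k = a * b * (1 + α)) :
    HalfLineData α k isOpen_Ioi self_notMem_Ioi a κ := by
  have ePhi : EqOn (PhiT α k) (fun x => (Phi α k x : ℂ)) (Ioi 0) := fun x (hx : 0 < x) => by
    rw [PhiT, abs_of_pos hx]
  have ePsi : EqOn (PsiT α k)
      (fun x => (SolPair.psiSol (Phi α k) (Fsol α k) (a * b * (1 + α)) x : ℂ)) (Ioi 0) :=
    fun x (hx : 0 < x) => by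
      simp only [PsiT, abs_of_pos hx, Psi_eq_psiSol S hx, hw]
  have aPhi : PhiT α k =ᵐ[volume.restrict (Ioi 0)] fun x => (Phi α k x : ℂ) :=
    ae_restrict_of_forall_mem measurableSet_Ioi ePhi
  have aPsi : PsiT α k =ᵐ[volume.restrict (Ioi 0)]
      fun x => (SolPair.psiSol (Phi α k) (Fsol α k) (a * b * (1 + α)) x : ℂ) :=
    ae_restrict_of_forall_mem measurableSet_Ioi ePsi
  have mPhi : MemLp (PhiT α k) 2 (volume.restrict (Ioi 0)) := S.memLp_ofReal_Phi.ae_eq aPhi.symm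
  have mPsi : MemLp (PsiT α k) 2 (volume.restrict (Ioi 0)) := S.memLp_psiSol.ofReal.ae_eq aPsi.symm
  have hN : ∫ x in Ioi 0, ‖PhiT α k x‖ ^ 2 = normSqPhi α k := by
    refine setIntegral_congr_fun measurableSet_Ioi fun x hx => ?_
    simp [ePhi hx]
  have D : DeficiencyData (minOp α k isOpen_Ioi self_notMem_Ioi) (shiftConst k)
      (mPhi.toLp _) (mPsi.toLp _) := by
    refine deficiencyData_minOp (Φ := fun x => Phi α k |x|) (Ψ := fun x => Psi α k |x|)
      S.hα0 isOpen_Ioi self_notMem_Ioi mPhi mPsi (fun φ hφ => ?_) (fun φ hφ => ?_)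
      (fun g hg h => ?_) fun h => ?_
    · rw [← S.setIntegral_Phi_mul_schrodinger hφ]
      refine setIntegral_congr_fun measurableSet_Ioi fun x hx => ?_
      simp only [abs_of_pos (mem_Ioi.mp hx)]
    · refine Eq.trans ?_ ((S.setIntegral_psiSol_mul_schrodinger hφ).trans ?_)
      · refine setIntegral_congr_fun measurableSet_Ioi fun x hx => ?_
        simp only [abs_of_pos (mem_Ioi.mp hx), Psi_eq_psiSol S hx, hw]
      · refine setIntegral_congr_fun measurableSet_Ioi fun x hx => ?_
        simp only [abs_of_pos (mem_Ioi.mp hx)]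
    · obtain ⟨c, hc⟩ := S.ae_eq_of_weak_solution hg h
      refine ⟨c, hc.trans (ae_restrict_of_forall_mem measurableSet_Ioi fun x hx => ?_)⟩
      simp only [abs_of_pos (mem_Ioi.mp hx)]
    · have h1 := norm_sq_toLp mPhi
      rw [hN] at h1
      have h2 : 0 < normSqPhi α k := S.normSq_pos
      rw [← h1] at h2
      exact h2.ne' (by rw [show mPhi.toLp (PhiT α k) = 0 from h, norm_zero]; norm_num)
  refine ⟨mPhi, mPsi, D, SolPair.FunLimits.congr S.funLimits_Phi ePhi,
    SolPair.FunLimits.congr S.funLimits_psiSol ePsi, fun φ hφ => ?_, hN⟩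
  obtain ⟨r, u, h1, h2⟩ := (D.mem_closure_iff φ).mp hφ
  choose f hf hf' using fun n => exists_testFn_of_mem isOpen_Ioi self_notMem_Ioi (u n)
  refine S.hasLimits_of_tendsto h1 h2 (φ := fun n => (f n).1) (fun n => (f n).2) (fun n => ?_)
    fun n => ?_
  · rw [hf n]
    exact MemLp.coeFn_toLp _
  · rw [hf n, hf' n]
    exact toLp_add_shift_ae isOpen_Ioi self_notMem_Ioi (f n).2

end Positive

/-! ### Reflection -/

theorem comp_neg_mem_testFn {φ : ℝ → ℂ} (hφ : φ ∈ testFn (Iio 0)) :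
    (fun x => φ (-x)) ∈ testFn (Ioi 0) := by
  refine ⟨hφ.1.comp contDiff_neg, hφ.2.1.comp_homeomorph (Homeomorph.neg ℝ), fun x hx => ?_⟩
  have h : (fun x => φ (-x)) = φ ∘ (Homeomorph.neg ℝ) := rfl
  rw [h, tsupport_comp_eq_preimage] at hx
  have : -x < 0 := hφ.2.2 hx
  exact neg_lt_zero.mp this

theorem comp_neg_mem_testFn' {φ : ℝ → ℂ} (hφ : φ ∈ testFn (Ioi 0)) :
    (fun x => φ (-x)) ∈ testFn (Iio 0) := by
  refine ⟨hφ.1.comp contDiff_neg, hφ.2.1.comp_homeomorph (Homeomorph.neg ℝ), fun x hx => ?_⟩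
  have h : (fun x => φ (-x)) = φ ∘ (Homeomorph.neg ℝ) := rfl
  rw [h, tsupport_comp_eq_preimage] at hx
  have : 0 < -x := hφ.2.2 hx
  exact neg_pos.mp this

theorem schrodinger_comp_neg (φ : ℝ → ℂ) (x : ℝ) :
    schrodinger (shiftedPotential α k) (fun y => φ (-y)) x =
      schrodinger (shiftedPotential α k) φ (-x) := by
  have h1 : deriv (fun y => φ (-y)) = fun y => -deriv φ (-y) := funext fun y => deriv_comp_neg φ y
  have h2 : deriv (fun y => -deriv φ (-y)) x = deriv (deriv φ) (-x) := by
    rw [deriv.fun_neg, deriv_comp_neg, neg_neg]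
  rw [schrodinger, schrodinger, h1, h2, shiftedPotential_neg]

theorem measurePreserving_neg_half :
    MeasurePreserving (fun x : ℝ => -x) (volume.restrict (Ioi 0)) (volume.restrict (Iio 0)) := by
  have h := (Measure.measurePreserving_neg (volume : Measure ℝ)).restrict_preimage
    (measurableSet_Iio (a := (0 : ℝ)))
  simpa using h

theorem measurePreserving_neg_half' :
    MeasurePreserving (fun x : ℝ => -x) (volume.restrict (Iio 0)) (volume.restrict (Ioi 0)) := by
  have h := (Measure.measurePreserving_neg (volume : Measure ℝ)).restrict_preimage
    (measurableSet_Ioi (a := (0 : ℝ)))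
  simpa using h

theorem setIntegral_Iio_eq {E : Type*} [NormedAddCommGroup E] [NormedSpace ℝ E] (f : ℝ → E) :
    ∫ x in Iio 0, f x = ∫ x in Ioi 0, f (-x) :=
  (measurePreserving_neg_half.integral_comp (Homeomorph.neg ℝ).measurableEmbedding f).symm

theorem tendsto_neg_half : Tendsto (fun x : ℝ => -x) (𝓝[<] 0) (𝓝[>] 0) := by
  simpa using tendsto_neg_nhdsLT (a := (0 : ℝ))

theorem FunLimits.comp_neg {f : ℝ → ℂ} {g₀ g₁ : ℂ} (h : FunLimits α (Ioi 0) f g₀ g₁) :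
    FunLimits α (Iio 0) (fun x => f (-x)) g₀ g₁ := by
  refine ⟨h.1.comp continuous_neg.continuousOn fun x hx => ?_, ?_, ?_⟩
  · exact neg_pos.mpr (mem_Iio.mp hx)
  · refine (h.2.1.comp tendsto_neg_half).congr fun x => ?_
    simp
  · refine (h.2.2.comp tendsto_neg_half).congr fun x => ?_
    simp

/-- The potential, Φ̃ and Ψ̃ are even, so the isometry x ↦ -x intertwines the two minimal operators
and preserves the boundary values, which are defined through |x|. -/
theorem halfLineData_neg {a κ : ℝ} (H : HalfLineData α k isOpen_Ioi self_notMem_Ioi a κ)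
    (hα : 0 ≤ α) :
    HalfLineData α k isOpen_Iio self_notMem_Iio a κ := by
  have ePhi : (fun x => PhiT α k (-x)) = PhiT α k := funext fun x => by simp [PhiT]
  have ePsi : (fun x => PsiT α k (-x)) = PsiT α k := funext fun x => by simp [PsiT]
  have mPhi : MemLp (PhiT α k) 2 (volume.restrict (Iio 0)) := by
    rw [← ePhi]
    exact H.memLp_Phi.comp_measurePreserving measurePreserving_neg_half'
  have mPsi : MemLp (PsiT α k) 2 (volume.restrict (Iio 0)) := by
    rw [← ePsi]
    exact H.memLp_Psi.comp_measurePreserving measurePreserving_neg_half'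
  have hN : ∫ x in Iio 0, ‖PhiT α k x‖ ^ 2 = normSqPhi α k := by
    rw [setIntegral_Iio_eq, ← H.normSq]
    simp [PhiT]
  have D : DeficiencyData (minOp α k isOpen_Iio self_notMem_Iio) (shiftConst k)
      (mPhi.toLp _) (mPsi.toLp _) := by
    have D' := H.deficiency
    have shift : ∀ (f : ℝ → ℝ) (hf : MemLp (fun x => (f |x| : ℂ)) 2 (volume.restrict (Ioi 0)))
        (φ : ℝ → ℂ) (hφ : φ ∈ testFn (Ioi 0)),
        ∃ u : (minOp α k isOpen_Ioi self_notMem_Ioi).domain,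
          (u : L2 (Ioi 0)) = (testFn_memLp hφ).toLp φ ∧
          ∫ x in Ioi 0, (f |x| : ℂ) * schrodinger (shiftedPotential α k) φ x =
          inner ℂ (hf.toLp _) (minOp α k isOpen_Ioi self_notMem_Ioi u +
            (shiftConst k : ℂ) • (u : L2 (Ioi 0))) := fun f hf φ hφ => by
      obtain ⟨u, e1, e2⟩ := exists_mem_of_testFn (α := α) (k := k) isOpen_Ioi self_notMem_Ioi hφ
      refine ⟨u, e1, ?_⟩
      rw [e1, e2, inner_add_shift isOpen_Ioi self_notMem_Ioi hφ]
      refine integral_congr_ae ?_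
      filter_upwards [hf.coeFn_toLp] with x hx
      rw [hx, Complex.conj_ofReal]
    refine deficiencyData_minOp (Φ := fun x => Phi α k |x|) (Ψ := fun x => Psi α k |x|)
      hα isOpen_Iio self_notMem_Iio mPhi mPsi (fun φ hφ => ?_) (fun φ hφ => ?_)
      (fun g hg h => ?_) fun h => ?_
    · obtain ⟨u, -, e⟩ := shift (Phi α k) H.memLp_Phi _ (comp_neg_mem_testFn hφ)
      rw [setIntegral_Iio_eq]
      simp only [abs_neg, ← schrodinger_comp_neg]
      rw [e]
      exact D'.phi u
    · obtain ⟨u, e', e⟩ := shift (Psi α k) H.memLp_Psi _ (comp_neg_mem_testFn hφ)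
      rw [setIntegral_Iio_eq, setIntegral_Iio_eq]
      simp only [abs_neg, ← schrodinger_comp_neg]
      rw [e]
      refine (D'.psi u).trans ?_
      rw [e', inner_toLp]
      simp only [PhiT, Complex.conj_ofReal]
    · have hg' := hg.comp_measurePreserving measurePreserving_neg_half
      have hgs : MemLp (fun x => conj (g (-x))) 2 (volume.restrict (Ioi 0)) := hg'.star
      obtain ⟨c, hc⟩ := D'.ker (hgs.toLp _) fun u => by
        obtain ⟨φ, e1, e2⟩ := exists_testFn_of_mem isOpen_Ioi self_notMem_Ioi u
        rw [e1, e2, inner_add_shift isOpen_Ioi self_notMem_Ioi φ.2, ← h _ (comp_neg_mem_testFn' φ.2), setIntegral_Iio_eq]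
        refine integral_congr_ae ?_
        filter_upwards [hgs.coeFn_toLp] with x hx
        rw [hx, Complex.conj_conj, schrodinger_comp_neg, neg_neg, mul_comm]
      refine ⟨conj c, ?_⟩
      have hae : (fun x => g (-x)) =ᵐ[volume.restrict (Ioi 0)]
          fun x => conj c * (Phi α k |x| : ℂ) := by
        have h1 := hgs.coeFn_toLp
        rw [hc] at h1
        filter_upwards [h1, Lp.coeFn_smul c (H.memLp_Phi.toLp _), H.memLp_Phi.coeFn_toLp]
          with x h1 h2 h3
        rw [h2, Pi.smul_apply, h3, smul_eq_mul] at h1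
        rw [← Complex.conj_conj (g (-x)), ← h1, map_mul, PhiT, Complex.conj_ofReal]
      have := measurePreserving_neg_half'.quasiMeasurePreserving.ae_eq_comp hae
      refine this.mono fun x hx => ?_
      simpa using hx
    · have h1 := norm_sq_toLp mPhi
      have h2 := norm_sq_toLp H.memLp_Phi
      have h3 : mPhi.toLp (PhiT α k) = 0 := h
      rw [hN, ← H.normSq, ← h2, h3, norm_zero, eq_comm] at h1
      refine D'.phi_ne (norm_eq_zero.mp (pow_eq_zero_iff two_ne_zero |>.mp (h1.trans ?_)))
      norm_num
  refine ⟨mPhi, mPsi, D, ePhi ▸ H.limits_Phi.comp_neg, ePsi ▸ H.limits_Psi.comp_neg,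
    fun φ hφ => ?_, hN⟩
  let R := Lp.compMeasurePreservingₗᵢ ℂ (E := ℂ) (p := 2) (fun x : ℝ => -x) measurePreserving_neg_half
  have hR : ∀ g : L2 (Iio 0), (R g : L2 (Ioi 0)) =ᵐ[volume.restrict (Ioi 0)] fun x => g (-x) := fun g =>
    Lp.coeFn_compMeasurePreserving g measurePreserving_neg_half
  -- Reflection carries approximating sequences of test functions, together with their images, to
  -- the positive half-line.
  have hlim : HasLimits α (R φ) 0 0 := by
    refine H.limits_closure _ ((H.deficiency.mem_closure_iff _).mpr ?_)
    obtain ⟨r, u, h1, h2⟩ := (D.mem_closure_iff φ).mp hφ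
    choose f hf hf' using fun n => exists_testFn_of_mem isOpen_Iio self_notMem_Iio (u n)
    choose v hv hv' using fun n => exists_mem_of_testFn (α := α) (k := k) isOpen_Ioi self_notMem_Ioi
      (comp_neg_mem_testFn (f n).2)
    refine ⟨R r, v, ((R.continuous.tendsto φ).comp h1).congr fun n => ?_,
      ((R.continuous.tendsto r).comp h2).congr fun n => ?_⟩
    · rw [Function.comp_apply, hf n, hv n]
      refine Lp.ext ((hR _).trans ?_)
      refine (measurePreserving_neg_half.quasiMeasurePreserving.ae_eq_comp
        (testFn_memLp (f n).2).coeFn_toLp).trans ?_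
      exact (testFn_memLp (comp_neg_mem_testFn (f n).2)).coeFn_toLp.symm
    · rw [Function.comp_apply, hf n, hf' n, hv n, hv' n]
      refine Lp.ext ((hR _).trans ?_)
      refine (measurePreserving_neg_half.quasiMeasurePreserving.ae_eq_comp
        (toLp_add_shift_ae isOpen_Iio self_notMem_Iio (f n).2)).trans ?_
      refine EventuallyEq.trans (Eventually.of_forall fun x => ?_)
        (toLp_add_shift_ae isOpen_Ioi self_notMem_Ioi (comp_neg_mem_testFn (f n).2)).symm
      exact (schrodinger_comp_neg (f n).1 x).symm
  obtain ⟨f, hf, hfe, l0, l1⟩ := hlim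
  have hL : FunLimits α (Ioi 0) f 0 0 := ⟨hf, l0, l1⟩
  refine hL.comp_neg.hasLimits ?_
  have := measurePreserving_neg_half'.quasiMeasurePreserving.ae_eq_comp ((hR φ).symm.trans hfe)
  refine this.mono fun x hx => ?_
  simpa using hx

end HalfLines

/-! ### The solutions for `k ≠ 0` -/

theorem contDiffOn_shiftedPotential (α : ℝ) (k : ℤ) :
    ContDiffOn ℝ ∞ (shiftedPotential α k) (Ioi 0) := by
  have h : EqOn (shiftedPotential α k)
      (fun x => (k : ℝ) ^ 2 * x ^ (2 * α) + α * (2 + α) / (4 * x ^ 2) + shiftConst k) (Ioi 0) :=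
    fun x (hx : 0 < x) => by rw [shiftedPotential, potential, abs_of_pos hx]
  refine ContDiffOn.congr ?_ h
  have h1 : ContDiffOn ℝ ∞ (fun x : ℝ => x ^ (2 * α)) (Ioi 0) :=
    contDiffOn_id.rpow_const_of_ne fun x (hx : 0 < x) => hx.ne'
  have h2 : ContDiffOn ℝ ∞ (fun x : ℝ => α * (2 + α) / (4 * x ^ 2)) (Ioi 0) :=
    contDiffOn_const.div (contDiffOn_const.mul (contDiffOn_id.pow 2)) fun x (hx : 0 < x) => by
      have := hx.ne'
      positivity
  exact ((contDiffOn_const.mul h1).add h2).add contDiffOn_const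

/-- `x^{-α/2} exp(s x^{1+α}/(1+α))`. -/
def expSol (α s x : ℝ) : ℝ := x ^ (-(α / 2)) * Real.exp (s / (1 + α) * x ^ (1 + α))

/-- The derivative of `expSol`. -/
def expSolDeriv (α s x : ℝ) : ℝ := (-(α / 2) * x⁻¹ + s * x ^ α) * expSol α s x

theorem expSol_pos (α s : ℝ) {x : ℝ} (hx : 0 < x) : 0 < expSol α s x :=
  mul_pos (Real.rpow_pos_of_pos hx _) (Real.exp_pos _)

theorem hasDerivAt_expSol {α : ℝ} (hα : 0 ≤ α) (s : ℝ) {x : ℝ} (hx : 0 < x) :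
    HasDerivAt (expSol α s) (expSolDeriv α s x) x := by
  refine ((Real.hasDerivAt_rpow_const (p := -(α / 2)) (Or.inl hx.ne')).mul
    (((Real.hasDerivAt_rpow_const (p := 1 + α) (Or.inl hx.ne')).const_mul
      (s / (1 + α))).exp)).congr_deriv ?_
  have h1 : x ^ (-(α / 2) - 1) = x ^ (-(α / 2)) * x⁻¹ := by
    rw [Real.rpow_sub hx, Real.rpow_one, div_eq_mul_inv]
  rw [expSolDeriv, expSol, h1, add_sub_cancel_left]
  field_simp

/-- The logarithmic derivative p = -α/(2x) + s x^α satisfies the Riccati equation p' + p² = s²x^(2α)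
+ α(2+α)/(4x²), as the terms in x^(α-1) cancel. Only s² enters, so s = ±|k| give two solutions. -/
theorem hasDerivAt_expSolDeriv {α : ℝ} (hα : 0 ≤ α) (s : ℝ) {x : ℝ} (hx : 0 < x) :
    HasDerivAt (expSolDeriv α s)
      ((s ^ 2 * x ^ (2 * α) + α * (2 + α) / (4 * x ^ 2)) * expSol α s x) x := by
  refine ((((hasDerivAt_inv hx.ne').const_mul (-(α / 2))).add
    ((Real.hasDerivAt_rpow_const (p := α) (Or.inl hx.ne')).const_mul s)).mul
    (hasDerivAt_expSol hα s hx)).congr_deriv ?_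
  have h1 : x ^ (α - 1) = x ^ α * x⁻¹ := by
    rw [Real.rpow_sub hx, Real.rpow_one, div_eq_mul_inv]
  have h2 : x ^ (2 * α) = x ^ α * x ^ α := by rw [← Real.rpow_add hx]; congr 1; ring
  rw [expSolDeriv, h1, h2]
  simp only [Pi.add_apply]
  field_simp
  ring

/-- Needed for F' ≥ 0: up to a positive factor, F' is (1+α) z cosh z - (α/2) sinh z. -/
theorem sinh_le_mul_cosh {z : ℝ} (hz : 0 ≤ z) : Real.sinh z ≤ z * Real.cosh z := by
  have h : MonotoneOn (fun z => z * Real.cosh z - Real.sinh z) (Ici 0) := by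
    refine monotoneOn_of_hasDerivWithinAt_nonneg (f' := fun z => z * Real.sinh z) (convex_Ici 0)
      (by fun_prop) (fun z _ => ?_) fun z hz => ?_
    · refine HasDerivAt.hasDerivWithinAt ((((hasDerivAt_id z).mul (Real.hasDerivAt_cosh z)).sub
        (Real.hasDerivAt_sinh z)).congr_deriv ?_)
      simp
    · rw [interior_Ici] at hz
      exact mul_nonneg (le_of_lt hz) (Real.sinh_nonneg_iff.mpr (le_of_lt hz))
  have := h (mem_Ici.mpr le_rfl) (mem_Ici.mpr hz) hz
  simp only [zero_mul, Real.sinh_zero, sub_zero] at this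
  linarith

/-- For k ≠ 0 both solutions are x^(-α/2) times an entire function of x^(1+α), so their next
asymptotic coefficient is a derivative at 0. -/
theorem tendsto_div_rpow {f : ℝ → ℝ} {f' : ℝ} (hf : HasDerivAt f f' 0) (hf0 : f 0 = 0) {p : ℝ}
    (hp : 0 < p) : Tendsto (fun x : ℝ => f (x ^ p) / x ^ p) (𝓝[>] 0) (𝓝 f') := by
  have h1 : Tendsto (fun x : ℝ => x ^ p) (𝓝[>] 0) (𝓝[≠] 0) := by
    refine tendsto_nhdsWithin_iff.mpr ⟨SolPair.tendsto_rpow_zero hp, ?_⟩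
    filter_upwards [self_mem_nhdsWithin] with x (hx : 0 < x)
    exact (Real.rpow_pos_of_pos hx p).ne'
  refine (hf.tendsto_slope.comp h1).congr fun x => ?_
  simp [slope, hf0, div_eq_inv_mul]

theorem solPair_of_ne {α : ℝ} (hα0 : 0 ≤ α) (hα1 : α < 1) {k : ℤ} (hk : k ≠ 0) :
    SolPair α (shiftedPotential α k) (Phi α k)
      (fun x => √(Real.pi * (1 + α) / (2 * |(k : ℝ)|)) * expSolDeriv α (-|(k : ℝ)|) x) (Fsol α k)
      (fun x => √(2 * (1 + α) / (Real.pi * |(k : ℝ)|)) / 2 *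
        (expSolDeriv α |(k : ℝ)| x - expSolDeriv α (-|(k : ℝ)|) x))
      √(Real.pi * (1 + α) / (2 * |(k : ℝ)|))
      (√(2 * (1 + α) / (Real.pi * |(k : ℝ)|)) * (|(k : ℝ)| / (1 + α))) (|(k : ℝ)| / (1 + α)) := by
  have hK1 : (1 : ℝ) ≤ |(k : ℝ)| := by exact_mod_cast Int.one_le_abs hk
  have hsq : |(k : ℝ)| ^ 2 = (k : ℝ) ^ 2 := sq_abs _
  set K := |(k : ℝ)| with hK
  have hK0 : 0 < K := zero_lt_one.trans_le hK1
  set A := √(Real.pi * (1 + α) / (2 * K)) with hA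
  set B := √(2 * (1 + α) / (Real.pi * K)) with hB
  have hπ := Real.pi_pos
  have hA0 : 0 < A := Real.sqrt_pos.mpr (by positivity)
  have hB0 : 0 < B := Real.sqrt_pos.mpr (by positivity)
  have eΦ : ∀ x, Phi α k x = A * expSol α (-K) x := fun x => by
    rw [Phi, if_neg hk, expSol, ← hK, ← hA, mul_assoc, neg_div, neg_mul]
  have eF : ∀ x, Fsol α k x = B / 2 * (expSol α K x - expSol α (-K) x) := fun x => by
    rw [Fsol, if_neg hk, expSol, expSol, ← hK, ← hB, Real.sinh_eq, neg_div, neg_mul]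
    ring
  have eF' : ∀ x, Fsol α k x = B * x ^ (-(α / 2)) * Real.sinh (K / (1 + α) * x ^ (1 + α)) :=
    fun x => by rw [Fsol, if_neg hk]
  have eq : ∀ x > 0, ∀ s, s ^ 2 = (k : ℝ) ^ 2 →
      s ^ 2 * x ^ (2 * α) + α * (2 + α) / (4 * x ^ 2) = shiftedPotential α k x := fun x hx s hs => by
    rw [shiftedPotential, potential, abs_of_pos hx, shiftConst, if_neg hk, hs, add_zero]
  refine
    { hα0 := hα0
      hα1 := hα1
      q_smooth := contDiffOn_shiftedPotential α k
      dPhi := fun x hx => ?_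
      dPhi' := fun x hx => ?_
      dF := fun x hx => ?_
      dF' := fun x hx => ?_
      Phi_pos := fun x hx => ?_
      F_pos := fun x hx => ?_
      F'_nonneg := fun x hx => ?_
      decay := fun x hx => ?_
      a_pos := hA0
      b_pos := by positivity
      lim_Phi := ?_
      lim_Phi' := ?_
      lim_F := ?_ }
  · exact ((hasDerivAt_expSol hα0 (-K) hx).const_mul A).congr_of_eventuallyEq
      (Eventually.of_forall eΦ)
  · refine ((hasDerivAt_expSolDeriv hα0 (-K) hx).const_mul A).congr_deriv ?_
    rw [eΦ, eq x hx (-K) (by rw [neg_sq, hsq])]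
    ring
  · exact (((hasDerivAt_expSol hα0 K hx).sub (hasDerivAt_expSol hα0 (-K) hx)).const_mul
      (B / 2)).congr_of_eventuallyEq (Eventually.of_forall eF)
  · refine (((hasDerivAt_expSolDeriv hα0 K hx).sub
      (hasDerivAt_expSolDeriv hα0 (-K) hx)).const_mul (B / 2)).congr_deriv ?_
    rw [eF, eq x hx (-K) (by rw [neg_sq, hsq]), eq x hx K hsq]
    ring
  · rw [eΦ]
    exact mul_pos hA0 (expSol_pos _ _ hx)
  · rw [eF']
    have h1 := Real.rpow_pos_of_pos hx (-(α / 2))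
    have h2 := Real.rpow_pos_of_pos hx (1 + α)
    have h3 : 0 < Real.sinh (K / (1 + α) * x ^ (1 + α)) := Real.sinh_pos_iff.mpr (by positivity)
    positivity
  · set z := K / (1 + α) * x ^ (1 + α) with hz
    have hx1 := Real.rpow_pos_of_pos hx (1 + α)
    have hz0 : 0 ≤ z := by positivity
    have h1 := sinh_le_mul_cosh hz0
    have h2 := Real.sinh_nonneg_iff.mpr hz0
    have hKx : K * x ^ α = (1 + α) * z * x⁻¹ := by
      rw [hz, Real.rpow_add hx, Real.rpow_one]
      field_simp
    have e : expSolDeriv α K x - expSolDeriv α (-K) x =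
        2 * (x ^ (-(α / 2)) * x⁻¹) * ((1 + α) * (z * Real.cosh z) - α / 2 * Real.sinh z) := by
      have e1 : expSol α (-K) x = x ^ (-(α / 2)) * Real.exp (-z) := by
        rw [expSol, hz, neg_div, neg_mul]
      rw [expSolDeriv, expSolDeriv, e1, neg_mul K, hKx, Real.sinh_eq, Real.cosh_eq, expSol, ← hz]
      ring
    rw [e]
    have h4 : 0 ≤ (1 + α) * (z * Real.cosh z) - α / 2 * Real.sinh z := by nlinarith
    have h5 := Real.rpow_pos_of_pos hx (-(α / 2))
    positivity
  -- Here Φ'/Φ = -α/(2x) - |k|x^α, which is at most -1 for x ≥ 1 since |k| ≥ 1.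
  · have hx0 : 0 < x := zero_lt_one.trans_le hx
    have h1 : 0 ≤ α / 2 * x⁻¹ := by positivity
    have h2 : 1 ≤ x ^ α := Real.one_le_rpow hx hα0
    have h3 : 1 ≤ K * x ^ α := one_le_mul_of_one_le_of_one_le hK1 h2
    have h4 := mul_pos hA0 (expSol_pos α (-K) hx0)
    rw [eΦ, expSolDeriv]
    nlinarith
  · have h : Tendsto (fun x : ℝ => A * Real.exp (-K / (1 + α) * x ^ (1 + α))) (𝓝[>] 0) (𝓝 A) := by
      have := ((Real.continuous_exp.tendsto _).comp ((SolPair.tendsto_rpow_zero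
        (p := 1 + α) (by linarith)).const_mul (-K / (1 + α)))).const_mul A
      simpa using this
    refine h.congr' ?_
    filter_upwards [self_mem_nhdsWithin] with x (hx : 0 < x)
    have : x ^ (α / 2) * x ^ (-(α / 2)) = 1 := by rw [← Real.rpow_add hx]; simp
    rw [eΦ, expSol]
    linear_combination -(A * Real.exp (-K / (1 + α) * x ^ (1 + α))) * this
  · have hd : HasDerivAt (fun y => A * (Real.exp (-K / (1 + α) * y) - 1)) (-(K / (1 + α) * A)) 0 := by
      refine ((((hasDerivAt_id (0 : ℝ)).const_mul (-K / (1 + α))).exp.sub_const 1).const_mul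
        A).congr_deriv ?_
      simp
      ring
    refine (tendsto_div_rpow hd (by simp) (p := 1 + α) (by linarith)).congr' ?_
    filter_upwards [self_mem_nhdsWithin] with x (hx : 0 < x)
    have : x ^ (-(1 + α / 2)) * x ^ (-(α / 2)) = (x ^ (1 + α))⁻¹ := by
      rw [← Real.rpow_add hx, ← Real.rpow_neg hx.le]; congr 1; ring
    rw [eΦ, expSol, div_eq_mul_inv, ← this]
    ring
  · have hd : HasDerivAt (fun y => B * Real.sinh (K / (1 + α) * y)) (B * (K / (1 + α))) 0 := by
      refine ((((hasDerivAt_id (0 : ℝ)).const_mul (K / (1 + α))).sinh).const_mul B).congr_deriv ?_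
      simp
    refine (tendsto_div_rpow hd (by simp) (p := 1 + α) (by linarith)).congr' ?_
    filter_upwards [self_mem_nhdsWithin] with x (hx : 0 < x)
    have : x ^ (-(1 + α / 2)) * x ^ (-(α / 2)) = (x ^ (1 + α))⁻¹ := by
      rw [← Real.rpow_add hx, ← Real.rpow_neg hx.le]; congr 1; ring
    rw [eF', div_eq_mul_inv, ← this]
    ring

theorem wronskian_of_ne {α : ℝ} (hα0 : 0 ≤ α) {k : ℤ} (hk : k ≠ 0) :
    wronskian α k = √(Real.pi * (1 + α) / (2 * |(k : ℝ)|)) *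
      (√(2 * (1 + α) / (Real.pi * |(k : ℝ)|)) * (|(k : ℝ)| / (1 + α))) * (1 + α) := by
  have hK0 : 0 < |(k : ℝ)| := by positivity
  have hπ := Real.pi_pos
  rw [wronskian, if_neg hk, ← mul_assoc, ← Real.sqrt_mul (by positivity)]
  have : Real.pi * (1 + α) / (2 * |(k : ℝ)|) * (2 * (1 + α) / (Real.pi * |(k : ℝ)|)) =
      ((1 + α) / |(k : ℝ)|) ^ 2 := by
    field_simp
  rw [this, Real.sqrt_sq (by positivity)]
  field_simp

/-! ### The modified Bessel function of the second kind -/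

/-- From e^y ≥ y^(n+1)/(n+1)! at y = x cosh t, one more power of cosh is absorbed than required. The
spare one is traded for e^(-t) through 1 ≤ 2 cosh t · e^(-t). -/
theorem exists_cosh_pow_mul_exp_le (n : ℕ) {x : ℝ} (hx : 0 < x) :
    ∃ C, ∀ t : ℝ, Real.cosh t ^ n * Real.exp (-x * Real.cosh t) ≤ C * Real.exp (-t) := by
  refine ⟨2 * ((n + 1).factorial / x ^ (n + 1)), fun t => ?_⟩
  have hc := Real.cosh_pos t
  have h1 := Real.pow_div_factorial_le_exp (x * Real.cosh t) (by positivity) (n + 1)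
  have h2 : Real.exp t ≤ 2 * Real.cosh t := by
    rw [Real.cosh_eq]; linarith [Real.exp_pos (-t)]
  have h3 : 1 ≤ 2 * Real.cosh t * Real.exp (-t) := by
    have := mul_le_mul_of_nonneg_right h2 (Real.exp_pos (-t)).le
    rwa [← Real.exp_add, add_neg_cancel, Real.exp_zero] at this
  have hf : (0 : ℝ) < (n + 1).factorial := by positivity
  have h4 : Real.cosh t ^ (n + 1) * Real.exp (-x * Real.cosh t) ≤
      (n + 1).factorial / x ^ (n + 1) := by
    rw [div_le_iff₀ hf, mul_pow] at h1
    rw [le_div_iff₀ (by positivity)]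
    have := mul_le_mul_of_nonneg_right h1 (Real.exp_pos (-(x * Real.cosh t))).le
    rw [mul_right_comm (Real.exp _), ← Real.exp_add, add_neg_cancel, Real.exp_zero, one_mul] at this
    rw [neg_mul]
    linarith
  calc Real.cosh t ^ n * Real.exp (-x * Real.cosh t)
      ≤ Real.cosh t ^ n * Real.exp (-x * Real.cosh t) * (2 * Real.cosh t * Real.exp (-t)) :=
        le_mul_of_one_le_right (by positivity) h3
    _ = 2 * (Real.cosh t ^ (n + 1) * Real.exp (-x * Real.cosh t)) * Real.exp (-t) := by ring
    _ ≤ _ := by gcongr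

theorem cosh_mul_le {μ : ℝ} (hμ : |μ| ≤ 1) (t : ℝ) : Real.cosh (μ * t) ≤ Real.cosh t := by
  rw [Real.cosh_le_cosh, abs_mul]
  exact mul_le_of_le_one_left (abs_nonneg t) hμ

theorem abs_sinh_le_cosh (t : ℝ) : |Real.sinh t| ≤ Real.cosh t :=
  abs_le_of_sq_le_sq (by linarith [Real.cosh_sq t]) (Real.cosh_pos t).le

theorem integrableOn_of_le_cosh {f : ℝ → ℝ} (hf : Continuous f) {n : ℕ} {x D : ℝ} (hx : 0 < x)
    (hD : 0 ≤ D) (h : ∀ t, |f t| ≤ D * (Real.cosh t ^ n * Real.exp (-x * Real.cosh t))) :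
    IntegrableOn f (Ioi 0) := by
  obtain ⟨C, hC⟩ := exists_cosh_pow_mul_exp_le n hx
  have hi : IntegrableOn (fun t : ℝ => D * C * Real.exp (-1 * t)) (Ioi 0) :=
    (integrableOn_exp_mul_Ioi (by norm_num) 0).const_mul _
  refine hi.mono' hf.aestronglyMeasurable (Eventually.of_forall fun t => ?_)
  rw [neg_one_mul, mul_assoc]
  exact (h t).trans (mul_le_mul_of_nonneg_left (hC t) hD)

theorem tendsto_zero_of_le_cosh {f : ℝ → ℝ} {n : ℕ} {x D : ℝ} (hx : 0 < x)
    (hD : 0 ≤ D) (h : ∀ t, |f t| ≤ D * (Real.cosh t ^ n * Real.exp (-x * Real.cosh t))) :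
    Tendsto f atTop (𝓝 0) := by
  obtain ⟨C, hC⟩ := exists_cosh_pow_mul_exp_le n hx
  refine squeeze_zero_norm (a := fun t => D * (C * Real.exp (-t)))
    (fun t => (h t).trans (mul_le_mul_of_nonneg_left (hC t) hD)) ?_
  have := ((Real.tendsto_exp_neg_atTop_nhds_zero).const_mul C).const_mul D
  simpa using this

/-- The integrals `∫₀^∞ e^{-x cosh t} cosh^n t cosh (μ t) dt`. -/
def coshIntegral (n : ℕ) (μ x : ℝ) : ℝ :=
  ∫ t in Ioi (0 : ℝ), Real.exp (-x * Real.cosh t) * (Real.cosh t ^ n * Real.cosh (μ * t))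

theorem coshIntegral_zero (μ x : ℝ) : coshIntegral 0 μ x = besselK μ x := by
  simp [coshIntegral, besselK]

theorem abs_coshIntegrand_le (n : ℕ) {μ : ℝ} (hμ : |μ| ≤ 1) {x y : ℝ} (hxy : x ≤ y) (t : ℝ) :
    |Real.exp (-y * Real.cosh t) * (Real.cosh t ^ n * Real.cosh (μ * t))| ≤
      1 * (Real.cosh t ^ (n + 1) * Real.exp (-x * Real.cosh t)) := by
  have h1 := Real.cosh_pos t
  have h2 := Real.cosh_pos (μ * t)
  rw [abs_of_pos (by positivity), one_mul, pow_succ, mul_comm]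
  refine mul_le_mul (mul_le_mul_of_nonneg_left (cosh_mul_le hμ t) (by positivity))
    (Real.exp_le_exp.mpr ?_) (Real.exp_pos _).le (by positivity)
  nlinarith

theorem integrableOn_coshIntegrand (n : ℕ) {μ : ℝ} (hμ : |μ| ≤ 1) {x : ℝ} (hx : 0 < x) :
    IntegrableOn (fun t => Real.exp (-x * Real.cosh t) * (Real.cosh t ^ n * Real.cosh (μ * t)))
      (Ioi 0) :=
  integrableOn_of_le_cosh (by fun_prop) hx zero_le_one (abs_coshIntegrand_le n hμ le_rfl)

/-- Differentiation under the integral on the neighbourhood y > x/2, where all the t-integrands are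
dominated by the one with rate x/2. -/
theorem hasDerivAt_coshIntegral (n : ℕ) {μ : ℝ} (hμ : |μ| ≤ 1) {x : ℝ} (hx : 0 < x) :
    HasDerivAt (coshIntegral n μ) (-coshIntegral (n + 1) μ x) x := by
  have hx2 : 0 < x / 2 := half_pos hx
  have hb : IntegrableOn
      (fun t => Real.cosh t ^ (n + 2) * Real.exp (-(x / 2) * Real.cosh t)) (Ioi 0) := by
    refine integrableOn_of_le_cosh (n := n + 2) (D := 1) (by fun_prop) hx2 zero_le_one fun t => ?_
    have := Real.cosh_pos t
    rw [abs_of_pos (by positivity), one_mul]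
  have h := hasDerivAt_integral_of_dominated_loc_of_deriv_le (μ := volume.restrict (Ioi 0))
    (F := fun y t => Real.exp (-y * Real.cosh t) * (Real.cosh t ^ n * Real.cosh (μ * t)))
    (F' := fun y t => -(Real.exp (-y * Real.cosh t) * (Real.cosh t ^ (n + 1) * Real.cosh (μ * t))))
    (x₀ := x) (s := Ioi (x / 2)) (Ioi_mem_nhds (half_lt_self hx))
    (Eventually.of_forall fun y => Continuous.aestronglyMeasurable (by fun_prop))
    (integrableOn_coshIntegrand n hμ hx) (Continuous.aestronglyMeasurable (by fun_prop))
    (Eventually.of_forall fun t y (hy : x / 2 < y) => ?_) hb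
    (Eventually.of_forall fun t y _ => ?_)
  · refine h.2.congr_deriv ?_
    rw [integral_neg, coshIntegral]
  · rw [norm_neg]
    simpa using abs_coshIntegrand_le (n + 1) hμ hy.le t
  · refine ((((hasDerivAt_id y).neg.mul_const (Real.cosh t)).exp).mul_const
      (Real.cosh t ^ n * Real.cosh (μ * t))).congr_deriv ?_
    simp
    ring

theorem coshIntegral_pos (n : ℕ) {μ : ℝ} (hμ : |μ| ≤ 1) {x : ℝ} (hx : 0 < x) :
    0 < coshIntegral n μ x := by
  have hp : ∀ t, 0 < Real.exp (-x * Real.cosh t) * (Real.cosh t ^ n * Real.cosh (μ * t)) :=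
    fun t => by
      have := Real.cosh_pos t
      have := Real.cosh_pos (μ * t)
      positivity
  rw [coshIntegral, setIntegral_pos_iff_support_of_nonneg_ae
    (Eventually.of_forall fun t => (hp t).le) (integrableOn_coshIntegrand n hμ hx)]
  have : (Function.support fun t =>
      Real.exp (-x * Real.cosh t) * (Real.cosh t ^ n * Real.cosh (μ * t))) ∩ Ioi 0 = Ioi 0 :=
    inter_eq_right.mpr fun t _ => (hp t).ne'
  rw [this]
  simp

theorem coshIntegral_le_succ (n : ℕ) {μ : ℝ} (hμ : |μ| ≤ 1) {x : ℝ} (hx : 0 < x) :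
    coshIntegral n μ x ≤ coshIntegral (n + 1) μ x := by
  refine setIntegral_mono_on (integrableOn_coshIntegrand n hμ hx)
    (integrableOn_coshIntegrand (n + 1) hμ hx) measurableSet_Ioi fun t _ => ?_
  have h1 := Real.one_le_cosh t
  have h2 := Real.cosh_pos (μ * t)
  refine mul_le_mul_of_nonneg_left (mul_le_mul_of_nonneg_right ?_ h2.le) (Real.exp_pos _).le
  exact pow_le_pow_right₀ h1 n.le_succ

theorem hasDerivAt_exp_neg_mul_cosh (x t : ℝ) : HasDerivAt (fun t => Real.exp (-x * Real.cosh t))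
    (-(x * Real.sinh t) * Real.exp (-x * Real.cosh t)) t := by
  refine (((Real.hasDerivAt_cosh t).const_mul (-x)).exp).congr_deriv ?_
  ring

theorem hasDerivAt_cosh_mul (μ t : ℝ) :
    HasDerivAt (fun t => Real.cosh (μ * t)) (μ * Real.sinh (μ * t)) t := by
  refine (((hasDerivAt_id t).const_mul μ).cosh).congr_deriv ?_
  simp [mul_comm]

theorem hasDerivAt_sinh_mul (μ t : ℝ) :
    HasDerivAt (fun t => Real.sinh (μ * t)) (μ * Real.cosh (μ * t)) t := by
  refine (((hasDerivAt_id t).const_mul μ).sinh).congr_deriv ?_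
  simp [mul_comm]

/-- Bessel's differential equation. -/
theorem coshIntegral_ode {μ : ℝ} (hμ : |μ| ≤ 1) {x : ℝ} (hx : 0 < x) :
    x ^ 2 * coshIntegral 2 μ x - x * coshIntegral 1 μ x - (x ^ 2 + μ ^ 2) * coshIntegral 0 μ x = 0 := by
  have i0 := integrableOn_coshIntegrand 0 hμ hx
  have i1 := integrableOn_coshIntegrand 1 hμ hx
  have i2 := integrableOn_coshIntegrand 2 hμ hx
  have hi := ((i2.const_mul (x ^ 2)).sub (i1.const_mul x)).sub (i0.const_mul (x ^ 2 + μ ^ 2))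
  have hb : ∀ t, |-(x * Real.sinh t) * Real.exp (-x * Real.cosh t) * Real.cosh (μ * t) -
      μ * (Real.exp (-x * Real.cosh t) * Real.sinh (μ * t))| ≤
      (x + 1) * (Real.cosh t ^ 2 * Real.exp (-x * Real.cosh t)) := fun t => by
    have h1 := abs_sinh_le_cosh t
    have h2 := cosh_mul_le hμ t
    have h3 := (abs_sinh_le_cosh (μ * t)).trans h2
    have h4 := Real.one_le_cosh t
    have h5 := Real.exp_pos (-x * Real.cosh t)
    have h6 := Real.cosh_pos (μ * t)
    refine (abs_sub _ _).trans ?_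
    rw [abs_mul, abs_mul, abs_neg, abs_mul, abs_mul μ, abs_mul, abs_of_pos hx, abs_of_pos h5,
      abs_of_pos h6]
    have e1 : |Real.sinh t| * Real.cosh (μ * t) ≤ Real.cosh t ^ 2 := by
      rw [sq]; exact mul_le_mul h1 h2 h6.le (by positivity)
    have e2 : |μ| * |Real.sinh (μ * t)| ≤ Real.cosh t ^ 2 := by
      nlinarith [abs_nonneg μ, abs_nonneg (Real.sinh (μ * t))]
    have e3 := mul_le_mul_of_nonneg_left e1 (mul_pos hx h5).le
    have e4 := mul_le_mul_of_nonneg_left e2 h5.le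
    nlinarith
  -- The combination of integrands in Bessel's equation is an exact t-derivative, and its primitive
  -- vanishes at t = 0 and at infinity.
  have h := integral_Ioi_of_hasDerivAt_of_tendsto' (a := 0) (m := 0)
    (f := fun t => -(x * Real.sinh t) * Real.exp (-x * Real.cosh t) * Real.cosh (μ * t) -
      μ * (Real.exp (-x * Real.cosh t) * Real.sinh (μ * t)))
    (fun t _ => ?_) hi (tendsto_zero_of_le_cosh hx (by linarith) hb)
  · rw [integral_sub' ((i2.const_mul (x ^ 2)).sub (i1.const_mul x)) (i0.const_mul (x ^ 2 + μ ^ 2)),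
      integral_sub' (i2.const_mul (x ^ 2)) (i1.const_mul x), integral_const_mul, integral_const_mul,
      integral_const_mul] at h
    simpa [coshIntegral] using h
  · refine (((((Real.hasDerivAt_sinh t).const_mul x).neg.mul (hasDerivAt_exp_neg_mul_cosh x t)).mul
      (hasDerivAt_cosh_mul μ t)).sub (((hasDerivAt_exp_neg_mul_cosh x t).mul
      (hasDerivAt_sinh_mul μ t)).const_mul μ)).congr_deriv ?_
    have hs := Real.cosh_sq t
    simp only [Pi.mul_apply, Pi.neg_apply, Pi.sub_apply]
    linear_combination -x ^ 2 * Real.exp (-x * Real.cosh t) * Real.cosh (μ * t) * hs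

/-- The recurrence `x K_ν' + ν K_ν = - x K_{1-ν}`. -/
theorem coshIntegral_recurrence {μ : ℝ} (hμ0 : 0 ≤ μ) (hμ1 : μ ≤ 1) {x : ℝ} (hx : 0 < x) :
    μ * coshIntegral 0 μ x - x * coshIntegral 1 μ x + x * coshIntegral 0 (1 - μ) x = 0 := by
  have hμ : |μ| ≤ 1 := by rwa [abs_of_nonneg hμ0]
  have hμ' : |1 - μ| ≤ 1 := by rw [abs_of_nonneg (by linarith)]; linarith
  have i0 := integrableOn_coshIntegrand 0 hμ hx
  have i1 := integrableOn_coshIntegrand 1 hμ hx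
  have i2 := integrableOn_coshIntegrand 0 hμ' hx
  have hi := ((i0.const_mul μ).sub (i1.const_mul x)).add (i2.const_mul x)
  have hb : ∀ t, |Real.exp (-x * Real.cosh t) * Real.sinh (μ * t)| ≤
      1 * (Real.cosh t ^ 1 * Real.exp (-x * Real.cosh t)) := fun t => by
    have h3 := (abs_sinh_le_cosh (μ * t)).trans (cosh_mul_le hμ t)
    have h5 := Real.exp_pos (-x * Real.cosh t)
    rw [abs_mul, abs_of_pos h5, one_mul, pow_one, mul_comm]
    exact mul_le_mul_of_nonneg_right h3 h5.le
  -- Again an exact derivative, of e^(-x cosh t) sinh(μt), once cosh((1-μ)t) is expanded by the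
  -- addition formula.
  have h := integral_Ioi_of_hasDerivAt_of_tendsto' (a := 0) (m := 0)
    (f := fun t => Real.exp (-x * Real.cosh t) * Real.sinh (μ * t))
    (fun t _ => ?_) hi (tendsto_zero_of_le_cosh hx zero_le_one hb)
  · rw [integral_add' ((i0.const_mul μ).sub (i1.const_mul x)) (i2.const_mul x),
      integral_sub' (i0.const_mul μ) (i1.const_mul x), integral_const_mul, integral_const_mul,
      integral_const_mul] at h
    simpa [coshIntegral] using h
  · refine ((hasDerivAt_exp_neg_mul_cosh x t).mul (hasDerivAt_sinh_mul μ t)).congr_deriv ?_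
    have hs : Real.cosh ((1 - μ) * t) =
        Real.cosh t * Real.cosh (μ * t) - Real.sinh t * Real.sinh (μ * t) := by
      rw [← Real.cosh_sub]; congr 1; ring
    simp only [Pi.add_apply, Pi.sub_apply, hs]
    ring

/-! Behaviour at the origin. -/

/-- `∫₀^∞ s^{μ-1} e^{-s-x²/(4s)} ds`. -/
def gammaIntegral (μ x : ℝ) : ℝ :=
  ∫ s in Ioi (0 : ℝ), s ^ (μ - 1) * Real.exp (-s - x ^ 2 / (4 * s))

theorem continuousOn_gammaIntegrand (μ x : ℝ) :
    ContinuousOn (fun s : ℝ => s ^ (μ - 1) * Real.exp (-s - x ^ 2 / (4 * s))) (Ioi 0) := by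
  refine (continuousOn_id.rpow_const fun s (hs : 0 < s) => Or.inl hs.ne').mul
    (Real.continuous_exp.comp_continuousOn (continuousOn_neg.sub
      (continuousOn_const.div (by fun_prop) fun s (hs : 0 < s) => ?_)))
  positivity

theorem gammaIntegrand_le {μ x s : ℝ} (hs : 0 < s) :
    ‖s ^ (μ - 1) * Real.exp (-s - x ^ 2 / (4 * s))‖ ≤ Real.exp (-s) * s ^ (μ - 1) := by
  have h1 := Real.rpow_pos_of_pos hs (μ - 1)
  rw [Real.norm_of_nonneg (by positivity), mul_comm]
  refine mul_le_mul_of_nonneg_right (Real.exp_le_exp.mpr ?_) h1.le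
  have : 0 ≤ x ^ 2 / (4 * s) := by positivity
  linarith

theorem integrableOn_gammaIntegrand {μ : ℝ} (hμ : 0 < μ) (x : ℝ) :
    IntegrableOn (fun s : ℝ => s ^ (μ - 1) * Real.exp (-s - x ^ 2 / (4 * s))) (Ioi 0) :=
  (Real.GammaIntegral_convergent hμ).mono'
    ((continuousOn_gammaIntegrand μ x).aestronglyMeasurable measurableSet_Ioi)
    ((ae_restrict_iff' measurableSet_Ioi).mpr (Eventually.of_forall fun _ hs => gammaIntegrand_le hs))

theorem tendsto_gammaIntegral {μ : ℝ} (hμ : 0 < μ) :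
    Tendsto (gammaIntegral μ) (𝓝[>] 0) (𝓝 (Real.Gamma μ)) := by
  rw [Real.Gamma_eq_integral hμ]
  refine tendsto_integral_filter_of_dominated_convergence
    (fun s => Real.exp (-s) * s ^ (μ - 1)) (Eventually.of_forall fun x =>
      (continuousOn_gammaIntegrand μ x).aestronglyMeasurable measurableSet_Ioi)
    (Eventually.of_forall fun x => (ae_restrict_iff' measurableSet_Ioi).mpr
      (Eventually.of_forall fun _ hs => gammaIntegrand_le hs))
    (Real.GammaIntegral_convergent hμ)
    ((ae_restrict_iff' measurableSet_Ioi).mpr (Eventually.of_forall fun s (hs : 0 < s) => ?_))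
  have hc : Continuous fun x : ℝ => s ^ (μ - 1) * Real.exp (-s - x ^ 2 / (4 * s)) := by fun_prop
  have := (hc.tendsto 0).mono_left (nhdsWithin_le_nhds (s := Ioi 0))
  simpa [mul_comm] using this

/-- The substitution s = (x/2)e^u turns s + x²/(4s) into x cosh u. The right-hand side has a visible
limit at x = 0, a Gamma integral. -/
theorem rpow_mul_besselK {μ : ℝ} (hμ : 0 < μ) {x : ℝ} (hx : 0 < x) :
    x ^ μ * besselK μ x = 2 ^ (μ - 1) * gammaIntegral μ x := by
  have hx2 : 0 < x / 2 := half_pos hx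
  have himg : (fun u => x / 2 * Real.exp u) '' univ = Ioi 0 := by
    ext s
    simp only [image_univ, mem_range, mem_Ioi]
    refine ⟨fun ⟨u, hu⟩ => hu ▸ mul_pos hx2 (Real.exp_pos u), fun hs => ⟨Real.log (s / (x / 2)), ?_⟩⟩
    rw [Real.exp_log (div_pos hs hx2), mul_div_cancel₀ _ hx2.ne']
  have hd : ∀ u ∈ univ, HasDerivWithinAt (fun u => x / 2 * Real.exp u) (x / 2 * Real.exp u) univ u :=
    fun u _ => ((Real.hasDerivAt_exp u).const_mul _).hasDerivWithinAt
  have hinj : InjOn (fun u => x / 2 * Real.exp u) univ := fun u _ v _ h =>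
    Real.exp_injective (mul_left_cancel₀ hx2.ne' h)
  have hint : ∀ u : ℝ, |x / 2 * Real.exp u| • ((x / 2 * Real.exp u) ^ (μ - 1) *
      Real.exp (-(x / 2 * Real.exp u) - x ^ 2 / (4 * (x / 2 * Real.exp u)))) =
      (x / 2) ^ μ * (Real.exp (-x * Real.cosh u) * Real.exp (μ * u)) := fun u => by
    have hp : 0 < x / 2 * Real.exp u := mul_pos hx2 (Real.exp_pos u)
    have e1 : (x / 2 * Real.exp u) * (x / 2 * Real.exp u) ^ (μ - 1) =
        (x / 2) ^ μ * Real.exp (μ * u) := by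
      rw [Real.rpow_sub_one hp.ne', mul_div_cancel₀ _ hp.ne', Real.mul_rpow hx2.le (Real.exp_pos u).le,
        ← Real.exp_mul, mul_comm u]
    have e2 : -(x / 2 * Real.exp u) - x ^ 2 / (4 * (x / 2 * Real.exp u)) = -x * Real.cosh u := by
      rw [Real.cosh_eq, Real.exp_neg]
      have := (Real.exp_pos u).ne'
      field_simp
      ring
    rw [abs_of_pos hp, smul_eq_mul, ← mul_assoc, e1, e2]
    ring
  have hJ : gammaIntegral μ x =
      (x / 2) ^ μ * ∫ u, Real.exp (-x * Real.cosh u) * Real.exp (μ * u) := by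
    rw [gammaIntegral, ← himg, integral_image_eq_integral_abs_deriv_smul MeasurableSet.univ hd hinj,
      setIntegral_univ, ← integral_const_mul]
    exact integral_congr_ae (Eventually.of_forall hint)
  have hi : Integrable fun u => Real.exp (-x * Real.cosh u) * Real.exp (μ * u) := by
    have := integrableOn_gammaIntegrand hμ x
    rw [← himg, integrableOn_image_iff_integrableOn_abs_deriv_smul MeasurableSet.univ hd hinj,
      integrableOn_univ] at this
    simp only [hint] at this
    refine (this.const_mul ((x / 2) ^ μ)⁻¹).congr (Eventually.of_forall fun u => ?_)
    simp only
    rw [inv_mul_cancel_left₀ (Real.rpow_pos_of_pos hx2 μ).ne']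
  -- The half-line integral with cosh(μt) is doubled by evenness, and each exponential half of cosh
  -- contributes the same integral over ℝ.
  have hK : 2 * besselK μ x = ∫ u, Real.exp (-x * Real.cosh u) * Real.exp (μ * u) := by
    rw [besselK, ← integral_comp_abs]
    have e : ∀ u : ℝ, Real.exp (-x * Real.cosh |u|) * Real.cosh (μ * |u|) =
        1 / 2 * (Real.exp (-x * Real.cosh u) * Real.exp (μ * u)) +
        1 / 2 * (Real.exp (-x * Real.cosh (-u)) * Real.exp (μ * -u)) := fun u => by
      have h1 : Real.cosh (μ * |u|) = Real.cosh (μ * u) := by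
        rw [← Real.cosh_abs, abs_mul, abs_abs, ← abs_mul, Real.cosh_abs]
      rw [Real.cosh_abs, h1, Real.cosh_neg, Real.cosh_eq (μ * u), mul_neg]
      ring
    simp only [e]
    rw [integral_add (hi.const_mul _) (hi.comp_neg.const_mul _), integral_const_mul,
      integral_const_mul,
      integral_neg_eq_self (fun u => Real.exp (-x * Real.cosh u) * Real.exp (μ * u))]
    ring
  rw [hJ, ← hK, Real.div_rpow hx.le zero_le_two, Real.rpow_sub_one two_ne_zero]
  have := (Real.rpow_pos_of_pos zero_lt_two μ).ne'
  field_simp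

theorem tendsto_rpow_mul_besselK {μ : ℝ} (hμ : 0 < μ) :
    Tendsto (fun x => x ^ μ * besselK μ x) (𝓝[>] 0) (𝓝 (2 ^ (μ - 1) * Real.Gamma μ)) := by
  refine ((tendsto_gammaIntegral hμ).const_mul _).congr' ?_
  filter_upwards [self_mem_nhdsWithin] with x hx
  exact (rpow_mul_besselK hμ hx).symm

/-- The second term of the expansion of `K_μ` at the origin. -/
theorem tendsto_besselK_second {μ : ℝ} (hμ0 : 0 < μ) (hμ1 : μ < 1) :
    Tendsto (fun x => (x ^ μ * besselK μ x - 2 ^ (μ - 1) * Real.Gamma μ) / x ^ (2 * μ)) (𝓝[>] 0)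
      (𝓝 (-(2 ^ (-μ - 1) * Real.Gamma (1 - μ) / μ))) := by
  have hμ : |μ| ≤ 1 := by rw [abs_of_pos hμ0]; exact hμ1.le
  -- The recurrence reads (x^μ K_μ)' = -x^μ K_{1-μ}, so l'Hôpital reduces the second coefficient to
  -- the leading behaviour of K_{1-μ}.
  refine HasDerivAt.lhopital_zero_nhdsGT
    (f' := fun x => -(x ^ μ * besselK (1 - μ) x)) (g' := fun x => 2 * μ * x ^ (2 * μ - 1))
    ?_ ?_ ?_ ?_ (SolPair.tendsto_rpow_zero (by linarith)) ?_
  · filter_upwards [self_mem_nhdsWithin] with x (hx : 0 < x)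
    have hd := ((Real.hasDerivAt_rpow_const (p := μ) (Or.inl hx.ne')).mul
      (hasDerivAt_coshIntegral 0 hμ hx)).sub_const (2 ^ (μ - 1) * Real.Gamma μ)
    simp only [Pi.mul_apply, coshIntegral_zero] at hd
    refine hd.congr_deriv ?_
    have hr := coshIntegral_recurrence hμ0.le hμ1.le hx
    rw [coshIntegral_zero, coshIntegral_zero] at hr
    rw [Real.rpow_sub_one hx.ne']
    have hx0 := hx.ne'
    field_simp
    linear_combination hr
  · filter_upwards [self_mem_nhdsWithin] with x (hx : 0 < x)
    exact Real.hasDerivAt_rpow_const (Or.inl hx.ne')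
  · filter_upwards [self_mem_nhdsWithin] with x (hx : 0 < x)
    have := Real.rpow_pos_of_pos hx (2 * μ - 1)
    positivity
  · have := (tendsto_rpow_mul_besselK hμ0).sub_const (2 ^ (μ - 1) * Real.Gamma μ)
    rwa [sub_self] at this
  · have h := (tendsto_rpow_mul_besselK (μ := 1 - μ) (by linarith)).const_mul (-(2 * μ)⁻¹)
    have e : -(2 * μ)⁻¹ * (2 ^ (1 - μ - 1) * Real.Gamma (1 - μ)) =
        -(2 ^ (-μ - 1) * Real.Gamma (1 - μ) / μ) := by
      rw [Real.rpow_sub_one two_ne_zero (-μ), show (1 : ℝ) - μ - 1 = -μ by ring]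
      field_simp
    rw [e] at h
    refine h.congr' ?_
    filter_upwards [self_mem_nhdsWithin] with x (hx : 0 < x)
    have e1 : x ^ μ = x ^ (1 - μ) * x ^ (2 * μ - 1) := by rw [← Real.rpow_add hx]; congr 1; ring
    have h2 := (Real.rpow_pos_of_pos hx (2 * μ - 1)).ne'
    rw [e1]
    field_simp

/-! ### The modified Bessel function of the first kind -/

/-- The coefficients of `besselSeries`. -/
def besselCoeff (ν : ℝ) (m : ℕ) : ℝ := (m.factorial * Real.Gamma (m + ν + 1))⁻¹

/-- The entire function `z ↦ ∑ z^m / (m! Γ(m+ν+1))`. -/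
def besselSeries (ν z : ℝ) : ℝ := ∑' m : ℕ, besselCoeff ν m * z ^ m

theorem Gamma_arg_pos {ν : ℝ} (hν : 0 ≤ ν) (m : ℕ) : 0 < Real.Gamma (m + ν + 1) :=
  Real.Gamma_pos_of_pos (by positivity)

theorem besselCoeff_pos {ν : ℝ} (hν : 0 ≤ ν) (m : ℕ) : 0 < besselCoeff ν m := by
  have := Gamma_arg_pos hν m
  unfold besselCoeff
  positivity

theorem Gamma_le_Gamma_add_nat {ν : ℝ} (hν : 0 ≤ ν) (m : ℕ) :
    Real.Gamma (ν + 1) ≤ Real.Gamma (m + ν + 1) := by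
  induction m with
  | zero => simp
  | succ m ih =>
    refine ih.trans ?_
    have h : ((m + 1 : ℕ) : ℝ) + ν + 1 = (m + ν + 1) + 1 := by push_cast; ring
    have hm : (0 : ℝ) ≤ m := m.cast_nonneg
    rw [h, Real.Gamma_add_one (s := m + ν + 1) (by positivity)]
    exact le_mul_of_one_le_left (Gamma_arg_pos hν m).le (by linarith)

/-- Since Γ(m+ν+1) ≥ Γ(ν+1), the terms are dominated by those of the exponential series. -/
theorem summable_besselSeries {ν : ℝ} (hν : 0 ≤ ν) (z : ℝ) :
    Summable fun m => besselCoeff ν m * z ^ m := by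
  refine Summable.of_norm_bounded
    ((Real.summable_pow_div_factorial |z|).mul_left (Real.Gamma (ν + 1))⁻¹) fun m => ?_
  have h0 : 0 < Real.Gamma (ν + 1) := Real.Gamma_pos_of_pos (by linarith)
  have h1 := Gamma_le_Gamma_add_nat hν m
  have h2 : (0 : ℝ) < m.factorial := by positivity
  rw [norm_mul, norm_pow, Real.norm_eq_abs, Real.norm_eq_abs, abs_of_pos (besselCoeff_pos hν m),
    besselCoeff, mul_inv, div_eq_inv_mul, ← mul_assoc, mul_comm (m.factorial : ℝ)⁻¹]
  gcongr

theorem besselCoeff_succ {ν : ℝ} (m : ℕ) :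
    ((m + 1 : ℕ) : ℝ) * besselCoeff ν (m + 1) = besselCoeff (ν + 1) m := by
  have h : ((m + 1 : ℕ) : ℝ) + ν + 1 = m + (ν + 1) + 1 := by push_cast; ring
  rw [besselCoeff, besselCoeff, h, Nat.factorial_succ]
  push_cast
  have : (m : ℝ) + 1 ≠ 0 := by positivity
  rw [mul_assoc, mul_inv, mul_inv_cancel_left₀ this]

/-- Termwise differentiation shifts the coefficients from ν to ν + 1 by `besselCoeff_succ`. The
derivative series is dominated on the ball of radius |z| + 1 by its value at that radius. -/
theorem hasDerivAt_besselSeries {ν : ℝ} (hν : 0 ≤ ν) (z : ℝ) :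
    HasDerivAt (besselSeries ν) (besselSeries (ν + 1) z) z := by
  set R := |z| + 1
  have hshift : ∀ y : ℝ, ∀ m : ℕ, besselCoeff ν (m + 1) * (((m + 1 : ℕ) : ℝ) * y ^ (m + 1 - 1)) =
      besselCoeff (ν + 1) m * y ^ m := fun y m => by
    rw [← besselCoeff_succ, Nat.add_sub_cancel]
    ring
  have hsum : ∀ y : ℝ, Summable fun m : ℕ => besselCoeff ν m * ((m : ℝ) * y ^ (m - 1)) := fun y => by
    rw [← summable_nat_add_iff 1]
    simp only [hshift]
    exact summable_besselSeries (by linarith) y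
  have h := hasDerivAt_tsum_of_isPreconnected (hsum R) (Metric.isOpen_ball (x := (0 : ℝ)) (ε := R))
    (convex_ball (0 : ℝ) R).isPreconnected
    (g := fun m y => besselCoeff ν m * y ^ m)
    (g' := fun m y => besselCoeff ν m * ((m : ℝ) * y ^ (m - 1)))
    (fun m y _ => (hasDerivAt_pow m y).const_mul _) (fun m y hy => ?_)
    (Metric.mem_ball_self (by positivity)) (summable_besselSeries hν 0) (y := z) ?_
  · refine h.congr_deriv ?_
    rw [(hsum z).tsum_eq_zero_add]
    simp only [hshift]
    simp [besselSeries]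
  · have hy' : |y| ≤ R := by
      rw [Metric.mem_ball, dist_zero_right] at hy
      exact hy.le
    rw [norm_mul, norm_mul, norm_pow, Real.norm_eq_abs, Real.norm_eq_abs, Real.norm_eq_abs,
      abs_of_pos (besselCoeff_pos hν m), Nat.abs_cast]
    have := besselCoeff_pos hν m
    gcongr
  · rw [Metric.mem_ball, dist_zero_right]
    exact lt_add_one _

/-- Coefficientwise this is Γ(s+1) = sΓ(s) with s = m + ν + 1. As differentiation raises ν by one,
it is the modified Bessel equation in the variable z = x²/4. -/
theorem besselSeries_recurrence {ν : ℝ} (hν : 0 ≤ ν) (z : ℝ) :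
    besselSeries ν z = (ν + 1) * besselSeries (ν + 1) z + z * besselSeries (ν + 2) z := by
  have hs : Summable fun m : ℕ => (m : ℝ) * besselCoeff (ν + 1) m * z ^ m := by
    rw [← summable_nat_add_iff 1]
    refine ((summable_besselSeries (ν := ν + 2) (by linarith) z).mul_left z).congr fun m => ?_
    rw [besselCoeff_succ, show ν + 1 + 1 = ν + 2 by ring]
    ring
  have e : z * besselSeries (ν + 2) z = ∑' m : ℕ, (m : ℝ) * besselCoeff (ν + 1) m * z ^ m := by
    rw [hs.tsum_eq_zero_add, besselSeries, ← tsum_mul_left]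
    simp only [Nat.cast_zero, zero_mul, zero_add]
    refine tsum_congr fun m => ?_
    rw [besselCoeff_succ, show ν + 1 + 1 = ν + 2 by ring]
    ring
  rw [e, besselSeries, besselSeries, ← tsum_mul_left,
    ← ((summable_besselSeries (ν := ν + 1) (by linarith) z).mul_left (ν + 1)).tsum_add hs]
  refine tsum_congr fun m => ?_
  have h : (m : ℝ) + (ν + 1) + 1 = (m + ν + 1) + 1 := by ring
  have h1 : (m : ℝ) + ν + 1 ≠ 0 := by positivity
  have h2 := (Gamma_arg_pos hν m).ne'
  rw [besselCoeff, besselCoeff, h, Real.Gamma_add_one h1]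
  field_simp
  ring

theorem besselSeries_pos {ν z : ℝ} (hν : 0 ≤ ν) (hz : 0 ≤ z) : 0 < besselSeries ν z := by
  refine (summable_besselSeries hν z).tsum_pos (fun m => ?_) 0 ?_
  · exact mul_nonneg (besselCoeff_pos hν m).le (pow_nonneg hz m)
  · simpa using besselCoeff_pos hν 0

theorem besselSeries_zero (ν : ℝ) : besselSeries ν 0 = (Real.Gamma (ν + 1))⁻¹ := by
  rw [besselSeries, tsum_eq_single 0 fun m hm => by simp [hm]]
  simp [besselCoeff]

theorem besselI_eq {ν x : ℝ} (hx : 0 < x) :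
    besselI ν x = (x / 2) ^ ν * besselSeries ν (x ^ 2 / 4) := by
  rw [besselI, besselSeries, ← tsum_mul_left]
  refine tsum_congr fun m => ?_
  have h : (x / 2) ^ (2 * (m : ℝ)) = (x ^ 2 / 4) ^ m := by
    rw [Real.rpow_mul (by positivity), Real.rpow_natCast, Real.rpow_two]
    congr 1
    ring
  rw [Real.rpow_add (by positivity), h, besselCoeff]
  ring

theorem sqrt_mul_besselI {ν x : ℝ} (hx : 0 < x) :
    √x * besselI ν x = 2 ^ (-ν) * (x ^ (ν + 1 / 2) * besselSeries ν (x ^ 2 / 4)) := by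
  rw [besselI_eq hx, Real.div_rpow hx.le zero_le_two, Real.sqrt_eq_rpow, Real.rpow_add hx,
    Real.rpow_neg zero_le_two]
  ring

theorem hasDerivAt_rpow_mul_besselSeries {ν : ℝ} (hν : 0 ≤ ν) (p : ℝ) {x : ℝ} (hx : 0 < x) :
    HasDerivAt (fun x => x ^ p * besselSeries ν (x ^ 2 / 4))
      (p * (x ^ (p - 1) * besselSeries ν (x ^ 2 / 4)) +
        1 / 2 * (x ^ (p + 1) * besselSeries (ν + 1) (x ^ 2 / 4))) x := by
  have h2 : HasDerivAt (fun x : ℝ => x ^ 2 / 4) (x / 2) x := by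
    refine ((hasDerivAt_pow 2 x).div_const 4).congr_deriv ?_
    simp
    ring
  refine ((Real.hasDerivAt_rpow_const (p := p) (Or.inl hx.ne')).mul
    ((hasDerivAt_besselSeries hν (x ^ 2 / 4)).comp x h2)).congr_deriv ?_
  rw [Real.rpow_add_one hx.ne', Function.comp_apply]
  ring

/-! ### The solutions for `k = 0` -/

theorem shiftedPotential_zero (α : ℝ) (x : ℝ) :
    shiftedPotential α 0 x = 1 + (((1 + α) / 2) ^ 2 - 1 / 4) / x ^ 2 := by
  rw [shiftedPotential, potential, shiftConst, if_pos rfl]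
  rcases eq_or_ne x 0 with rfl | hx
  · simp
  · push_cast
    field_simp
    ring

/-- The derivative of `√x K_ν(x)`. -/
def sqrtBesselKDeriv (ν x : ℝ) : ℝ :=
  √x * ((2 * x)⁻¹ * coshIntegral 0 ν x - coshIntegral 1 ν x)

theorem hasDerivAt_sqrt_mul {f : ℝ → ℝ} {f' x : ℝ} (hx : 0 < x) (hf : HasDerivAt f f' x) :
    HasDerivAt (fun x => √x * f x) (√x * ((2 * x)⁻¹ * f x + f')) x := by
  refine ((Real.hasDerivAt_sqrt hx.ne').mul hf).congr_deriv ?_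
  have h := (Real.sqrt_pos.mpr hx).ne'
  have h2 := Real.sq_sqrt hx.le
  rw [mul_add]
  congr 1
  field_simp
  rw [h2, mul_comm]

theorem solPair_zero {α : ℝ} (hα0 : 0 ≤ α) (hα1 : α < 1) :
    SolPair α (shiftedPotential α 0) (Phi α 0) (sqrtBesselKDeriv ((1 + α) / 2)) (Fsol α 0)
      (fun x => 2 ^ (-((1 + α) / 2)) * (((1 + α) / 2 + 1 / 2) *
        (x ^ ((1 + α) / 2 + 1 / 2 - 1) * besselSeries ((1 + α) / 2) (x ^ 2 / 4)) +
        1 / 2 * (x ^ ((1 + α) / 2 + 1 / 2 + 1) * besselSeries ((1 + α) / 2 + 1) (x ^ 2 / 4))))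
      (2 ^ ((1 + α) / 2 - 1) * Real.Gamma ((1 + α) / 2))
      (2 ^ (-((1 + α) / 2)) * (Real.Gamma ((1 + α) / 2 + 1))⁻¹)
      (2 ^ (-(1 + α)) * Real.Gamma (1 - (1 + α) / 2) / ((1 + α) / 2 * Real.Gamma ((1 + α) / 2))) := by
  set ν := (1 + α) / 2 with hν
  have hν0 : 0 < ν := by positivity
  have hν1 : ν < 1 := by rw [hν]; linarith
  clear_value ν
  have hμ : |ν| ≤ 1 := by rw [abs_of_pos hν0]; exact hν1.le
  have hαν : α / 2 = ν - 1 / 2 := by rw [hν]; ring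
  have eΦ : ∀ x, Phi α 0 x = √x * coshIntegral 0 ν x := fun x => by
    rw [Phi, if_pos rfl, coshIntegral_zero, hν]
  have eF : ∀ x > 0, Fsol α 0 x = 2 ^ (-ν) * (x ^ (ν + 1 / 2) * besselSeries ν (x ^ 2 / 4)) :=
    fun x hx => by rw [Fsol, if_pos rfl, ← hν, sqrt_mul_besselI hx]
  have hg0 : 0 < Real.Gamma ν := Real.Gamma_pos_of_pos hν0
  have h2p : ∀ p : ℝ, (0 : ℝ) < 2 ^ p := fun p => Real.rpow_pos_of_pos zero_lt_two p
  refine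
    { hα0 := hα0
      hα1 := hα1
      q_smooth := contDiffOn_shiftedPotential α 0
      dPhi := fun x hx => ?_
      dPhi' := fun x hx => ?_
      dF := fun x hx => ?_
      dF' := fun x hx => ?_
      Phi_pos := fun x hx => ?_
      F_pos := fun x hx => ?_
      F'_nonneg := fun x hx => ?_
      decay := fun x hx => ?_
      a_pos := mul_pos (h2p _) hg0
      b_pos := mul_pos (h2p _) (inv_pos.mpr (Real.Gamma_pos_of_pos (by linarith)))
      lim_Phi := ?_
      lim_Phi' := ?_
      lim_F := ?_ }
  · refine ((hasDerivAt_sqrt_mul hx (hasDerivAt_coshIntegral 0 hμ hx)).congr_of_eventuallyEq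
      (Eventually.of_forall eΦ)).congr_deriv ?_
    rw [sqrtBesselKDeriv, sub_eq_add_neg]
  · have hd := hasDerivAt_sqrt_mul hx ((((((hasDerivAt_id x).const_mul 2).inv (by simpa using hx.ne')).mul
      (hasDerivAt_coshIntegral 0 hμ hx))).sub (hasDerivAt_coshIntegral 1 hμ hx))
    refine hd.congr_deriv ?_
    have hode := coshIntegral_ode hμ hx
    rw [shiftedPotential_zero, eΦ, ← hν]
    simp only [Pi.mul_apply, Pi.sub_apply, Pi.inv_apply, id, zero_add, one_add_one_eq_two]
    have hx0 := hx.ne'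
    field_simp
    linear_combination 16 * hode
  · refine (((hasDerivAt_rpow_mul_besselSeries hν0.le (ν + 1 / 2) hx).const_mul
      (2 ^ (-ν))).congr_of_eventuallyEq ?_)
    filter_upwards [Ioi_mem_nhds hx] with y hy
    exact eF y hy
  · refine ((((hasDerivAt_rpow_mul_besselSeries hν0.le (ν + 1 / 2 - 1) hx).const_mul
      (ν + 1 / 2)).add ((hasDerivAt_rpow_mul_besselSeries (ν := ν + 1) (by linarith)
      (ν + 1 / 2 + 1) hx).const_mul (1 / 2))).const_mul (2 ^ (-ν))).congr_deriv ?_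
    have hr := besselSeries_recurrence hν0.le (x ^ 2 / 4)
    rw [shiftedPotential_zero, eF x hx, ← hν, Real.rpow_sub_one hx.ne', Real.rpow_sub_one hx.ne',
      sub_add_cancel, add_sub_cancel_right, Real.rpow_add_one hx.ne', Real.rpow_add_one hx.ne',
      show ν + 1 + 1 = ν + 2 by ring]
    have hx0 := hx.ne'
    field_simp
    linear_combination -(16 * x ^ 2) * hr
  · rw [eΦ]
    exact mul_pos (Real.sqrt_pos.mpr hx) (coshIntegral_pos 0 hμ hx)
  · rw [eF x hx]
    have h1 := Real.rpow_pos_of_pos hx (ν + 1 / 2)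
    have h2 := besselSeries_pos (z := x ^ 2 / 4) hν0.le (by positivity)
    have h3 := h2p (-ν)
    positivity
  · have h1 := Real.rpow_pos_of_pos hx (ν + 1 / 2 - 1)
    have h1' := Real.rpow_pos_of_pos hx (ν + 1 / 2 + 1)
    have h2 := besselSeries_pos (z := x ^ 2 / 4) hν0.le (by positivity)
    have h2' := besselSeries_pos (ν := ν + 1) (z := x ^ 2 / 4) (by linarith) (by positivity)
    have h3 := h2p (-ν)
    positivity
  · have hx0 : 0 < x := zero_lt_one.trans_le hx
    -- The rate 1/2 arises here: -K_ν' ≥ K_ν because cosh ≥ 1, and the factor √x gives back at most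
    -- 1/(2x) ≤ 1/2.
    rw [eΦ, sqrtBesselKDeriv]
    have h1 := coshIntegral_le_succ 0 hμ hx0
    have h2 : (2 * x)⁻¹ ≤ 1 / 2 := by
      rw [one_div]
      exact inv_anti₀ zero_lt_two (by linarith)
    have h3 := coshIntegral_pos 0 hμ hx0
    have h4 := mul_le_mul_of_nonneg_right h2 h3.le
    have h5 : (2 * x)⁻¹ * coshIntegral 0 ν x - coshIntegral 1 ν x ≤ -(1 / 2) * coshIntegral 0 ν x := by
      rw [zero_add] at h1
      linarith
    have h6 := mul_le_mul_of_nonneg_left h5 (Real.sqrt_nonneg x)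
    linarith
  · refine (tendsto_rpow_mul_besselK hν0).congr' ?_
    filter_upwards [self_mem_nhdsWithin] with x (hx : 0 < x)
    rw [eΦ, coshIntegral_zero, ← mul_assoc, Real.sqrt_eq_rpow, ← Real.rpow_add hx, hαν]
    congr 2
    ring
  · have h := tendsto_besselK_second hν0 hν1
    -- The second coefficient of K_ν written as -κ times the leading one, which is the form required
    -- by `SolPair`.
    have e : -(2 ^ (-ν - 1) * Real.Gamma (1 - ν) / ν) =
        -(2 ^ (-(1 + α)) * Real.Gamma (1 - ν) / (ν * Real.Gamma ν) *
          (2 ^ (ν - 1) * Real.Gamma ν)) := by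
      have : (2 : ℝ) ^ (-ν - 1) = 2 ^ (-(1 + α)) * 2 ^ (ν - 1) := by
        rw [← Real.rpow_add zero_lt_two]; congr 1; rw [hν]; ring
      rw [this]
      field_simp
    rw [e] at h
    refine h.congr' ?_
    filter_upwards [self_mem_nhdsWithin] with x (hx : 0 < x)
    have e1 : x ^ (-(1 + α / 2)) * √x = x ^ ν * (x ^ (2 * ν))⁻¹ := by
      rw [Real.sqrt_eq_rpow, ← Real.rpow_neg hx.le, ← Real.rpow_add hx, ← Real.rpow_add hx, hαν]
      congr 1
      ring
    have e2 : x ^ (-(1 + α / 2)) * x ^ (-(α / 2)) = (x ^ (2 * ν))⁻¹ := by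
      rw [← Real.rpow_neg hx.le, ← Real.rpow_add hx, hαν]
      congr 1
      ring
    rw [eΦ, coshIntegral_zero, div_eq_mul_inv]
    linear_combination -besselK ν x * e1 + 2 ^ (ν - 1) * Real.Gamma ν * e2
  · have hc : Tendsto (fun x : ℝ => 2 ^ (-ν) * besselSeries ν (x ^ 2 / 4)) (𝓝[>] 0)
        (𝓝 (2 ^ (-ν) * (Real.Gamma (ν + 1))⁻¹)) := by
      have h1 : Continuous (besselSeries ν) := continuous_iff_continuousAt.mpr fun z =>
        (hasDerivAt_besselSeries hν0.le z).continuousAt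
      have h2 : Continuous fun x : ℝ => 2 ^ (-ν) * besselSeries ν (x ^ 2 / 4) := by fun_prop
      have h3 := (h2.tendsto 0).mono_left (nhdsWithin_le_nhds (s := Ioi 0))
      simpa [besselSeries_zero] using h3
    refine hc.congr' ?_
    filter_upwards [self_mem_nhdsWithin] with x (hx : 0 < x)
    have e1 : x ^ (-(1 + α / 2)) * x ^ (ν + 1 / 2) = 1 := by
      rw [← Real.rpow_add hx, hαν]
      ring_nf
      exact Real.rpow_zero x
    rw [eF x hx]
    linear_combination -(2 ^ (-ν) * besselSeries ν (x ^ 2 / 4)) * e1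

theorem wronskian_zero {α : ℝ} (hα0 : 0 ≤ α) :
    wronskian α 0 = 2 ^ ((1 + α) / 2 - 1) * Real.Gamma ((1 + α) / 2) *
      (2 ^ (-((1 + α) / 2)) * (Real.Gamma ((1 + α) / 2 + 1))⁻¹) * (1 + α) := by
  have hν0 : 0 < (1 + α) / 2 := by positivity
  have hg := (Real.Gamma_pos_of_pos hν0).ne'
  rw [wronskian, if_pos rfl, Real.Gamma_add_one hν0.ne', Real.rpow_sub_one two_ne_zero,
    Real.rpow_neg zero_le_two]
  have := (Real.rpow_pos_of_pos zero_lt_two ((1 + α) / 2)).ne'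
  field_simp

/-! ### Boundary values on a half-line -/

namespace HalfLineData

variable {α : ℝ} {k : ℤ} {U : Set ℝ} {hU : IsOpen U} {h0 : (0 : ℝ) ∉ U} {a κ : ℝ}

/-- `g = φ + c₁ Ψ̃ + c₀ Φ̃` with `φ` in the domain of the closure of the minimal operator. -/
def Rep (H : HalfLineData α k hU h0 a κ) (g φ : L2 U) (c₀ c₁ : ℂ) : Prop :=
  φ ∈ (minOp α k hU h0).closure.domain ∧
    g = φ + c₁ • H.memLp_Psi.toLp (PsiT α k) + c₀ • H.memLp_Phi.toLp (PhiT α k)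

theorem rep_ae (H : HalfLineData α k hU h0 a κ) (φ : L2 U) (c₀ c₁ : ℂ) :
    (φ + c₁ • H.memLp_Psi.toLp (PsiT α k) + c₀ • H.memLp_Phi.toLp (PhiT α k) : L2 U)
      =ᵐ[volume.restrict U] fun x => φ x + c₁ * PsiT α k x + c₀ * PhiT α k x := by
  filter_upwards [Lp.coeFn_add (φ + c₁ • H.memLp_Psi.toLp (PsiT α k))
      (c₀ • H.memLp_Phi.toLp (PhiT α k)), Lp.coeFn_add φ (c₁ • H.memLp_Psi.toLp (PsiT α k)),
    Lp.coeFn_smul c₁ (H.memLp_Psi.toLp (PsiT α k)), Lp.coeFn_smul c₀ (H.memLp_Phi.toLp (PhiT α k)),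
    H.memLp_Psi.coeFn_toLp, H.memLp_Phi.coeFn_toLp] with x h1 h2 h3 h4 h5 h6
  rw [h1, Pi.add_apply, h2, Pi.add_apply, h3, h4, Pi.smul_apply, Pi.smul_apply, h5, h6, smul_eq_mul,
    smul_eq_mul]

theorem rep_iff (H : HalfLineData α k hU h0 a κ) (g φ : L2 U) (c₀ c₁ : ℂ) :
    H.Rep g φ c₀ c₁ ↔ φ ∈ (minOp α k hU h0).closure.domain ∧
      g =ᵐ[volume.restrict U] fun x => φ x + c₁ * PsiT α k x + c₀ * PhiT α k x :=
  and_congr_right fun _ => ⟨fun h => h ▸ H.rep_ae φ c₀ c₁,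
    fun h => Lp.ext (h.trans (H.rep_ae φ c₀ c₁).symm)⟩

theorem Rep.unique {H : HalfLineData α k hU h0 a κ} {g φ ψ : L2 U} {c₀ c₁ d₀ d₁ : ℂ}
    (h : H.Rep g φ c₀ c₁) (h' : H.Rep g ψ d₀ d₁) : φ = ψ ∧ c₀ = d₀ ∧ c₁ = d₁ := by
  obtain ⟨e1, e2, e3⟩ := H.deficiency.rep_eq_zero (c₀ := c₀ - d₀) (c₁ := c₁ - d₁)
    (Submodule.sub_mem _ h.1 h'.1) (by
      have := h.2.symm.trans h'.2
      rw [sub_smul, sub_smul]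
      rw [← sub_eq_zero] at this
      rw [← this]
      abel)
  exact ⟨sub_eq_zero.mp e1, sub_eq_zero.mp e2, sub_eq_zero.mp e3⟩

theorem exists_rep (H : HalfLineData α k hU h0 a κ) {g : L2 U}
    (hg : g ∈ (minOp α k hU h0).adjoint.domain) : ∃ φ c₀ c₁, H.Rep g φ c₀ c₁ := by
  obtain ⟨φ, hφ, c₀, c₁, h⟩ := H.deficiency.exists_rep hg
  exact ⟨φ, c₀, c₁, hφ, h⟩

theorem Rep.mem_adjoint {H : HalfLineData α k hU h0 a κ} {g φ : L2 U} {c₀ c₁ : ℂ}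
    (h : H.Rep g φ c₀ c₁) : g ∈ (minOp α k hU h0).adjoint.domain := by
  rw [h.2]
  exact H.deficiency.mem_adjoint_of_rep h.1 c₀ c₁

theorem normSqPhi_eq (H : HalfLineData α k hU h0 a κ) :
    ‖H.memLp_Phi.toLp (PhiT α k)‖ ^ 2 = normSqPhi α k := by
  rw [norm_sq_toLp, H.normSq]

theorem normSqPhi_pos (H : HalfLineData α k hU h0 a κ) : 0 < normSqPhi α k := by
  rw [← H.normSqPhi_eq]
  have := norm_pos_iff.mpr H.deficiency.phi_ne
  positivity

/-- The ratio of the boundary value `g₁` to the coefficient `c₁`, up to the factor `a`. -/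
def slope (α : ℝ) (k : ℤ) (a : ℝ) : ℝ := normSqPhi α k / (a ^ 2 * (1 + α))

/-- The boundary values add up: none from φ, (0, ‖Φ‖²/(a(1+α))) from Ψ̃, and (a, -κa) from Φ̃. -/
theorem Rep.hasLimits {H : HalfLineData α k hU h0 a κ} (ha : a ≠ 0) {g φ : L2 U} {c₀ c₁ : ℂ}
    (h : H.Rep g φ c₀ c₁) : HasLimits α g (a * c₀) (a * (slope α k a * c₁ - κ * c₀)) := by
  have h1 := ((H.limits_closure φ h.1).add
    ((H.limits_Psi.hasLimits H.memLp_Psi.coeFn_toLp).smul c₁)).add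
    ((H.limits_Phi.hasLimits H.memLp_Phi.coeFn_toLp).smul c₀)
  rw [← h.2] at h1
  have ha' : (a : ℂ) ≠ 0 := Complex.ofReal_ne_zero.mpr ha
  convert h1 using 1
  · ring
  · rw [slope]
    push_cast
    field_simp
    ring

theorem form_iff (H : HalfLineData α k hU h0 a κ) (hα : 0 ≤ α) (ha : a ≠ 0)
    (hcl : (0 : ℝ) ∈ closure U) {g φ : L2 U} {c₀ c₁ : ℂ} (h : H.Rep g φ c₀ c₁) :
    MemFormDomain (minOp α k hU h0) g ↔ c₀ = 0 := by
  rw [h.2]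
  refine H.deficiency.memFormDomain_rep_iff (fun ψ hψ d₀ d₁ hm => ?_) h.1 c₀ c₁
  have := eq_zero_of_memFormDomain hα hU h0 hcl hm (Rep.hasLimits (H := H) ha ⟨hψ, rfl⟩)
  exact (mul_eq_zero.mp this).resolve_left (Complex.ofReal_ne_zero.mpr ha)

/-- The abstract Green formula rewritten in boundary values: ‖Φ‖² = a²m(1+α) with m the slope, and
the terms in κ cancel because κ is real. -/
theorem green (H : HalfLineData α k hU h0 a κ) (hα : 0 ≤ α) (ha : a ≠ 0)
    (hcl : (0 : ℝ) ∈ closure U) (g f : (minOp α k hU h0).adjoint.domain) {g₀ g₁ f₀ f₁ : ℂ}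
    (hg : HasLimits α (g : L2 U) g₀ g₁) (hf : HasLimits α (f : L2 U) f₀ f₁) :
    inner ℂ ((minOp α k hU h0).adjoint g) (f : L2 U) -
      inner ℂ (g : L2 U) ((minOp α k hU h0).adjoint f) =
      ((1 + α : ℝ) : ℂ) * (conj g₁ * f₀ - conj g₀ * f₁) := by
  obtain ⟨φ, c₀, c₁, hφ⟩ := H.exists_rep g.2
  obtain ⟨χ, d₀, d₁, hχ⟩ := H.exists_rep f.2
  rw [H.deficiency.green hφ.1 hχ.1 hφ.2 hχ.2, H.normSqPhi_eq]
  obtain ⟨rfl, rfl⟩ := hg.unique hU hcl (hφ.hasLimits ha)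
  obtain ⟨rfl, rfl⟩ := hf.unique hU hcl (hχ.hasLimits ha)
  have ha' : (a : ℂ) ≠ 0 := Complex.ofReal_ne_zero.mpr ha
  have hα' : (1 + α : ℂ) ≠ 0 := by exact_mod_cast (by positivity : (1 + α) ≠ 0)
  rw [slope]
  simp only [map_mul, map_sub, Complex.conj_ofReal]
  push_cast
  field_simp
  ring

end HalfLineData

/-! ### Boundary values on the bilateral fibre -/

theorem orthSum_apply_of_eq {E F : Type*} [NormedAddCommGroup E] [InnerProductSpace ℂ E]
    [NormedAddCommGroup F] [InnerProductSpace ℂ F] {A : E →ₗ.[ℂ] E} {B : F →ₗ.[ℂ] F}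
    {T : WithLp 2 (E × F) →ₗ.[ℂ] WithLp 2 (E × F)} (h : T = orthSum A B) (x : T.domain) :
    ∃ (h1 : (x : WithLp 2 (E × F)).fst ∈ A.domain) (h2 : (x : WithLp 2 (E × F)).snd ∈ B.domain),
      T x = WithLp.toLp 2 (A ⟨_, h1⟩, B ⟨_, h2⟩) := by
  subst h
  exact ⟨x.2.1, x.2.2, rfl⟩

theorem eq_of_le_of_domain_eq' {E : Type*} [NormedAddCommGroup E] [InnerProductSpace ℂ E]
    {A B T : E →ₗ.[ℂ] E} (hA : A ≤ T) (hB : B ≤ T) (h : ∀ x, x ∈ A.domain ↔ x ∈ B.domain) : A = B := by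
  have hd : A.domain = B.domain := Submodule.ext h
  refine LinearPMap.eq_of_le_of_domain_eq ⟨hd.le, fun x y hxy => ?_⟩ hd
  rw [hA.2 (y := ⟨x, hA.1 x.2⟩) rfl, hB.2 (y := ⟨x, hA.1 x.2⟩) hxy.symm]

theorem zero_mem_closure_Ioi : (0 : ℝ) ∈ closure (Ioi (0 : ℝ)) := by simp

theorem zero_mem_closure_Iio : (0 : ℝ) ∈ closure (Iio (0 : ℝ)) := by simp

theorem memLp_of_memLp_half {f : ℝ → ℂ} (h1 : MemLp f 2 (volume.restrict (Iio 0)))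
    (h2 : MemLp f 2 (volume.restrict (Ioi 0))) : MemLp f 2 volume := by
  have hv : (volume : Measure ℝ).restrict (Iio 0 ∪ Ioi 0) = volume := by
    rw [Iio_union_Ioi]
    exact Measure.restrict_eq_self_of_ae_mem (by simp [ae_iff])
  have hm : AEStronglyMeasurable f volume := by
    rw [← hv]
    exact aestronglyMeasurable_union_iff.mpr ⟨h1.1, h2.1⟩
  rw [memLp_two_iff_integrable_sq_norm hm, ← hv]
  exact IntegrableOn.union
    (show IntegrableOn _ _ volume from (memLp_two_iff_integrable_sq_norm h1.1).mp h1)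
    ((memLp_two_iff_integrable_sq_norm h2.1).mp h2)

section Fibre

variable {α : ℝ} {k : ℤ} {a κ : ℝ}

/-- The boundary values of an element of the fibre. -/
def Trace (α : ℝ) (g : Fibre) (t : (ℂ × ℂ) × (ℂ × ℂ)) : Prop :=
  HasLimits α g.fst t.1.1 t.2.1 ∧ HasLimits α g.snd t.1.2 t.2.2

theorem Trace.unique {g : Fibre} {t s : (ℂ × ℂ) × (ℂ × ℂ)} (ht : Trace α g t) (hs : Trace α g s) :
    t = s := by
  obtain ⟨h1, h2⟩ := ht.1.unique isOpen_Iio zero_mem_closure_Iio hs.1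
  obtain ⟨h3, h4⟩ := ht.2.unique isOpen_Ioi zero_mem_closure_Ioi hs.2
  exact Prod.ext (Prod.ext h1 h3) (Prod.ext h2 h4)

/-- The elements of the fibre whose boundary values lie in `L`. -/
def bdrySubmodule (α : ℝ) (L : Submodule ℂ ((ℂ × ℂ) × (ℂ × ℂ))) : Submodule ℂ Fibre where
  carrier := {g | ∃ t ∈ L, HasLimits α g.fst t.1.1 t.2.1 ∧ HasLimits α g.snd t.1.2 t.2.2}
  add_mem' := fun ⟨t, ht, h1, h2⟩ ⟨s, hs, h3, h4⟩ =>
    ⟨t + s, L.add_mem ht hs, h1.add h3, h2.add h4⟩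
  zero_mem' := ⟨0, L.zero_mem, HasLimits.zero _ _, HasLimits.zero _ _⟩
  smul_mem' := fun c _ ⟨t, ht, h1, h2⟩ => ⟨c • t, L.smul_mem c ht, h1.smul c, h2.smul c⟩

theorem bdryExt_eq (α : ℝ) (k : ℤ) (L : Submodule ℂ ((ℂ × ℂ) × (ℂ × ℂ))) :
    bdryExt α k L = (op α k).adjoint.domRestrict (bdrySubmodule α L) := rfl

theorem mem_bdryExt (L : Submodule ℂ ((ℂ × ℂ) × (ℂ × ℂ))) (g : Fibre) :
    g ∈ (bdryExt α k L).domain ↔ g ∈ (op α k).adjoint.domain ∧ ∃ t ∈ L, Trace α g t :=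
  and_comm

theorem adjoint_op (hα : 0 ≤ α) (k : ℤ) :
    (op α k).adjoint = orthSum (opNeg α k).adjoint (opPos α k).adjoint :=
  (isNonnegSymm_minOp hα k isOpen_Iio self_notMem_Iio).adjoint_orthSum
    (isNonnegSymm_minOp hα k isOpen_Ioi self_notMem_Ioi)

theorem mem_adjoint_op (hα : 0 ≤ α) (k : ℤ) (g : Fibre) : g ∈ (op α k).adjoint.domain ↔
    g.fst ∈ (opNeg α k).adjoint.domain ∧ g.snd ∈ (opPos α k).adjoint.domain := by
  rw [adjoint_op hα]
  rfl

theorem isRep_iff (Hn : HalfLineData α k isOpen_Iio self_notMem_Iio a κ)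
    (Hp : HalfLineData α k isOpen_Ioi self_notMem_Ioi a κ) (g φ : Fibre) (c₀ c₁ : ℂ × ℂ) : IsRep α k g φ c₀ c₁ ↔
    Hn.Rep g.fst φ.fst c₀.1 c₁.1 ∧ Hp.Rep g.snd φ.snd c₀.2 c₁.2 := by
  rw [Hn.rep_iff, Hp.rep_iff, IsRep, opNeg, opPos]
  tauto

theorem exists_isRep (Hn : HalfLineData α k isOpen_Iio self_notMem_Iio a κ)
    (Hp : HalfLineData α k isOpen_Ioi self_notMem_Ioi a κ) (hα : 0 ≤ α) {g : Fibre} (hg : g ∈ (op α k).adjoint.domain) :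
    ∃ φ c₀ c₁, IsRep α k g φ c₀ c₁ := by
  obtain ⟨h1, h2⟩ := (mem_adjoint_op hα k g).mp hg
  obtain ⟨φ, c₀, c₁, h⟩ := Hn.exists_rep h1
  obtain ⟨χ, d₀, d₁, h'⟩ := Hp.exists_rep h2
  exact ⟨WithLp.toLp 2 (φ, χ), (c₀, d₀), (c₁, d₁), (isRep_iff Hn Hp _ _ _ _).mpr ⟨h, h'⟩⟩

theorem mem_adjoint_of_isRep (Hn : HalfLineData α k isOpen_Iio self_notMem_Iio a κ)
    (Hp : HalfLineData α k isOpen_Ioi self_notMem_Ioi a κ) (hα : 0 ≤ α) {g φ : Fibre} {c₀ c₁ : ℂ × ℂ} (h : IsRep α k g φ c₀ c₁) :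
    g ∈ (op α k).adjoint.domain := by
  obtain ⟨h1, h2⟩ := (isRep_iff Hn Hp _ _ _ _).mp h
  exact (mem_adjoint_op hα k g).mpr ⟨h1.mem_adjoint, h2.mem_adjoint⟩

theorem isRep_unique (Hn : HalfLineData α k isOpen_Iio self_notMem_Iio a κ)
    (Hp : HalfLineData α k isOpen_Ioi self_notMem_Ioi a κ) {g φ ψ : Fibre} {c₀ c₁ d₀ d₁ : ℂ × ℂ} (h : IsRep α k g φ c₀ c₁)
    (h' : IsRep α k g ψ d₀ d₁) : φ = ψ ∧ c₀ = d₀ ∧ c₁ = d₁ := by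
  obtain ⟨h1, h2⟩ := (isRep_iff Hn Hp _ _ _ _).mp h
  obtain ⟨h3, h4⟩ := (isRep_iff Hn Hp _ _ _ _).mp h'
  obtain ⟨e1, e2, e3⟩ := h1.unique h3
  obtain ⟨e4, e5, e6⟩ := h2.unique h4
  exact ⟨WithLp.ofLp_injective 2 (Prod.ext e1 e4), Prod.ext e2 e5, Prod.ext e3 e6⟩

theorem trace_of_isRep (Hn : HalfLineData α k isOpen_Iio self_notMem_Iio a κ)
    (Hp : HalfLineData α k isOpen_Ioi self_notMem_Ioi a κ) (ha : a ≠ 0) {g φ : Fibre} {c₀ c₁ : ℂ × ℂ} (h : IsRep α k g φ c₀ c₁) :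
    Trace α g ((a * c₀.1, a * c₀.2), (a * (HalfLineData.slope α k a * c₁.1 - κ * c₀.1),
      a * (HalfLineData.slope α k a * c₁.2 - κ * c₀.2))) := by
  obtain ⟨h1, h2⟩ := (isRep_iff Hn Hp _ _ _ _).mp h
  exact ⟨h1.hasLimits ha, h2.hasLimits ha⟩

/-- Uniqueness of the limits identifies any admissible trace with the one computed from the
representation, so a condition on traces becomes a condition on (c₀, c₁). -/
theorem mem_bdryExt_iff_isRep (Hn : HalfLineData α k isOpen_Iio self_notMem_Iio a κ)
    (Hp : HalfLineData α k isOpen_Ioi self_notMem_Ioi a κ) (hα : 0 ≤ α) (ha : a ≠ 0)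
    {L : Submodule ℂ ((ℂ × ℂ) × (ℂ × ℂ))} {P : ℂ × ℂ → ℂ × ℂ → Prop}
    (hP : ∀ c₀ c₁ : ℂ × ℂ, ((((a * c₀.1, a * c₀.2),
      (a * (HalfLineData.slope α k a * c₁.1 - κ * c₀.1),
        a * (HalfLineData.slope α k a * c₁.2 - κ * c₀.2))) : (ℂ × ℂ) × (ℂ × ℂ)) ∈ L ↔ P c₀ c₁))
    (g : Fibre) : g ∈ (bdryExt α k L).domain ↔
      g ∈ (op α k).adjoint.domain ∧ ∃ φ c₀ c₁, IsRep α k g φ c₀ c₁ ∧ P c₀ c₁ := by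
  rw [mem_bdryExt]
  refine and_congr_right fun hg => ⟨fun ⟨t, ht, hgt⟩ => ?_, fun ⟨φ, c₀, c₁, h, hc⟩ =>
    ⟨_, (hP c₀ c₁).mpr hc, trace_of_isRep Hn Hp ha h⟩⟩
  obtain ⟨φ, c₀, c₁, h⟩ := exists_isRep Hn Hp hα hg
  refine ⟨φ, c₀, c₁, h, (hP c₀ c₁).mp ?_⟩
  rwa [← hgt.unique (trace_of_isRep Hn Hp ha h)]

theorem slope_pos (Hn : HalfLineData α k isOpen_Iio self_notMem_Iio a κ) (hα : 0 ≤ α) (ha : a ≠ 0) : 0 < HalfLineData.slope α k a := by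
  have := Hn.normSqPhi_pos
  unfold HalfLineData.slope
  positivity

theorem isTrace (Hn : HalfLineData α k isOpen_Iio self_notMem_Iio a κ)
    (Hp : HalfLineData α k isOpen_Ioi self_notMem_Ioi a κ) (hα : 0 ≤ α) (ha : a ≠ 0) : IsTrace (op α k) (Trace α) ((1 + α : ℝ) : ℂ) where
  dense := ((isNonnegSymm_minOp hα k isOpen_Iio self_notMem_Iio).orthSum
    (isNonnegSymm_minOp hα k isOpen_Ioi self_notMem_Ioi)).dense
  symm := ((isNonnegSymm_minOp hα k isOpen_Iio self_notMem_Iio).orthSum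
    (isNonnegSymm_minOp hα k isOpen_Ioi self_notMem_Ioi)).symm
  exists_trace := fun g hg => by
    obtain ⟨φ, c₀, c₁, h⟩ := exists_isRep Hn Hp hα hg
    exact ⟨_, trace_of_isRep Hn Hp ha h⟩
  onto := fun ⟨⟨x, y⟩, z, w⟩ => by
    have hm : (HalfLineData.slope α k a : ℂ) ≠ 0 :=
      Complex.ofReal_ne_zero.mpr (slope_pos Hn hα ha).ne'
    have ha' : (a : ℂ) ≠ 0 := Complex.ofReal_ne_zero.mpr ha
    -- Prescribed boundary values are realised with φ = 0, the coefficients solving g₀ = a c₀ and g₁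
    -- = a(m c₁ - κ c₀).
    have h1 : Hn.Rep _ 0 (x / a) ((z + κ * x) / (a * HalfLineData.slope α k a)) :=
      ⟨Submodule.zero_mem _, rfl⟩
    have h2 : Hp.Rep _ 0 (y / a) ((w + κ * y) / (a * HalfLineData.slope α k a)) :=
      ⟨Submodule.zero_mem _, rfl⟩
    have hr := (isRep_iff Hn Hp (WithLp.toLp 2 (_, _)) (WithLp.toLp 2 (0, 0)) (x / a, y / a)
      ((z + κ * x) / (a * HalfLineData.slope α k a), (w + κ * y) / (a * HalfLineData.slope α k a))).mpr
        ⟨h1, h2⟩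
    refine ⟨_, mem_adjoint_of_isRep Hn Hp hα hr, ?_⟩
    convert trace_of_isRep Hn Hp ha hr using 1
    refine Prod.ext (Prod.ext ?_ ?_) (Prod.ext ?_ ?_) <;> simp only <;> field_simp <;> ring
  zero := ⟨HasLimits.zero _ _, HasLimits.zero _ _⟩
  add := fun h h' => ⟨h.1.add h'.1, h.2.add h'.2⟩
  smul := fun c _ _ h => ⟨h.1.smul c, h.2.smul c⟩
  ne := Complex.ofReal_ne_zero.mpr (by positivity)
  green := fun g f t s ht hs => by
    obtain ⟨g1, g2, hg⟩ := orthSum_apply_of_eq (adjoint_op hα k) g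
    obtain ⟨f1, f2, hf⟩ := orthSum_apply_of_eq (adjoint_op hα k) f
    have e1 := Hn.green hα ha zero_mem_closure_Iio ⟨_, g1⟩ ⟨_, f1⟩ ht.1 hs.1
    have e2 := Hp.green hα ha zero_mem_closure_Ioi ⟨_, g2⟩ ⟨_, f2⟩ ht.2 hs.2
    rw [hg, hf, WithLp.prod_inner_apply, WithLp.prod_inner_apply]
    refine (add_sub_add_comm _ _ _ _).trans ((congrArg₂ (· + ·) e1 e2).trans ?_)
    rw [sympl]
    ring

/-- Both operators are restrictions of A*, so only the domains are compared: membership in the form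
domain and vanishing of g₀ on either side both amount to c₀ = 0. -/
theorem friedrichs_eq (Hn : HalfLineData α k isOpen_Iio self_notMem_Iio a κ)
    (Hp : HalfLineData α k isOpen_Ioi self_notMem_Ioi a κ) (hα : 0 ≤ α) (ha : a ≠ 0) :
    orthSum (isNonnegSymm_minOp hα k isOpen_Iio self_notMem_Iio).friedrichs
      (isNonnegSymm_minOp hα k isOpen_Ioi self_notMem_Ioi).friedrichs = bdryExt α k condF := by
  have hF : IsFriedrichsExtension (op α k) _ :=
    (isNonnegSymm_minOp hα k isOpen_Iio self_notMem_Iio).isFriedrichsExtension_orthSum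
      (isNonnegSymm_minOp hα k isOpen_Ioi self_notMem_Ioi)
  refine eq_of_le_of_domain_eq' hF.1 LinearPMap.domRestrict_le fun g => ?_
  rw [hF.2, mem_bdryExt]
  refine and_congr_right fun hg => ?_
  obtain ⟨φ, c₀, c₁, h⟩ := exists_isRep Hn Hp hα hg
  obtain ⟨h1, h2⟩ := (isRep_iff Hn Hp _ _ _ _).mp h
  have ht := trace_of_isRep Hn Hp ha h
  have ha' : (a : ℂ) ≠ 0 := Complex.ofReal_ne_zero.mpr ha
  refine ((isNonnegSymm_minOp hα k isOpen_Iio self_notMem_Iio).memFormDomain_orthSum_iff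
    (isNonnegSymm_minOp hα k isOpen_Ioi self_notMem_Ioi) g).trans ?_
  rw [Hn.form_iff hα ha zero_mem_closure_Iio h1, Hp.form_iff hα ha zero_mem_closure_Ioi h2]
  constructor
  · rintro ⟨e1, e2⟩
    exact ⟨_, (mem_condF _).mpr ⟨by simp [e1], by simp [e2]⟩, ht⟩
  · rintro ⟨t, hL, hgt⟩
    rw [hgt.unique ht, mem_condF] at hL
    exact ⟨(mul_eq_zero.mp hL.1).resolve_left ha', (mul_eq_zero.mp hL.2).resolve_left ha'⟩

end Fibre

/-! ### The relations between the parameters -/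

/-- The parameter relations, in terms of the slope `m` and the shift `κ`. -/
structure ParamRelation (α : ℝ) (k : ℤ) (m κ : ℝ) : Prop where
  one : ∀ β, gammaI α k β = m * β - κ
  two : ∀ z τ, gammaII α k z τ = (1 + ‖z‖ ^ 2) * (m * τ - κ)
  diag : ∀ τ, gammaDiag α k τ = m * τ - κ
  off : ∀ τ, gammaOff α k τ = m * τ

theorem paramRelation_of_ne {α : ℝ} (hα0 : 0 ≤ α) {k : ℤ} (hk : k ≠ 0) :
    ParamRelation α k (HalfLineData.slope α k √(Real.pi * (1 + α) / (2 * |(k : ℝ)|)))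
      (|(k : ℝ)| / (1 + α)) := by
  have hK0 : 0 < |(k : ℝ)| := by positivity
  have hπ := Real.pi_pos
  have hm : HalfLineData.slope α k √(Real.pi * (1 + α) / (2 * |(k : ℝ)|)) =
      |(k : ℝ)| / (1 + α) * (2 * normSqPhi α k / (Real.pi * (1 + α))) := by
    rw [HalfLineData.slope, Real.sq_sqrt (by positivity)]
    field_simp
  rw [hm]
  refine ⟨fun β => ?_, fun z τ => ?_, fun τ => ?_, fun τ => ?_⟩
  · rw [gammaI, if_neg hk]
    ring
  · rw [gammaII, if_neg hk]
    ring
  · rw [gammaDiag, if_neg hk]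
    ring
  · rw [gammaOff, if_neg hk]
    field_simp

/-- Everything reduces to Γ((3+α)/2) = ((1+α)/2) Γ((1+α)/2) and to collecting powers of 2. -/
theorem paramRelation_zero {α : ℝ} (hα0 : 0 ≤ α) (hα1 : α < 1) (hN : normSqPhi α 0 ≠ 0) :
    ParamRelation α 0 (HalfLineData.slope α 0 (2 ^ ((1 + α) / 2 - 1) * Real.Gamma ((1 + α) / 2)))
      (2 ^ (-(1 + α)) * Real.Gamma (1 - (1 + α) / 2) /
        ((1 + α) / 2 * Real.Gamma ((1 + α) / 2))) := by
  have hg : Real.Gamma ((1 + α) / 2) ≠ 0 := (Real.Gamma_pos_of_pos (by positivity)).ne'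
  have hg' : Real.Gamma ((1 - α) / 2) ≠ 0 := (Real.Gamma_pos_of_pos (by linarith)).ne'
  have e1 : Real.Gamma ((3 + α) / 2) = (1 + α) / 2 * Real.Gamma ((1 + α) / 2) := by
    rw [← Real.Gamma_add_one (by positivity)]
    congr 1
    ring
  have e2 : 1 - (1 + α) / 2 = (1 - α) / 2 := by ring
  have e3 : (2 : ℝ) ^ (-(1 + α)) = ((2 : ℝ) ^ α)⁻¹ / 2 := by
    rw [neg_add', ← neg_add_eq_sub, neg_add_eq_sub, Real.rpow_sub zero_lt_two, Real.rpow_neg_one]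
    field_simp
  have e4 : ((2 : ℝ) ^ ((1 + α) / 2 - 1)) ^ 2 = 2 ^ α / 2 := by
    rw [← Real.rpow_natCast, ← Real.rpow_mul zero_le_two,
      show ((1 + α) / 2 - 1) * ((2 : ℕ) : ℝ) = α - 1 by push_cast; ring,
      Real.rpow_sub_one two_ne_zero]
  have h2 : (2 : ℝ) ^ α ≠ 0 := (Real.rpow_pos_of_pos zero_lt_two α).ne'
  have hα : 1 + α ≠ 0 := by positivity
  rw [HalfLineData.slope, mul_pow, e2, e3, e4]
  refine ⟨fun β => ?_, fun z τ => ?_, fun τ => ?_, fun τ => ?_⟩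
  · rw [gammaI, if_pos rfl, e1]
    field_simp
  · rw [gammaII, if_pos rfl, e1]
    field_simp
  · rw [gammaDiag, if_pos rfl, e1]
    field_simp
  · rw [gammaOff, if_pos rfl, e1]
    field_simp

theorem bijective_affine {m κ : ℝ} (hm : m ≠ 0) : Function.Bijective fun β : ℝ => m * β - κ :=
  ⟨fun x y h => mul_left_cancel₀ hm (sub_left_injective h),
    fun y => ⟨(y + κ) / m, by simp only; field_simp; ring⟩⟩

namespace ParamRelation

variable {α : ℝ} {k : ℤ} {m κ : ℝ}

theorem bijective_gammaI (R : ParamRelation α k m κ) (hm : m ≠ 0) :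
    Function.Bijective (gammaI α k) := by
  rw [show gammaI α k = fun β => m * β - κ from funext R.one]
  exact bijective_affine hm

theorem bijective_gammaII (R : ParamRelation α k m κ) (hm : m ≠ 0) (z : ℂ) :
    Function.Bijective (gammaII α k z) := by
  rw [show gammaII α k z = fun τ => (1 + ‖z‖ ^ 2) * m * τ - (1 + ‖z‖ ^ 2) * κ from
    funext fun τ => by rw [R.two]; ring]
  exact bijective_affine (mul_ne_zero (by positivity) hm)

theorem bijective_gammaIII (R : ParamRelation α k m κ) (hm : m ≠ 0) :
    Function.Bijective (gammaIII α k) := by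
  constructor
  · intro x y h
    have h0 := congrFun h 0
    have h1 := congrFun h 1
    have h2 := congrFun h 2
    have h3 := congrFun h 3
    simp only [gammaIII, Matrix.cons_val, R.diag, R.off] at h0 h1 h2 h3
    funext i
    fin_cases i
    · exact (bijective_affine hm).1 h0
    · exact mul_left_cancel₀ hm h1
    · exact mul_left_cancel₀ hm h2
    · exact (bijective_affine hm).1 h3
  · intro y
    refine ⟨![(y 0 + κ) / m, y 1 / m, y 2 / m, (y 3 + κ) / m], ?_⟩
    funext i
    fin_cases i <;> simp [gammaIII, R.diag, R.off] <;> field_simp <;> ring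

end ParamRelation

/-- The boundary values of both half-lines, with the parameter relations. -/
theorem exists_halfLineData {α : ℝ} (hα0 : 0 ≤ α) (hα1 : α < 1) (k : ℤ) :
    ∃ a κ : ℝ, a ≠ 0 ∧ HalfLineData α k isOpen_Iio self_notMem_Iio a κ ∧
      HalfLineData α k isOpen_Ioi self_notMem_Ioi a κ ∧
      ParamRelation α k (HalfLineData.slope α k a) κ := by
  rcases eq_or_ne k 0 with rfl | hk
  · have S := solPair_zero hα0 hα1
    have H := halfLineData_pos S (wronskian_zero hα0)
    exact ⟨_, _, S.a_pos.ne', halfLineData_neg H hα0, H,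
      paramRelation_zero hα0 hα1 H.normSqPhi_pos.ne'⟩
  · have S := solPair_of_ne hα0 hα1 hk
    have H := halfLineData_pos S (wronskian_of_ne hα0 hk)
    exact ⟨_, _, S.a_pos.ne', halfLineData_neg H hα0, H, paramRelation_of_ne hα0 hk⟩

/-! ### The families of extensions in terms of the coefficients -/

section Families

variable {a m κ : ℝ}

theorem coeff_eq_iff (ha : a ≠ 0) (hm : m ≠ 0) (β : ℝ) (x y : ℂ) :
    (a : ℂ) * (m * y - κ * x) = ((m * β - κ : ℝ) : ℂ) * (a * x) ↔ y = β * x := by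
  have ha' : (a : ℂ) ≠ 0 := Complex.ofReal_ne_zero.mpr ha
  have hm' : (m : ℂ) ≠ 0 := Complex.ofReal_ne_zero.mpr hm
  push_cast
  constructor
  · intro h
    refine mul_left_cancel₀ (mul_ne_zero ha' hm') ?_
    linear_combination h
  · rintro rfl
    ring

theorem mem_condF_iff (ha : a ≠ 0) (c₀ c₁ : ℂ × ℂ) :
    (((a * c₀.1, a * c₀.2), (a * (m * c₁.1 - κ * c₀.1), a * (m * c₁.2 - κ * c₀.2))) :
      (ℂ × ℂ) × (ℂ × ℂ)) ∈ condF ↔ c₀.1 = 0 ∧ c₀.2 = 0 := by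
  have ha' : (a : ℂ) ≠ 0 := Complex.ofReal_ne_zero.mpr ha
  simp [mem_condF, ha']

theorem mem_condR_iff (ha : a ≠ 0) (hm : m ≠ 0) (β : ℝ) (c₀ c₁ : ℂ × ℂ) :
    (((a * c₀.1, a * c₀.2), (a * (m * c₁.1 - κ * c₀.1), a * (m * c₁.2 - κ * c₀.2))) :
      (ℂ × ℂ) × (ℂ × ℂ)) ∈ condR (m * β - κ) ↔ c₀.1 = 0 ∧ c₁.2 = β * c₀.2 := by
  have ha' : (a : ℂ) ≠ 0 := Complex.ofReal_ne_zero.mpr ha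
  rw [mem_condR, coeff_eq_iff ha hm]
  simp [ha']

theorem mem_condL_iff (ha : a ≠ 0) (hm : m ≠ 0) (β : ℝ) (c₀ c₁ : ℂ × ℂ) :
    (((a * c₀.1, a * c₀.2), (a * (m * c₁.1 - κ * c₀.1), a * (m * c₁.2 - κ * c₀.2))) :
      (ℂ × ℂ) × (ℂ × ℂ)) ∈ condL (m * β - κ) ↔ c₀.2 = 0 ∧ c₁.1 = β * c₀.1 := by
  have ha' : (a : ℂ) ≠ 0 := Complex.ofReal_ne_zero.mpr ha
  rw [mem_condL, coeff_eq_iff ha hm]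
  simp [ha']

/-- The condition fixes only c₁⁻ + z̄ c₁⁺ = (1+|z|²)τc, which explains the factor in γ. The free
parameter runs along (1, -1/z̄), the kernel of that functional. -/
theorem mem_condII_iff (ha : a ≠ 0) (hm : m ≠ 0) {z : ℂ} (hz : z ≠ 0) (τ : ℝ) (c₀ c₁ : ℂ × ℂ) :
    (((a * c₀.1, a * c₀.2), (a * (m * c₁.1 - κ * c₀.1), a * (m * c₁.2 - κ * c₀.2))) :
      (ℂ × ℂ) × (ℂ × ℂ)) ∈ condII z ((1 + ‖z‖ ^ 2) * (m * τ - κ)) ↔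
      ∃ c ct : ℂ, c₀ = (c, c * z) ∧ c₁ = (τ * c + ct, τ * c * z - ct * (conj z)⁻¹) := by
  have ha' : (a : ℂ) ≠ 0 := Complex.ofReal_ne_zero.mpr ha
  have hm' : (m : ℂ) ≠ 0 := Complex.ofReal_ne_zero.mpr hm
  have hz' : conj z ≠ 0 := (map_ne_zero _).mpr hz
  have hn : ((‖z‖ : ℝ) : ℂ) ^ 2 = conj z * z := by
    rw [← Complex.ofReal_pow, conj_mul_self_eq]
  rw [mem_condII]
  push_cast
  rw [hn]
  constructor
  · rintro ⟨h1, h2⟩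
    have e1 : c₀.2 = c₀.1 * z := by
      refine mul_left_cancel₀ ha' ?_
      linear_combination h1
    have e2 : c₁.1 + conj z * c₁.2 = (1 + conj z * z) * τ * c₀.1 := by
      refine mul_left_cancel₀ (mul_ne_zero ha' hm') ?_
      rw [e1] at h2
      linear_combination h2
    refine ⟨c₀.1, c₁.1 - τ * c₀.1, Prod.ext rfl e1, Prod.ext (by simp) ?_⟩
    refine mul_left_cancel₀ hz' ?_
    simp only
    field_simp
    linear_combination e2
  · rintro ⟨c, ct, rfl, rfl⟩
    refine ⟨by simp only; ring, ?_⟩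
    simp only
    field_simp
    ring

theorem mem_condIII_iff (ha : a ≠ 0) (hm : m ≠ 0) (τ Γ : Fin 4 → ℝ) (h0 : Γ 0 = m * τ 0 - κ)
    (h1 : Γ 1 = m * τ 1) (h2 : Γ 2 = m * τ 2) (h3 : Γ 3 = m * τ 3 - κ) (c₀ c₁ : ℂ × ℂ) :
    (((a * c₀.1, a * c₀.2), (a * (m * c₁.1 - κ * c₀.1), a * (m * c₁.2 - κ * c₀.2))) :
      (ℂ × ℂ) × (ℂ × ℂ)) ∈ condIII Γ ↔ ![c₁.1, c₁.2] = (matT τ).mulVec ![c₀.1, c₀.2] := by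
  have ha' : (a : ℂ) ≠ 0 := Complex.ofReal_ne_zero.mpr ha
  have hm' : (m : ℂ) ≠ 0 := Complex.ofReal_ne_zero.mpr hm
  have hv : ![c₁.1, c₁.2] = (matT τ).mulVec ![c₀.1, c₀.2] ↔
      c₁.1 = τ 0 * c₀.1 + (τ 1 + Complex.I * τ 2) * c₀.2 ∧
      c₁.2 = (τ 1 - Complex.I * τ 2) * c₀.1 + τ 3 * c₀.2 := by
    rw [funext_iff, Fin.forall_fin_two]
    simp [matT, Matrix.mulVec, dotProduct, Fin.sum_univ_two]
  rw [mem_condIII, hv, h0, h1, h2, h3]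
  push_cast
  constructor
  · rintro ⟨e1, e2⟩
    constructor
    · refine mul_left_cancel₀ (mul_ne_zero ha' hm') ?_
      linear_combination e1
    · refine mul_left_cancel₀ (mul_ne_zero ha' hm') ?_
      linear_combination e2
  · rintro ⟨e1, e2⟩
    rw [e1, e2]
    constructor <;> ring

end Families

end Grushin

end

/-! ### The theorem, assembled from the boundary values -/

open Grushin in
theorem mainTheorem8 (α : ℝ) (hα0 : 0 ≤ α) (hα1 : α < 1) (k : ℤ) :
    -- the representation of the elements of the domain of the adjoint
    (MemLp (PhiT α k) 2 volume ∧ MemLp (PsiT α k) 2 volume ∧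
      ∀ g : Fibre,
        (g ∈ (op α k).adjoint.domain →
          ∃! r : Fibre × (ℂ × ℂ) × (ℂ × ℂ), IsRep α k g r.1 r.2.1 r.2.2) ∧
        ((∃ φ c₀ c₁, IsRep α k g φ c₀ c₁) → g ∈ (op α k).adjoint.domain)) ∧
    -- the Friedrichs extension, and the classification
    (∃ AF : Fibre →ₗ.[ℂ] Fibre, IsFriedrichsExtension (op α k) AF ∧
      (∃ AFneg AFpos, IsFriedrichsExtension (opNeg α k) AFneg ∧
        IsFriedrichsExtension (opPos α k) AFpos ∧ AF = orthSum AFneg AFpos) ∧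
      (∀ g : Fibre, g ∈ AF.domain ↔
        g ∈ (op α k).adjoint.domain ∧ ∃ φ c₀ c₁, IsRep α k g φ c₀ c₁ ∧
          c₀.1 = 0 ∧ c₀.2 = 0) ∧
      ∀ B : Fibre →ₗ.[ℂ] Fibre, IsSelfAdjointExtension (op α k) B ↔
        B = AF ∨ (∃ γ : ℝ, B = extR α k γ) ∨ (∃ γ : ℝ, B = extL α k γ) ∨
          (∃ (a : ℂ) (γ : ℝ), a ≠ 0 ∧ B = extII α k a γ) ∨
          (∃ Γ : Fin 4 → ℝ, B = extIII α k Γ)) ∧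
    -- family I_R
    (∀ (β : ℝ) (g : Fibre), g ∈ (extR α k (gammaI α k β)).domain ↔
      g ∈ (op α k).adjoint.domain ∧ ∃ φ c₀ c₁, IsRep α k g φ c₀ c₁ ∧
        c₀.1 = 0 ∧ c₁.2 = β * c₀.2) ∧
    -- family I_L
    (∀ (β : ℝ) (g : Fibre), g ∈ (extL α k (gammaI α k β)).domain ↔
      g ∈ (op α k).adjoint.domain ∧ ∃ φ c₀ c₁, IsRep α k g φ c₀ c₁ ∧
        c₀.2 = 0 ∧ c₁.1 = β * c₀.1) ∧
    -- family II_a with a ≠ 0; for a = 0 it is family I_L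
    (∀ (a : ℂ), a ≠ 0 → ∀ (τ : ℝ) (g : Fibre), g ∈ (extII α k a (gammaII α k a τ)).domain ↔
      g ∈ (op α k).adjoint.domain ∧ ∃ (φ : Fibre) (c₀ ct₀ : ℂ),
        IsRep α k g φ (c₀, c₀ * a)
          (τ * c₀ + ct₀, τ * c₀ * a - ct₀ * ((starRingEnd ℂ) a)⁻¹)) ∧
    (∀ γ : ℝ, extII α k 0 γ = extL α k γ) ∧
    -- family III
    (∀ (τ : Fin 4 → ℝ) (g : Fibre), g ∈ (extIII α k (gammaIII α k τ)).domain ↔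
      g ∈ (op α k).adjoint.domain ∧ ∃ φ c₀ c₁, IsRep α k g φ c₀ c₁ ∧
        ![c₁.1, c₁.2] = (matT τ).mulVec ![c₀.1, c₀.2]) ∧
    -- the two sets of parameters are in one-to-one correspondence
    (Function.Bijective (gammaI α k) ∧ (∀ a : ℂ, Function.Bijective (gammaII α k a)) ∧
      Function.Bijective (gammaIII α k)) := by
  obtain ⟨a, κ, ha, Hn, Hp, R⟩ := exists_halfLineData hα0 hα1 k
  have hm := (slope_pos Hn hα0 ha).ne'
  refine ⟨⟨memLp_of_memLp_half Hn.memLp_Phi Hp.memLp_Phi,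
    memLp_of_memLp_half Hn.memLp_Psi Hp.memLp_Psi, fun g => ⟨fun hg => ?_, ?_⟩⟩,
    ⟨bdryExt α k condF, ?_, ?_, mem_bdryExt_iff_isRep Hn Hp hα0 ha (mem_condF_iff ha), fun B => ?_⟩,
    fun β => ?_, fun β => ?_, fun z hz τ g => ?_, fun γ => ?_, fun τ => ?_,
    R.bijective_gammaI hm, R.bijective_gammaII hm, R.bijective_gammaIII hm⟩
  · obtain ⟨φ, c₀, c₁, h⟩ := exists_isRep Hn Hp hα0 hg
    refine ⟨(φ, c₀, c₁), h, fun r hr => ?_⟩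
    obtain ⟨e1, e2, e3⟩ := isRep_unique Hn Hp hr h
    exact Prod.ext e1 (Prod.ext e2 e3)
  · rintro ⟨φ, c₀, c₁, h⟩
    exact mem_adjoint_of_isRep Hn Hp hα0 h
  · rw [← friedrichs_eq Hn Hp hα0 ha]
    exact (isNonnegSymm_minOp hα0 k isOpen_Iio self_notMem_Iio).isFriedrichsExtension_orthSum
      (isNonnegSymm_minOp hα0 k isOpen_Ioi self_notMem_Ioi)
  · exact ⟨_, _, (isNonnegSymm_minOp hα0 k isOpen_Iio self_notMem_Iio).isFriedrichsExtension,
      (isNonnegSymm_minOp hα0 k isOpen_Ioi self_notMem_Ioi).isFriedrichsExtension,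
      (friedrichs_eq Hn Hp hα0 ha).symm⟩
  -- Each family is by definition the restriction of A* to one of the Lagrangian planes, so the
  -- classification of planes is that of the extensions.
  · rw [(isTrace Hn Hp hα0 ha).isSelfAdjointExtension_iff (bdrySubmodule α) (fun _ _ => Iff.rfl)]
    simp only [isLagrangian_iff, ← bdryExt_eq]
    constructor
    · rintro ⟨L, rfl | ⟨γ, rfl⟩ | ⟨γ, rfl⟩ | ⟨z, γ, hz, rfl⟩ | ⟨Γ, rfl⟩, rfl⟩
      · exact Or.inl rfl
      · exact Or.inr (Or.inl ⟨γ, rfl⟩)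
      · exact Or.inr (Or.inr (Or.inl ⟨γ, rfl⟩))
      · exact Or.inr (Or.inr (Or.inr (Or.inl ⟨z, γ, hz, rfl⟩)))
      · exact Or.inr (Or.inr (Or.inr (Or.inr ⟨Γ, rfl⟩)))
    · rintro (rfl | ⟨γ, rfl⟩ | ⟨γ, rfl⟩ | ⟨z, γ, hz, rfl⟩ | ⟨Γ, rfl⟩)
      · exact ⟨_, Or.inl rfl, rfl⟩
      · exact ⟨_, Or.inr (Or.inl ⟨γ, rfl⟩), rfl⟩
      · exact ⟨_, Or.inr (Or.inr (Or.inl ⟨γ, rfl⟩)), rfl⟩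
      · exact ⟨_, Or.inr (Or.inr (Or.inr (Or.inl ⟨z, γ, hz, rfl⟩))), rfl⟩
      · exact ⟨_, Or.inr (Or.inr (Or.inr (Or.inr ⟨Γ, rfl⟩))), rfl⟩
  · rw [R.one]
    exact mem_bdryExt_iff_isRep Hn Hp hα0 ha (mem_condR_iff ha hm β)
  · rw [R.one]
    exact mem_bdryExt_iff_isRep Hn Hp hα0 ha (mem_condL_iff ha hm β)
  · rw [R.two]
    refine (mem_bdryExt_iff_isRep Hn Hp hα0 ha (L := condII z _)
      (mem_condII_iff ha hm hz τ) g).trans (and_congr_right fun _ => ?_)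
    constructor
    · rintro ⟨φ, c₀, c₁, h, c, ct, rfl, rfl⟩
      exact ⟨φ, c, ct, h⟩
    · rintro ⟨φ, c, ct, h⟩
      exact ⟨φ, _, _, h, c, ct, rfl, rfl⟩
  · exact congrArg (bdryExt α k) (condII_zero γ)
  · exact mem_bdryExt_iff_isRep Hn Hp hα0 ha (L := condIII _)
      (mem_condIII_iff ha hm τ _ (R.diag _) (R.off _) (R.off _) (R.diag _))
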